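/- **Network.** Consider a resource sharing network with resources $i\in\{1,\dots,I\}$, capacities $C_i$, and job types $j\in\{1,\dots,J\}$ with holding costs $h_j>0$. Let $N_j$ be the set of resources that work on type $j$, and let $K$ be the $I\times J$ matrix with $K_{ij}=1$ if $i\in N_j$ and $K_{ij}=0$ otherwise; write $K_j$ for its $j$-th column. Distinct job types have distinct sets $N_j$. Let $\mathcal S^1=\{j:|N_j|=1\}$, and assume *local traffic*: $\bigcup_{j\in\mathcal S^1}N_j=\{1,\dots,I\}$. In the $r$-th network ($r>0$) the inter-arrival times and job sizes of type $j$ are exponential with rates $\lambda_j^r>0$ and $\mu_j^r>0$, all independent. Put $\varrho_j^r=\lambda_j^r/\mu_j^r$. Assume *heavy traffic*: $K\varrho^r<C$ for all $r>0$; $\lambda_j^r\to\lambda_j\in(0,\infty)$ and $\mu_j^r\to\mu_j\in(0,\infty)$ as $r\to\infty$; with $\varrho_j=\lambda_j/\mu_j$, $K\varrho=C$; and $r(\varrho-\varrho^r)\to\beta^*$ with $K\beta^*>0$. (Vector inequalities are componentwise.) **Viable ranking.** Let $G=K\,\mathrm{diag}(1/\mu_j)$ with columns $g_j$, and $\mathcal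 C(w)=\inf\{h\cdot q:q\in\mathbb R_+^J,\ Gq=w\}$ for $w\in\mathbb R_+^I$. Let $\mathcal S^p=\{j:\mathcal C(g_j)<h_j\}$, $\mathcal S^m=\{1,\dots,J\}\setminus(\mathcal S^p\cup\mathcal S^1)$ and $m=|\mathcal S^m|$. Assume that $\rho:\{1,\dots,m\}\to\mathcal S^m$ is a *viable ranking*: a bijection such that for every $k$, with $F_k=\{\rho(1),\dots,\rho(k-1)\}$ and $E_k=\mathcal S^m\setminus F_k$, $$\mu_{\rho(k)}h_{\rho(k)}+\mathcal C\Big(\sum_{l\in M}K_l-K_{\rho(k)}\Big)\le\mathcal C\Big(\sum_{l\in M}K_l\Big)$$ for every $M\subset(E_k\cup\mathcal S^1)\setminus\{\rho(k)\}$ which is minimal with $N_{\rho(k)}\subset\bigcup_{l\in M}N_l$ and satisfies $N_l\not\subset\bigcup_{l'\in M}N_{l'}$ for all $l\in F_k$. Let $\zeta_i^k=\{j\notin F_{k+1}:i\in N_j\}$. **Policy.** Fix $0<\alpha<1/2$, $0<c_1<c_2$, and let $\delta=\min_j\varrho_j/(2J)$. Given the queue length process $Q^r(t)$, let $\sigma(t)=\{j:Q_j^r(t)\ge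 c_2r^\alpha\}$ and define $y(t)$ as follows. * For $j\in\mathcal S^p$: $y_j=\varrho_j+\delta$ if $j\in\sigma$, and $y_j=\varrho_j-\delta/(J2^{m+3})$ otherwise. * For $j=\rho(k)$: $y_j=\varrho_j-2^{k-m-2}\delta$ if $\zeta_i^k\cap\sigma\ne\emptyset$ for all $i\in N_j$; otherwise $y_j=\varrho_j+2^{k-m-2}\delta$ if $j\in\sigma$, and $y_j=\varrho_j-2^{-k-m-2}\delta$ if $j\notin\sigma$. * For $j\in\mathcal S^1$ with $N_j=\{i\}$: $y_j=C_i-\sum_{l\ne j:\,i\in N_l}y_l$ if $i\in\bigcup_{l\in\sigma}N_l$, and $y_j=\varrho_j-\delta$ otherwise. Let $\mathcal E_j^r(t)\in\{0,1\}$ be the depletion indicator with initial state $z_j$. It becomes $1$ as soon as $Q_j^r<c_1r^\alpha$ and returns to $0$ as soon as $Q_j^r\ge c_2r^\alpha$; both rules also apply at time $0$, so an initial value $z_j$ that contradicts them is corrected immediately. Jobs of type $j$ are served at rate $x_j(t)=y_j(t)1_{\{\mathcal E_j^r(t)=0\}}$. Thus, with $A_j^r$ and $S_j^r$ the Poisson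 processes that count arrivals and completed job sizes of type $j$, $$Q_j^r(t)=Q_j^r(0)+A_j^r(t)-S_j^r\Big(\int_0^tx_j(s)\,ds\Big).$$ **Workload.** Let $\hat W_i^r(t)=\frac1r\sum_jK_{ij}Q_j^r(r^2t)/\mu_j^r$. For $x=(\hat q,z)$ in $\mathcal S^r=(\frac1r\mathbb N_0)^J\times\{0,1\}^J$ let $E_x$ be the expectation when $Q^r(0)=r\hat q$ and the initial depletion state is $z$. With $c_3=2Jc_2/\min_j\mu_j$ put $$\check\tau_i^r=\inf\{t\ge0:|\hat W_i^r(t)|\le2c_3\},\qquad V_i(x)=V_i^{r,\beta}(x)=E_x\big[e^{\beta\check\tau_i^r}\big].$$ **Theorem.** There exist $\beta,\gamma,R,H\in(0,\infty)$ such that for all $r\ge R$, all $x\in\mathcal S^r$ and all $i\in\{1,\dots,I\}$, $V_i(x)<\infty$ and, for all $t\ge0$, $$E_x\big[e^{\gamma\hat W_i^r(t)}\big]\le H\big(1+e^{-\beta t}V_i(x)\big).$$ -/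

import Mathlib

open Set Filter Topology MeasureTheory ProbabilityTheory
open scoped BigOperators ENNReal Matrix

noncomputable section

/-- Data of a sequence (indexed by the scaling parameter `r > 0`) of resource sharing networks with
resources `Fin I` and job types `Fin J`. -/
structure Network (I J : ℕ) where
  /-- `res j` is the set `N_j` of resources that work on job type `j` -/
  res : Fin J → Finset (Fin I)
  /-- capacities of the resources -/
  C : Fin I → ℝ
  /-- holding costs of the job types -/
  h : Fin J → ℝ
  /-- arrival rates `lamR r j` of the `r`-th network -/
  lamR : ℝ → Fin J → ℝ
  /-- job size rates `muR r j` of the `r`-th network -/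
  muR : ℝ → Fin J → ℝ
  /-- limiting arrival rates -/
  lam : Fin J → ℝ
  /-- limiting job size rates -/
  mu : Fin J → ℝ

namespace Network

variable {I J : ℕ} (N : Network I J)

/-- The `0`-`1` incidence matrix. -/
def K : Matrix (Fin I) (Fin J) ℝ := Matrix.of fun i j => if i ∈ N.res j then 1 else 0

/-- The limiting loads `ϱ_j = λ_j / μ_j`. -/
def load (j : Fin J) : ℝ := N.lam j / N.mu j

/-- The loads `ϱ_j^r = λ_j^r / μ_j^r`. -/
def loadR (r : ℝ) (j : Fin J) : ℝ := N.lamR r j / N.muR r j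

/-- The matrix `G = K M` with `M = diag(1/μ_j)`. -/
def G : Matrix (Fin I) (Fin J) ℝ := N.K * Matrix.diagonal fun j => 1 / N.mu j

/-- The matrix `G^r = K M^r` with `M^r = diag(1/μ_j^r)`. -/
def GR (r : ℝ) : Matrix (Fin I) (Fin J) ℝ := N.K * Matrix.diagonal fun j => 1 / N.muR r j

/-- Job types that use exactly one resource. -/
def S1 : Set (Fin J) := {j | ∑ i, N.K i j = 1}

/-- Different job types use different sets of resources, rates and holding costs are positive. -/
structure Basic : Prop where
  distinct : ∀ j k, N.res j = N.res k → j = k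
  h_pos : ∀ j, 0 < N.h j
  lamR_pos : ∀ r, 0 < r → ∀ j, 0 < N.lamR r j
  muR_pos : ∀ r, 0 < r → ∀ j, 0 < N.muR r j

/-- Local traffic: every resource has a job type that uses only this resource. -/
def LocalTraffic : Prop := ⋃ j ∈ N.S1, (N.res j : Set (Fin I)) = univ

/-- The heavy traffic condition. -/
structure HeavyTraffic : Prop where
  subcritical : ∀ r, 0 < r → ∀ i, (N.K *ᵥ N.loadR r) i < N.C i
  lam_pos : ∀ j, 0 < N.lam j
  mu_pos : ∀ j, 0 < N.mu j
  lam_tendsto : ∀ j, Tendsto (fun r => N.lamR r j) atTop (𝓝 (N.lam j))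
  mu_tendsto : ∀ j, Tendsto (fun r => N.muR r j) atTop (𝓝 (N.mu j))
  critical : N.C = N.K *ᵥ N.load
  drift : ∃ b : Fin J → ℝ,
    (∀ j, Tendsto (fun r => r * (N.load j - N.loadR r j)) atTop (𝓝 (b j))) ∧
    ∀ i, 0 < (N.K *ᵥ b) i

/-- The workload cost `𝒞(w) = inf {h · q : q ≥ 0, G q = w}`. -/
def cost (w : Fin I → ℝ) : ℝ :=
  sInf {c | ∃ q : Fin J → ℝ, (∀ j, 0 ≤ q j) ∧ N.G *ᵥ q = w ∧ c = ∑ j, N.h j * q j}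

/-- Primary job types. -/
def Sp : Set (Fin J) := {j | N.cost (fun i => N.G i j) < N.h j}

/-- Secondary job types. -/
def Ss : Set (Fin J) := N.Spᶜ

/-- Secondary job types that do not use exactly one resource. -/
def Sm : Set (Fin J) := N.Ss \ N.S1

/-- The set of resources associated with the job types in `M`. -/
def cover (M : Finset (Fin J)) : Finset (Fin I) := M.biUnion N.res

/-- `M` is a minimal set of job types in `E \ {k}` whose resources cover those of `k`. -/
def IsMinCover (E : Set (Fin J)) (k : Fin J) (M : Finset (Fin J)) : Prop :=
  (M : Set (Fin J)) ⊆ E \ {k} ∧ N.res k ⊆ N.cover M ∧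
    ∀ l ∈ M, ¬ N.res k ⊆ N.cover (M.erase l)

/-- The set `𝒪_F^E`: those `j ∈ E` such that
`μ_j h_j + 𝒞(∑_{l ∈ M} K_l - K_j) ≤ 𝒞(∑_{l ∈ M} K_l)` for every minimal covering set `M` of `j`
in `E ∪ S1` that does not cover any job type in `F`. -/
def optSet (E F : Set (Fin J)) : Set (Fin J) :=
  {j | j ∈ E ∧ ∀ M : Finset (Fin J), N.IsMinCover (E ∪ N.S1) j M →
    (∀ l ∈ F, ¬ N.res l ⊆ N.cover M) →
    N.mu j * N.h j + N.cost (fun i => ∑ l ∈ M, N.K i l - N.K i j)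
      ≤ N.cost (fun i => ∑ l ∈ M, N.K i l)}

/-- A viable ranking of the job types in `Sm`. Ranks start at `0` here, so that `ρ k` is the job
type with rank `k + 1` in the usual numbering. -/
structure IsViableRanking {m : ℕ} (ρ : Fin m → Fin J) : Prop where
  bij : BijOn ρ univ N.Sm
  opt : ∀ k, ρ k ∈ N.optSet (N.Sm \ ρ '' {l | l < k}) (ρ '' {l | l < k})

/-- The job types that use resource `i`, other than those with rank at most the rank of `ρ k`. -/
def zeta {m : ℕ} (ρ : Fin m → Fin J) (i : Fin I) (k : Fin m) : Set (Fin J) :=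
  {j | j ∉ ρ '' {l | l ≤ k} ∧ i ∈ N.res j}

/-- The constant `δ = min_j ϱ_j / (2J)` of the allocation policy. -/
def delta : ℝ := (⨅ j, N.load j) / (2 * J)

open Classical in
/-- The rates `y_j` of the primary job types and of the job types in `Sm`, as a function of the
set `s` of stocked job types. (The value for the other job types is a dummy.) -/
def rateMulti {m : ℕ} (ρ : Fin m → Fin J) (s : Set (Fin J)) (j : Fin J) : ℝ :=
  if j ∈ N.Sp then
    if j ∈ s then N.load j + N.delta else N.load j - N.delta / (J * 2 ^ (m + 3))
  else if hk : ∃ k, ρ k = j then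
    if ∀ i ∈ N.res j, (N.zeta ρ i hk.choose ∩ s).Nonempty then
      N.load j - (2 : ℝ) ^ (((hk.choose : ℕ) : ℤ) + 1 - m - 2) * N.delta
    else if j ∈ s then
      N.load j + (2 : ℝ) ^ (((hk.choose : ℕ) : ℤ) + 1 - m - 2) * N.delta
    else
      N.load j - (2 : ℝ) ^ (-(((hk.choose : ℕ) : ℤ) + 1) - m - 2) * N.delta
  else 0

open Classical in
/-- The rates `y_j` of all job types as a function of the set `s` of stocked job types. A job type
in `S1`, with sole resource `i`, gets what the other job types leave over at `i` if some stocked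
job type uses `i`; these other job types are not in `S1`, since different job types use different
sets of resources. -/
def rate {m : ℕ} (ρ : Fin m → Fin J) (s : Set (Fin J)) (j : Fin J) : ℝ :=
  if hi : ∃ i, N.res j = {i} then
    if ∃ l ∈ s, hi.choose ∈ N.res l then
      N.C hi.choose - ∑ l with l ≠ j ∧ hi.choose ∈ N.res l, N.rateMulti ρ s l
    else N.load j - N.delta
  else N.rateMulti ρ s j

end Network

/-- The first time `t ≥ a`, `t ≥ 0`, at which `A t` holds (`⊤` if there is none). -/
def hitTime (A : ℝ → Prop) (a : EReal) : EReal :=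
  sInf ((fun t : ℝ => (t : EReal)) '' {t | 0 ≤ t ∧ a ≤ t ∧ A t})

open Classical in
/-- The successive times at which a queue with path `x` becomes depleted (falls below `lo`) or
stocked again (reaches `hi`); odd indices are depletion times and even positive indices are
restocking times. If the queue is depleted at the outset, the first depletion time is `0`. -/
def switchTime (lo hi : ℝ) (depleted : Prop) (x : ℝ → ℝ) : ℕ → EReal
  | 0 => 0
  | n + 1 =>
    if Even n then
      if n = 0 ∧ depleted then 0
      else hitTime (fun t => x t < lo) (switchTime lo hi depleted x n)
    else hitTime (fun t => hi ≤ x t) (switchTime lo hi depleted x n)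

/-- The indicator `ℰ` is `1` at time `t`: the queue has been depleted and not restocked since. -/
def IsDepleted (lo hi : ℝ) (depleted : Prop) (x : ℝ → ℝ) (t : ℝ) : Prop :=
  ∃ l : ℕ, switchTime lo hi depleted x (2 * l + 1) ≤ t ∧
    (t : EReal) < switchTime lo hi depleted x (2 * l + 2)

/-- The counting process `max {k : ξ 0 + ... + ξ (k - 1) ≤ t}`. -/
def renewalCount (ξ : ℕ → ℝ) (t : ℝ) : ℕ := sSup {k | ∑ n ∈ Finset.range k, ξ n ≤ t}

namespace Network

variable {I J : ℕ} (N : Network I J)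

open Classical in
/-- The flow rates `x_j(t)` that the policy with parameters `α, c₁, c₂` allocates at time `t` to a
queue length path `Q`; `z` is the initial value of `ℰ`. -/
def flow {m : ℕ} (ρ : Fin m → Fin J) (α c₁ c₂ r : ℝ) (z : Fin J → Bool)
    (Q : ℝ → Fin J → ℤ) (t : ℝ) (j : Fin J) : ℝ :=
  if IsDepleted (c₁ * r ^ α) (c₂ * r ^ α) (z j = true) (fun s => (Q s j : ℝ)) t then 0
  else N.rate ρ {l | c₂ * r ^ α ≤ (Q t l : ℝ)} j

/-- The `r`-th network under the policy, started from queue lengths `q` and depletion indicators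
`z`: `η j k` and `Δ j k` are the independent exponential inter-arrival times and job sizes, `Q` is
the queue length process and `B` the process of cumulative allocations. -/
structure IsRealization {m : ℕ} (ρ : Fin m → Fin J) (α c₁ c₂ r : ℝ)
    (q : Fin J → ℕ) (z : Fin J → Bool) {Ω : Type*} [MeasurableSpace Ω] (P : Measure Ω)
    (η Δ : Fin J → ℕ → Ω → ℝ) (Q : Ω → ℝ → Fin J → ℤ) (B : Ω → ℝ → Fin J → ℝ) : Prop where
  law_arrival : ∀ j k, HasLaw (η j k) (expMeasure (N.lamR r j)) P
  law_size : ∀ j k, HasLaw (Δ j k) (expMeasure (N.muR r j)) P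
  indep : iIndepFun (fun a : (Fin J × ℕ) ⊕ (Fin J × ℕ) =>
    Sum.elim (fun p => η p.1 p.2) (fun p => Δ p.1 p.2) a) P
  flow_integrable : ∀ᵐ ω ∂P, ∀ t, 0 ≤ t → ∀ j,
    IntervalIntegrable (fun s => N.flow ρ α c₁ c₂ r z (Q ω) s j) volume 0 t
  alloc_eq : ∀ᵐ ω ∂P, ∀ t, 0 ≤ t → ∀ j,
    B ω t j = ∫ s in (0 : ℝ)..t, N.flow ρ α c₁ c₂ r z (Q ω) s j
  queue_eq : ∀ᵐ ω ∂P, ∀ t, 0 ≤ t → ∀ j,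
    Q ω t j = (q j : ℤ) + (renewalCount (fun k => η j k ω) t : ℤ)
      - (renewalCount (fun k => Δ j k ω) (B ω t j) : ℤ)

/-- The diffusion scaled workload `Ŵ_i^r(t) = (G^r Q(r² t))_i / r` of a queue length path `Q`. -/
def workload (r : ℝ) (Q : ℝ → Fin J → ℤ) (t : ℝ) (i : Fin I) : ℝ :=
  (N.GR r *ᵥ fun j => (Q (r ^ 2 * t) j : ℝ)) i / r

/-- The constant `c₃ = 2 J c₂ / min_j μ_j`. -/
def c₃ (c₂ : ℝ) : ℝ := 2 * J * c₂ / ⨅ j, N.mu j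

/-- The hitting time `inf {t ≥ 0 : |Ŵ_i^r(t)| ≤ 2 c₃}`. -/
def hittingTime (c₂ r : ℝ) (Q : ℝ → Fin J → ℤ) (i : Fin I) : EReal :=
  hitTime (fun t => |N.workload r Q t i| ≤ 2 * N.c₃ c₂) 0

/-- `V_i(x)`, the exponential moment `E_x[exp(β τ)]` of the hitting time, for the process `Q`
started from `x`. -/
def V (c₂ r β : ℝ) {Ω : Type*} [MeasurableSpace Ω] (P : Measure Ω) (Q : Ω → ℝ → Fin J → ℤ)
    (i : Fin I) : ℝ≥0∞ :=
  ∫⁻ ω, EReal.exp ((β : EReal) * N.hittingTime c₂ r (Q ω) i) ∂P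

end Network

end

noncomputable section

/-! ### Families of independent exponential clocks -/

/-! Fix a resource `i` and let `w` be its scaled workload in unscaled time. If `w > c₃`, some
stocked queue uses `i`, so the nominal rates exhaust `C i` (`sum_K_mul_rate`), and heavy traffic
gives `w` a nominal drift between `-κ₂/r²` and `-κ/r²` (`sum_GR_mul_drift_mem`). Depleted queues
forgo service, however, and each of them may cost a drift of order `1/r`, which is far larger.

The cure is that depletion is rare. A type that is not stocked is served at a rate below its load by
a fixed margin (`rate_lt_load`, the combinatorial point of the geometric weights in the policy), so
an undepleted queue below `c₂ r^α` is pushed upwards; once depleted, a queue only grows. Hence there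
is a potential `Ψ` of the queue lengths and depletion indicators, of size `r^(α-1)`, whose drift
pays for the loss up to an exponentially small error (`depletionPotential_drift_le`). All this is
collected in `JumpProcess.HasDrift`.

Three functions then do the work, with `D` the set where `w ≤ 2 c₃`. Off `D`, `exp (γ w) (1 + Ψ)`
decays at rate `κγ/(4 r²)`; therefore exponential moments of the hitting time of `D` are finite for
`β` below `κγ/4`. Off `D`, `exp (γ₀ (w - 2 c₃))` decays at rate at most `β/r²` when `γ₀ κ₂ ≤ β`;
therefore it lies below `V`. Finally a truncated version of the first function obeys a drift
inequality everywhere, which bounds exponential moments after `D` has been hit. Gluing `V` (before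
the hit) to the truncated function (after it) gives a supersolution of the backward equation that
dominates `exp (γ₀ w)` at time zero, and this is the theorem (`HasDrift.exists_lintegral_le`).

The probability is elementary. Memoryless clocks yield a renewal identity at the first ring
(`lintegral_ringsFirst`), and all comparisons are inductions on the number of jumps. A given
realization is identified path by path with the jump process driven by its own clocks
(`IsQueuePath.const`, `IsQueuePath.next`), and Fatou's lemma removes the bound on the number of
jumps. -/

theorem lintegral_expMeasure {l : ℝ} {g : ℝ → ℝ≥0∞} (hg : Measurable g) :
    ∫⁻ u, g u ∂(expMeasure l) = ∫⁻ u in Ioi 0, ENNReal.ofReal (l * Real.exp (-(l * u))) * g u := by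
  have h1 : expMeasure l = volume.withDensity (exponentialPDF l) := rfl
  have hm : Measurable (exponentialPDF l) := (measurable_exponentialPDFReal l).ennreal_ofReal
  rw [h1, lintegral_withDensity_eq_lintegral_mul _ hm hg, ← setLIntegral_univ]
  have h2 : (univ : Set ℝ) = Iio 0 ∪ Ici 0 := by simp
  rw [h2, lintegral_union measurableSet_Ici (by simp)]
  have h3 : ∫⁻ u in Iio (0 : ℝ), (exponentialPDF l * g) u = 0 := by
    rw [setLIntegral_congr_fun measurableSet_Iio (g := fun _ => 0)]
    · simp
    · intro u hu
      simp [exponentialPDF_of_neg hu]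
  rw [h3, zero_add, ← setLIntegral_congr Ioi_ae_eq_Ici]
  refine setLIntegral_congr_fun measurableSet_Ioi fun u hu => ?_
  simp [exponentialPDF_of_nonneg (le_of_lt hu)]

theorem lintegral_Ioi_sub (c : ℝ) (f : ℝ → ℝ≥0∞) :
    ∫⁻ u in Ioi c, f (u - c) = ∫⁻ u in Ioi 0, f u := by
  rw [← lintegral_indicator measurableSet_Ioi, ← lintegral_indicator measurableSet_Ioi,
    ← lintegral_sub_right_eq_self ((Ioi 0).indicator f) c]
  refine lintegral_congr fun u => ?_
  by_cases h : c < u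
  · rw [indicator_of_mem (by exact h), indicator_of_mem (by simpa using h)]
  · rw [indicator_of_notMem (by exact h), indicator_of_notMem (by simpa using h)]

theorem lintegral_Ioi_comp_div {c : ℝ} (hc : 0 < c) (f : ℝ → ℝ≥0∞) :
    ∫⁻ u in Ioi 0, f (u / c) = ENNReal.ofReal c * ∫⁻ u in Ioi 0, f u := by
  have h := Real.smul_map_volume_mul_left hc.ne'
  have hm : MeasurableEmbedding (fun u : ℝ => c * u) :=
    (Homeomorph.mulLeft₀ c hc.ne').measurableEmbedding
  rw [← lintegral_indicator measurableSet_Ioi, ← lintegral_indicator measurableSet_Ioi]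
  conv_lhs => rw [← h]
  rw [lintegral_smul_measure, hm.lintegral_map, abs_of_pos hc, smul_eq_mul]
  congr 1
  refine lintegral_congr fun u => ?_
  by_cases hu : 0 < u
  · rw [indicator_of_mem (show c * u ∈ Ioi 0 from mul_pos hc hu),
      indicator_of_mem (show u ∈ Ioi 0 from hu)]
    congr 1
    field_simp
  · rw [indicator_of_notMem (show u ∉ Ioi 0 from hu), indicator_of_notMem]
    intro h'
    exact hu (pos_of_mul_pos_right (show 0 < c * u from h') hc.le)

/-- The memoryless property: what exceeds `c` of an exponential variable is again exponential. -/
theorem lintegral_expMeasure_sub {l c : ℝ} (hc : 0 ≤ c) {g : ℝ → ℝ≥0∞}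
    (hg : Measurable g) :
    ∫⁻ u, (if c < u then g (u - c) else 0) ∂(expMeasure l)
      = ENNReal.ofReal (Real.exp (-(l * c))) * ∫⁻ u, g u ∂(expMeasure l) := by
  have hm : Measurable fun u => if c < u then g (u - c) else 0 :=
    Measurable.ite measurableSet_Ioi (hg.comp (measurable_id.sub_const c)) measurable_const
  rw [lintegral_expMeasure hg, lintegral_expMeasure hm,
    ← lintegral_const_mul' _ _ ENNReal.ofReal_ne_top,
    ← lintegral_Ioi_sub c (fun a => ENNReal.ofReal (Real.exp (-(l * c))) *
      (ENNReal.ofReal (l * Real.exp (-(l * a))) * g a)),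
    ← lintegral_indicator measurableSet_Ioi, ← lintegral_indicator measurableSet_Ioi]
  refine lintegral_congr fun u => ?_
  by_cases h : c < u
  · rw [indicator_of_mem (show u ∈ Ioi 0 from hc.trans_lt h),
      indicator_of_mem (show u ∈ Ioi c from h), if_pos h,
      ← mul_assoc, ← ENNReal.ofReal_mul (Real.exp_pos _).le]
    congr 2
    rw [mul_left_comm, ← Real.exp_add]
    ring_nf
  · rw [indicator_of_notMem (s := Ioi c) (by exact h)]
    simp [indicator, h]

section Clocks

set_option linter.unusedSectionVars false

variable {A : Type*} [DecidableEq A]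

/-- Insert the value `u` in front of the sequence of clock `a`. -/
def insertClock (a : A) (u : ℝ) (U : A × ℕ → ℝ) : A × ℕ → ℝ := fun p =>
  if p = (a, 0) then u else if p.1 = a then U (a, p.2 - 1) else U p

theorem measurable_insertClock (a : A) :
    Measurable fun x : ℝ × (A × ℕ → ℝ) => insertClock a x.1 x.2 := by
  refine measurable_pi_lambda _ fun p => ?_
  unfold insertClock
  split_ifs <;> fun_prop

/-- The law of independent clocks, where all variables of clock `a` have law `ν a`. -/
def clockLaw (ν : A → Measure ℝ) [∀ a, IsProbabilityMeasure (ν a)] : Measure (A × ℕ → ℝ) :=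
  Measure.infinitePi fun p : A × ℕ => ν p.1

instance (ν : A → Measure ℝ) [∀ a, IsProbabilityMeasure (ν a)] :
    IsProbabilityMeasure (clockLaw ν) := by
  unfold clockLaw; infer_instance

variable (ν : A → Measure ℝ) [∀ a, IsProbabilityMeasure (ν a)]

/-- An i.i.d. sequence keeps its law when an independent term of the same law is put in front. This
allows the first variable of a clock to be integrated out separately. -/
theorem map_insertClock (a : A) :
    ((ν a).prod (clockLaw ν)).map (fun x => insertClock a x.1 x.2) = clockLaw ν := by
  refine Measure.eq_infinitePi _ fun s t ht => ?_
  rw [Measure.map_apply (measurable_insertClock a)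
    (MeasurableSet.pi s.countable_toSet fun i _ => ht i)]
  -- `σ` tells where the old variables end up; its range misses exactly `(a, 0)`, so the preimage of
  -- a box is again a box.
  set σ : A × ℕ → A × ℕ := fun p => if p.1 = a then (a, p.2 + 1) else p with hσ
  have hinj : Function.Injective σ := by
    rintro ⟨b, k⟩ ⟨c, n⟩ h
    simp only [hσ] at h
    split_ifs at h <;> simp_all
  have hins : ∀ u U p, insertClock a u U (σ p) = U p := by
    rintro u U ⟨b, k⟩
    by_cases h : b = a <;> simp [insertClock, hσ, h]
  have hran : ∀ p, p ≠ (a, 0) → p ∈ range σ := by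
    rintro ⟨b, k⟩ h
    by_cases hb : b = a
    · subst hb
      cases k with
      | zero => exact absurd rfl h
      | succ k => exact ⟨(b, k), by simp [hσ]⟩
    · exact ⟨(b, k), by simp [hσ, hb]⟩
  have hσ0 : ∀ p, σ p ≠ (a, 0) := by
    rintro ⟨b, k⟩
    by_cases h : b = a <;> simp [hσ, h]
  set s' := (s.erase (a, 0)).preimage σ hinj.injOn
  have hpre : (fun x : ℝ × (A × ℕ → ℝ) => insertClock a x.1 x.2) ⁻¹' (Set.pi s t)
      = (if (a, 0) ∈ s then t (a, 0) else univ) ×ˢ Set.pi s' (fun p => t (σ p)) := by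
    ext ⟨u, U⟩
    simp only [mem_preimage, Set.mem_pi, mem_prod, Finset.mem_coe, s', Finset.mem_preimage,
      Finset.mem_erase]
    constructor
    · intro h
      refine ⟨?_, fun p hp => by simpa [hins] using h (σ p) hp.2⟩
      split_ifs with h0
      · simpa [insertClock] using h _ h0
      · trivial
    · rintro ⟨h1, h2⟩ p hp
      by_cases h0 : p = (a, 0)
      · subst h0
        rw [if_pos hp] at h1
        simpa [insertClock] using h1
      · obtain ⟨p, rfl⟩ := hran p h0
        rw [hins]
        exact h2 p ⟨h0, hp⟩
  have hlaw : ∀ p, ν (σ p).1 = ν p.1 := by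
    rintro ⟨b, k⟩
    by_cases h : b = a <;> simp [hσ, h]
  rw [hpre, Measure.prod_prod, clockLaw, Measure.infinitePi_pi _ (fun p _ => ht (σ p))]
  rw [Finset.prod_congr rfl fun p _ => by rw [← hlaw p]]
  rw [Finset.prod_preimage σ (s.erase (a, 0)) hinj.injOn (fun q => ν q.1 (t q))
    (fun p hp hp' => absurd (hran p (Finset.ne_of_mem_erase hp)) hp')]
  split_ifs with h0
  · rw [← Finset.mul_prod_erase s (fun q => ν q.1 (t q)) h0]
  · rw [Finset.erase_eq_of_notMem h0, measure_univ, one_mul]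

theorem lintegral_clockLaw_insert (a : A) {g : (A × ℕ → ℝ) → ℝ≥0∞} (hg : Measurable g) :
    ∫⁻ U, g U ∂(clockLaw ν) = ∫⁻ U, ∫⁻ u, g (insertClock a u U) ∂(ν a) ∂(clockLaw ν) := by
  conv_lhs => rw [← map_insertClock ν a]
  rw [lintegral_map hg (measurable_insertClock a),
    lintegral_prod_symm _ (by exact (hg.comp (measurable_insertClock a)).aemeasurable)]

/-- Reduce the first variable of each clock `b ∈ B` by `c b`. -/
def advance (B : Finset A) (c : A → ℝ) (U : A × ℕ → ℝ) : A × ℕ → ℝ := fun p =>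
  if p.1 ∈ B ∧ p.2 = 0 then U p - c p.1 else U p

theorem measurable_advance (B : Finset A) (c : A → ℝ) : Measurable (advance B c) := by
  refine measurable_pi_lambda _ fun p => ?_
  unfold advance
  split_ifs <;> fun_prop

/-- Memorylessness for several clocks at once. In the induction each new clock has its first
variable split off by `lintegral_clockLaw_insert` and then reduced. -/
theorem lintegral_advance {l : A → ℝ} (hν : ∀ a, ν a = expMeasure (l a))
    (B : Finset A) {c : A → ℝ} (hc : ∀ b, 0 ≤ c b) {g : (A × ℕ → ℝ) → ℝ≥0∞} (hg : Measurable g) :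
    ∫⁻ U, (if ∀ b ∈ B, c b < U (b, 0) then g (advance B c U) else 0) ∂(clockLaw ν)
      = ENNReal.ofReal (Real.exp (-∑ b ∈ B, l b * c b)) * ∫⁻ U, g U ∂(clockLaw ν) := by
  induction B using Finset.induction_on generalizing g with
  | empty =>
    have : ∀ U : A × ℕ → ℝ, advance ∅ c U = U := fun U => by
      funext p; simp [advance]
    simp [this]
  | insert a B ha ih =>
    have h1 : ∀ U : A × ℕ → ℝ,
        (if ∀ b ∈ insert a B, c b < U (b, 0) then g (advance (insert a B) c U) else 0)
        = (if ∀ b ∈ B, c b < U (b, 0) then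
            (fun U' => if c a < U' (a, 0) then g (advance {a} c U') else 0) (advance B c U)
            else 0) := by
      intro U
      have h2 : advance B c U (a, 0) = U (a, 0) := by simp [advance, ha]
      have h3 : advance (insert a B) c U = advance {a} c (advance B c U) := by
        funext ⟨b, k⟩
        by_cases hb : b = a
        · subst hb; simp [advance, ha]
        · simp [advance, hb]
      simp only [Finset.mem_insert, forall_eq_or_imp, h2, h3]
      by_cases h4 : c a < U (a, 0) <;> by_cases h5 : ∀ b ∈ B, c b < U (b, 0) <;> simp [h4, h5]
    have hm : Measurable fun U' : A × ℕ → ℝ =>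
        if c a < U' (a, 0) then g (advance {a} c U') else 0 :=
      Measurable.ite (measurableSet_lt measurable_const (measurable_pi_apply _))
        (hg.comp (measurable_advance _ _)) measurable_const
    simp_rw [h1]
    rw [ih hm, lintegral_clockLaw_insert ν a hm, lintegral_clockLaw_insert ν a hg,
      Finset.sum_insert ha, neg_add_rev, Real.exp_add, ENNReal.ofReal_mul (Real.exp_pos _).le,
      mul_assoc]
    congr 1
    rw [← lintegral_const_mul' _ _ ENNReal.ofReal_ne_top]
    refine lintegral_congr fun U => ?_
    have hm' : Measurable fun u => g (insertClock a u U) :=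
      hg.comp ((measurable_insertClock a).comp (measurable_id.prodMk measurable_const))
    rw [hν, ← lintegral_expMeasure_sub (hc a) hm']
    refine lintegral_congr fun u => ?_
    have h6 : insertClock a u U (a, 0) = u := by simp [insertClock]
    have h7 : advance {a} c (insertClock a u U) = insertClock a (u - c a) U := by
      funext ⟨b, k⟩
      by_cases hb : b = a
      · subst hb
        cases k <;> simp [advance, insertClock]
      · simp [advance, insertClock, hb]
    rw [h6, h7]

/-- The time at which clock `a` rings when the clocks run at speeds `sp`. -/
def ringTime (sp : A → ℝ) (a : A) (U : A × ℕ → ℝ) : ℝ := U (a, 0) / sp a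

/-- Clock `a` rings strictly before all other clocks. -/
def RingsFirst (sp : A → ℝ) (a : A) (U : A × ℕ → ℝ) : Prop :=
  0 < sp a ∧ ∀ b, b ≠ a → sp b * ringTime sp a U < U (b, 0)

/-- What is left on the clocks after clock `a` has rung first. -/
def restClocks (sp : A → ℝ) (a : A) (U : A × ℕ → ℝ) : A × ℕ → ℝ := fun p =>
  if p.1 = a then U (a, p.2 + 1)
  else if p.2 = 0 then U p - sp p.1 * ringTime sp a U else U p

theorem measurable_ringTime (sp : A → ℝ) (a : A) : Measurable (ringTime sp a) := by
  unfold ringTime; fun_prop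

theorem measurable_restClocks (sp : A → ℝ) (a : A) : Measurable (restClocks sp a) := by
  refine measurable_pi_lambda _ fun p => ?_
  have := measurable_ringTime sp a
  unfold restClocks
  split_ifs <;> fun_prop

theorem measurableSet_ringsFirst [Fintype A] (sp : A → ℝ) (a : A) :
    MeasurableSet {U | RingsFirst sp a U} := by
  have : {U | RingsFirst sp a U} = {_U | 0 < sp a} ∩
      ⋂ b ∈ Finset.univ.erase a, {U | sp b * ringTime sp a U < U (b, 0)} := by
    ext; simp [RingsFirst]
  rw [this]
  exact (MeasurableSet.const _).inter (Finset.measurableSet_biInter _ fun b _ =>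
    measurableSet_lt ((measurable_ringTime sp a).const_mul _) (measurable_pi_apply _))

open Classical in
-- The Markov property at the first ring. Given the first variable `u` of clock `a`, the ring time
-- is `u / sp a`, and the other clocks must survive being advanced by `sp b * (u / sp a)`; by
-- memorylessness they do so with an exponential probability and are then as good as new.
theorem lintegral_ringsFirst [Fintype A] {l : A → ℝ} (hl : ∀ a, 0 < l a)
    (hν : ∀ a, ν a = expMeasure (l a)) {sp : A → ℝ} (hsp : ∀ a, 0 ≤ sp a) (a : A)
    {g : ℝ → (A × ℕ → ℝ) → ℝ≥0∞} (hg : Measurable (Function.uncurry g)) :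
    ∫⁻ U, (if RingsFirst sp a U then g (ringTime sp a U) (restClocks sp a U) else 0) ∂(clockLaw ν)
      = ∫⁻ t in Ioi 0, ENNReal.ofReal (l a * sp a * Real.exp (-((∑ b, l b * sp b) * t)))
          * ∫⁻ U, g t U ∂(clockLaw ν) := by
  rcases (hsp a).eq_or_lt with h0 | hpos
  · have : ∀ U, ¬ RingsFirst sp a U := fun U h => h.1.ne h0
    simp [this, ← h0]
  have hG : Measurable fun U : A × ℕ → ℝ =>
      (if RingsFirst sp a U then g (ringTime sp a U) (restClocks sp a U) else 0) :=
    Measurable.ite (measurableSet_ringsFirst sp a)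
      (hg.comp ((measurable_ringTime sp a).prodMk (measurable_restClocks sp a))) measurable_const
  have hI : Measurable fun t => ∫⁻ U, g t U ∂(clockLaw ν) := hg.lintegral_prod_right'
  rw [lintegral_clockLaw_insert ν a hG, lintegral_lintegral_swap]
  swap
  · exact (hG.comp ((measurable_insertClock a).comp measurable_swap)).aemeasurable
  have key : ∀ u : ℝ, 0 < u → ∫⁻ U, (if RingsFirst sp a (insertClock a u U) then
      g (ringTime sp a (insertClock a u U)) (restClocks sp a (insertClock a u U)) else 0)
        ∂(clockLaw ν)
      = ENNReal.ofReal (Real.exp (-∑ b ∈ Finset.univ.erase a, l b * (sp b * (u / sp a))))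
        * ∫⁻ U, g (u / sp a) U ∂(clockLaw ν) := by
    intro u hu
    rw [← lintegral_advance ν hν _ (c := fun b => sp b * (u / sp a))
      (fun b => mul_nonneg (hsp b) (div_nonneg hu.le hpos.le)) (g := fun U => g (u / sp a) U)
      (hg.comp measurable_prodMk_left)]
    refine lintegral_congr fun U => ?_
    have h1 : ringTime sp a (insertClock a u U) = u / sp a := by simp [ringTime, insertClock]
    have h2 : restClocks sp a (insertClock a u U)
        = advance (Finset.univ.erase a) (fun b => sp b * (u / sp a)) U := by
      funext ⟨b, k⟩
      by_cases hb : b = a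
      · subst hb; simp [restClocks, insertClock, advance]
      · by_cases hk : k = 0 <;> simp [restClocks, insertClock, advance, hb, h1, hk]
    have h3 : RingsFirst sp a (insertClock a u U)
        ↔ ∀ b ∈ Finset.univ.erase a, sp b * (u / sp a) < U (b, 0) := by
      unfold RingsFirst
      rw [h1]
      simp only [hpos, true_and, Finset.mem_erase, Finset.mem_univ, and_true]
      refine forall_congr' fun b => imp_congr_right fun hb => ?_
      simp [insertClock, hb]
    simp only [h1, h2, h3]
    congr
  rw [hν]
  have hm1 : Measurable fun u => ∫⁻ U, (if RingsFirst sp a (insertClock a u U) then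
      g (ringTime sp a (insertClock a u U)) (restClocks sp a (insertClock a u U)) else 0)
        ∂(clockLaw ν) :=
    Measurable.lintegral_prod_right' (f := fun x : ℝ × (A × ℕ → ℝ) =>
      if RingsFirst sp a (insertClock a x.1 x.2) then
      g (ringTime sp a (insertClock a x.1 x.2)) (restClocks sp a (insertClock a x.1 x.2)) else 0)
      (hG.comp (measurable_insertClock a))
  rw [lintegral_expMeasure hm1, setLIntegral_congr_fun measurableSet_Ioi
    (g := fun u => (fun t => ENNReal.ofReal (l a * Real.exp (-((∑ b, l b * sp b) * t)))
          * ∫⁻ U, g t U ∂(clockLaw ν)) (u / sp a))]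
  · rw [lintegral_Ioi_comp_div hpos (fun t => ENNReal.ofReal (l a *
      Real.exp (-((∑ b, l b * sp b) * t))) * ∫⁻ U, g t U ∂(clockLaw ν)), ← lintegral_const_mul' _ _ ENNReal.ofReal_ne_top]
    refine lintegral_congr fun t => ?_
    rw [← mul_assoc, ← ENNReal.ofReal_mul hpos.le]
    congr 2
    ring
  · intro u hu
    simp only
    rw [key u hu, ← mul_assoc, ← ENNReal.ofReal_mul (mul_pos (hl a) (Real.exp_pos _)).le, mul_assoc,
      ← Real.exp_add]
    congr 4
    rw [← Finset.add_sum_erase _ _ (Finset.mem_univ a), add_mul, neg_add, Finset.sum_mul]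
    congr 2
    · field_simp
    · exact Finset.sum_congr rfl fun b _ => by ring

end Clocks

/-! ### Almost sure properties of the clocks. -/

section Clocks

set_option linter.unusedSectionVars false

variable {A : Type*} [DecidableEq A]
variable (ν : A → Measure ℝ) [∀ a, IsProbabilityMeasure (ν a)]

theorem ae_clockLaw_pos {l : A → ℝ} (hν : ∀ a, ν a = expMeasure (l a)) [Countable A] :
    ∀ᵐ U ∂(clockLaw ν), ∀ p, 0 < U p := by
  rw [ae_all_iff]
  intro p
  have h := Measure.infinitePi_map_eval (fun p : A × ℕ => ν p.1) p
  have h2 : ∀ᵐ u ∂(ν p.1), 0 < u := by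
    have hm : MeasurableSet {u : ℝ | ¬ 0 < u} := measurableSet_Ioi.compl
    rw [ae_iff, ← lintegral_indicator_one hm, hν,
      lintegral_expMeasure (measurable_one.indicator hm)]
    rw [setLIntegral_congr_fun measurableSet_Ioi (g := fun _ => 0)]
    · simp
    · intro u hu
      have : ¬ u ≤ 0 := not_le.2 hu
      simp [indicator, this]
  rw [← h] at h2
  exact ae_of_ae_map (measurable_pi_apply p).aemeasurable h2

theorem expMeasure_Iic_lt_one {l : ℝ} (hl : 0 < l) {M : ℝ} (hM : 0 ≤ M) :
    expMeasure l (Iic M) < 1 := by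
  have : IsProbabilityMeasure (expMeasure l) := isProbabilityMeasure_expMeasure hl
  have h := cdf_expMeasure_eq hl M
  rw [if_pos hM] at h
  rw [← ofReal_cdf (expMeasure l) M, h]
  rw [ENNReal.ofReal_lt_one]
  linarith [Real.exp_pos (-(l * M))]

/-- If all partial sums stay below `M`, then so does the first term, and the tail has the same
property. The probability `p` of this event thus satisfies `p ≤ ν a (Iic M) * p` with a factor below
`1`, which forces `p = 0`. -/
theorem ae_clockLaw_unbounded {l : A → ℝ} (hl : ∀ a, 0 < l a)
    (hν : ∀ a, ν a = expMeasure (l a)) [Countable A] :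
    ∀ᵐ U ∂(clockLaw ν), ∀ a, ∀ M : ℝ, ∃ k, M < ∑ n ∈ Finset.range k, U (a, n) := by
  rw [ae_all_iff]
  intro a
  have hM : ∀ M : ℕ, ∀ᵐ U ∂(clockLaw ν), ∃ k, (M : ℝ) < ∑ n ∈ Finset.range k, U (a, n) := by
    intro M
    set S : Set (A × ℕ → ℝ) :=
      {U | (∀ k, ∑ n ∈ Finset.range k, U (a, n) ≤ M) ∧ ∀ p, 0 < U p} with hS
    have hSm : MeasurableSet S := by
      have : S = (⋂ k, {U : A × ℕ → ℝ | ∑ n ∈ Finset.range k, U (a, n) ≤ M}) ∩ ⋂ p, {U | 0 < U p} := by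
        ext; simp [hS]
      rw [this]
      refine (MeasurableSet.iInter fun k => measurableSet_le ?_ measurable_const).inter
        (MeasurableSet.iInter fun p => measurableSet_lt measurable_const (measurable_pi_apply _))
      exact Finset.measurable_sum _ fun n _ => measurable_pi_apply _
    have hzero : clockLaw ν S = 0 := by
      by_contra hne
      have h1 : clockLaw ν S ≤ ν a (Iic M) * clockLaw ν S := by
        conv_lhs => rw [← map_insertClock ν a]
        rw [Measure.map_apply (measurable_insertClock a) hSm, ← Measure.prod_prod]
        refine measure_mono ?_
        rintro ⟨u, U⟩ ⟨h1, h2⟩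
        have hu : 0 < u := by simpa [insertClock] using h2 (a, 0)
        have hsum : ∀ k, ∑ n ∈ Finset.range (k + 1), insertClock a u U (a, n)
            = u + ∑ n ∈ Finset.range k, U (a, n) := by
          intro k
          rw [Finset.sum_range_succ', add_comm]
          simp [insertClock]
        refine ⟨?_, fun k => ?_, fun p => ?_⟩
        · have := h1 (0 + 1)
          simp only at this
          rw [hsum] at this
          simpa using this
        · have := h1 (k + 1)
          simp only at this
          rw [hsum] at this
          linarith
        · by_cases hp : p.1 = a
          · obtain ⟨b, k⟩ := p
            obtain rfl : b = a := hp
            simpa [insertClock] using h2 (b, k + 1)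
          · have hp' : p ≠ (a, 0) := fun h => hp (by rw [h])
            simpa [insertClock, hp, hp'] using h2 p
      have h2 : ν a (Iic M) < 1 := by
        rw [hν]; exact expMeasure_Iic_lt_one (hl a) (Nat.cast_nonneg M)
      have h3 : ν a (Iic M) * clockLaw ν S < 1 * clockLaw ν S :=
        (ENNReal.mul_lt_mul_iff_left hne (measure_ne_top _ _)).2 h2
      rw [one_mul] at h3
      exact absurd h1 (not_le.2 h3)
    have h4 : ∀ᵐ U ∂(clockLaw ν), U ∉ S := measure_eq_zero_iff_ae_notMem.1 hzero
    filter_upwards [h4, ae_clockLaw_pos ν hν] with U hU hpos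
    by_contra h5
    push Not at h5
    exact hU ⟨h5, hpos⟩
  filter_upwards [ae_all_iff.2 hM] with U hU M
  obtain ⟨n, hn⟩ := exists_nat_gt M
  obtain ⟨k, hk⟩ := hU n
  exact ⟨k, hn.trans hk⟩

theorem RingsFirst.eq {sp : A → ℝ} {a b : A} {U : A × ℕ → ℝ} (ha : RingsFirst sp a U)
    (hb : RingsFirst sp b U) : a = b := by
  by_contra h
  have h1 := ha.2 b (Ne.symm h)
  have h2 := hb.2 a h
  unfold ringTime at h1 h2
  have := ha.1
  have := hb.1
  rw [← mul_div_assoc, div_lt_iff₀ ha.1] at h1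
  rw [← mul_div_assoc, div_lt_iff₀ hb.1] at h2
  linarith

theorem lintegral_exp_neg {c : ℝ} (hc : 0 < c) :
    ∫⁻ t in Ioi 0, ENNReal.ofReal (Real.exp (-(c * t))) = ENNReal.ofReal (1 / c) := by
  have h1 := integrableOn_exp_mul_Ioi (a := -c) (by linarith) 0
  rw [← ofReal_integral_eq_lintegral_ofReal (by simpa [neg_mul, IntegrableOn] using h1)
    (ae_of_all _ fun t => (Real.exp_pos _).le)]
  congr 1
  have := integral_exp_mul_Ioi (a := -c) (by linarith) 0
  simp only [neg_mul] at this
  rw [this]; simp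

variable [Fintype A]

/-- The events that a given clock rings first are disjoint, and their probabilities `l a * sp a / ∑
b, l b * sp b` add up to `1`. -/
theorem ae_exists_ringsFirst {l : A → ℝ} (hl : ∀ a, 0 < l a)
    (hν : ∀ a, ν a = expMeasure (l a)) {sp : A → ℝ} (hsp : ∀ a, 0 ≤ sp a)
    (hpos : 0 < ∑ a, l a * sp a) :
    ∀ᵐ U ∂(clockLaw ν), ∃ a, RingsFirst sp a U := by
  classical
  set f : (A × ℕ → ℝ) → ℝ≥0∞ := fun U => ∑ a, if RingsFirst sp a U then 1 else 0 with hf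
  have hfm : Measurable f := Finset.measurable_sum _ fun a _ =>
    Measurable.ite (measurableSet_ringsFirst sp a) measurable_const measurable_const
  have hle : ∀ U, f U ≤ 1 := by
    intro U
    by_cases h : ∃ a, RingsFirst sp a U
    · obtain ⟨a, ha⟩ := h
      simp only [hf]
      rw [Finset.sum_eq_single a (fun b _ hb => if_neg fun h => hb (h.eq ha))
        (fun h => absurd (Finset.mem_univ a) h), if_pos ha]
    · push Not at h
      simp [hf, h]
  have hint : ∫⁻ U, f U ∂(clockLaw ν) = 1 := by
    simp only [hf]
    rw [lintegral_finsetSum _ fun a _ =>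
      Measurable.ite (measurableSet_ringsFirst sp a) measurable_const measurable_const]
    have h1 : ∀ a, ∫⁻ U, (if RingsFirst sp a U then 1 else 0) ∂(clockLaw ν)
        = ENNReal.ofReal (l a * sp a * (1 / ∑ b, l b * sp b)) := by
      intro a
      rw [lintegral_ringsFirst ν hl hν hsp a (g := fun _ _ => 1) measurable_const]
      simp only [lintegral_const, measure_univ, mul_one]
      rw [ENNReal.ofReal_mul (mul_nonneg (hl a).le (hsp a)), ← lintegral_exp_neg hpos,
        ← lintegral_const_mul' _ _ ENNReal.ofReal_ne_top]
      simp_rw [ENNReal.ofReal_mul (mul_nonneg (hl a).le (hsp a))]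
    simp_rw [h1]
    rw [← ENNReal.ofReal_sum_of_nonneg fun a _ =>
      mul_nonneg (mul_nonneg (hl a).le (hsp a)) (by positivity), ← Finset.sum_mul,
      mul_one_div_cancel hpos.ne', ENNReal.ofReal_one]
  have hae : f =ᵐ[clockLaw ν] fun _ => 1 := by
    refine ae_eq_of_ae_le_of_lintegral_le (ae_of_all _ hle) (by rw [hint]; simp)
      aemeasurable_const ?_
    rw [hint]; simp
  filter_upwards [hae] with U hU
  by_contra h
  push Not at h
  simp [hf, h] at hU

/-- Almost sure statements survive a restart at the first ring, because `lintegral_ringsFirst` sends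
null sets to null sets. -/
theorem ae_restClocks {l : A → ℝ} (hl : ∀ a, 0 < l a)
    (hν : ∀ a, ν a = expMeasure (l a)) {sp : A → ℝ} (hsp : ∀ a, 0 ≤ sp a) (a : A)
    {p : (A × ℕ → ℝ) → Prop} (hp : ∀ᵐ U ∂(clockLaw ν), p U) :
    ∀ᵐ U ∂(clockLaw ν), RingsFirst sp a U → p (restClocks sp a U) := by
  classical
  set S := toMeasurable (clockLaw ν) {U | ¬ p U} with hS
  have hSm : MeasurableSet S := measurableSet_toMeasurable _ _
  have hS0 : clockLaw ν S = 0 := by rw [hS, measure_toMeasurable]; exact hp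
  have h := lintegral_ringsFirst ν hl hν hsp a (g := fun _ U => S.indicator 1 U)
    ((measurable_one.indicator hSm).comp measurable_snd)
  simp only [lintegral_indicator_one hSm, hS0, mul_zero, lintegral_zero] at h
  rw [lintegral_eq_zero_iff] at h
  · filter_upwards [h] with U hU hr
    by_contra hn
    have : restClocks sp a U ∈ S := subset_toMeasurable _ _ hn
    simp [hr, this] at hU
  · exact Measurable.ite (measurableSet_ringsFirst sp a)
      ((measurable_one.indicator hSm).comp (measurable_restClocks sp a)) measurable_const

end Clocks

/-! ### Jump processes driven by clocks -/

/-- A jump process: in state `s` the clock `a` runs at speed `speed s a`, and the state becomes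
`next s a` when this clock rings. -/
structure JumpProcess (A S : Type*) where
  /-- speeds of the clocks -/
  speed : S → A → ℝ
  /-- the state after a clock has rung -/
  next : S → A → S

namespace JumpProcess

variable {A S : Type*} [Fintype A] [DecidableEq A] (X : JumpProcess A S)

open Classical in
/-- The value `f` of the state at time `t` if fewer than `n` clocks have rung by then, and `0`
otherwise. -/
def valueAt (f : S → ℝ≥0∞) : ℕ → S → ℝ → (A × ℕ → ℝ) → ℝ≥0∞
  | 0, _, _, _ => 0
  | n + 1, s, t, U => ∑ a, if RingsFirst (X.speed s) a U then
      (if t < ringTime (X.speed s) a U then f s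
        else valueAt f n (X.next s a) (t - ringTime (X.speed s) a U) (restClocks (X.speed s) a U))
      else 0

open Classical in
/-- The exponential `exp (β τ)` where `τ` is the time at which the state enters `D` or the `n`-th
clock rings, whatever comes first. -/
def expHit (D : S → Prop) (β : ℝ) : ℕ → S → (A × ℕ → ℝ) → ℝ≥0∞
  | 0, _, _ => 1
  | n + 1, s, U => if D s then 1 else ∑ a, if RingsFirst (X.speed s) a U then
      ENNReal.ofReal (Real.exp (β * ringTime (X.speed s) a U)) *
        expHit D β n (X.next s a) (restClocks (X.speed s) a U)
      else 0

/-- In each of the first `n` states some clock rings first. -/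
def NoTies : ℕ → S → (A × ℕ → ℝ) → Prop
  | 0, _, _ => True
  | n + 1, s, U => ∃ a, RingsFirst (X.speed s) a U ∧
      NoTies n (X.next s a) (restClocks (X.speed s) a U)

variable (l : A → ℝ)

/-- The rate at which clock `a` rings in state `s`. -/
def rate (s : S) (a : A) : ℝ := l a * X.speed s a

/-- The total jump rate in state `s`. -/
def totalRate (s : S) : ℝ := ∑ a, X.rate l s a

theorem measurable_valueAt (f : S → ℝ≥0∞) (n : ℕ) (s : S) :
    Measurable fun x : ℝ × (A × ℕ → ℝ) => X.valueAt f n s x.1 x.2 := by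
  induction n generalizing s with
  | zero => exact measurable_const
  | succ n ih =>
    unfold valueAt
    refine Finset.measurable_sum _ fun a _ => ?_
    have h1 := (measurable_ringTime (X.speed s) a).comp
      (measurable_snd : Measurable (Prod.snd : ℝ × (A × ℕ → ℝ) → _))
    have h2 := (measurable_restClocks (X.speed s) a).comp
      (measurable_snd : Measurable (Prod.snd : ℝ × (A × ℕ → ℝ) → _))
    refine Measurable.ite (measurable_snd (measurableSet_ringsFirst (X.speed s) a))
      (Measurable.ite (measurableSet_lt measurable_fst h1) measurable_const ?_) measurable_const
    exact (ih (X.next s a)).comp ((measurable_fst.sub h1).prodMk h2)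

theorem measurable_expHit (D : S → Prop) (β : ℝ) (n : ℕ) (s : S) :
    Measurable (X.expHit D β n s) := by
  induction n generalizing s with
  | zero => exact measurable_const
  | succ n ih =>
    classical
    have h : X.expHit D β (n + 1) s = fun U => if D s then 1 else ∑ a,
        if RingsFirst (X.speed s) a U then
          ENNReal.ofReal (Real.exp (β * ringTime (X.speed s) a U)) *
            X.expHit D β n (X.next s a) (restClocks (X.speed s) a U) else 0 := rfl
    rw [h]
    split_ifs
    · exact measurable_const
    refine Finset.measurable_sum _ fun a _ => ?_
    refine Measurable.ite (measurableSet_ringsFirst (X.speed s) a) ?_ measurable_const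
    exact ((measurable_ringTime (X.speed s) a).const_mul β).exp.ennreal_ofReal.mul
      ((ih (X.next s a)).comp (measurable_restClocks (X.speed s) a))

variable (ν : A → Measure ℝ) [∀ a, IsProbabilityMeasure (ν a)] {l}

theorem ae_noTies (hl : ∀ a, 0 < l a) (hν : ∀ a, ν a = expMeasure (l a))
    (hsp : ∀ s a, 0 ≤ X.speed s a) (hpos : ∀ s, 0 < X.totalRate l s) (n : ℕ) (s : S) :
    ∀ᵐ U ∂(clockLaw ν), X.NoTies n s U := by
  induction n generalizing s with
  | zero => exact ae_of_all _ fun _ => trivial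
  | succ n ih =>
    have h1 : ∀ a, ∀ᵐ U ∂(clockLaw ν), RingsFirst (X.speed s) a U →
        X.NoTies n (X.next s a) (restClocks (X.speed s) a U) :=
      fun a => ae_restClocks ν hl hν (hsp s) a (ih (X.next s a))
    filter_upwards [ae_exists_ringsFirst ν hl hν (hsp s) (hpos s), ae_all_iff.2 h1] with U h2 h3
    obtain ⟨a, ha⟩ := h2
    exact ⟨a, ha, h3 a ha⟩

end JumpProcess

/-! ### Expectations along the jump process and comparison principles. -/

namespace JumpProcess

set_option linter.unusedSectionVars false

variable {A S : Type*} [Fintype A] [DecidableEq A] (X : JumpProcess A S) {l : A → ℝ}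
  (ν : A → Measure ℝ) [∀ a, IsProbabilityMeasure (ν a)]

theorem rate_nonneg (hl : ∀ a, 0 < l a) (hsp : ∀ s a, 0 ≤ X.speed s a) (s : S) (a : A) :
    0 ≤ X.rate l s a := mul_nonneg (hl a).le (hsp s a)

theorem lintegral_valueAt_succ (hl : ∀ a, 0 < l a) (hν : ∀ a, ν a = expMeasure (l a))
    (hsp : ∀ s a, 0 ≤ X.speed s a) (f : S → ℝ≥0∞) (n : ℕ) (s : S) (t : ℝ) :
    ∫⁻ U, X.valueAt f (n + 1) s t U ∂(clockLaw ν)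
      = ∑ a, ∫⁻ w in Ioi 0, ENNReal.ofReal (X.rate l s a * Real.exp (-(X.totalRate l s * w))) *
          (if t < w then f s else ∫⁻ U, X.valueAt f n (X.next s a) (t - w) U ∂(clockLaw ν)) := by
  classical
  have hg : ∀ a, Measurable (Function.uncurry fun (w : ℝ) (U : A × ℕ → ℝ) =>
      if t < w then f s else X.valueAt f n (X.next s a) (t - w) U) := by
    intro a
    refine Measurable.ite (measurableSet_lt measurable_const measurable_fst) measurable_const ?_
    exact (X.measurable_valueAt f n (X.next s a)).comp
      ((measurable_const.sub measurable_fst).prodMk measurable_snd)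
  have hm : ∀ a, Measurable fun U => if RingsFirst (X.speed s) a U then
      (if t < ringTime (X.speed s) a U then f s
        else X.valueAt f n (X.next s a) (t - ringTime (X.speed s) a U)
          (restClocks (X.speed s) a U)) else 0 := fun a =>
    Measurable.ite (measurableSet_ringsFirst (X.speed s) a)
      ((hg a).comp ((measurable_ringTime (X.speed s) a).prodMk
        (measurable_restClocks (X.speed s) a))) measurable_const
  have h0 : ∀ U, X.valueAt f (n + 1) s t U = ∑ a, if RingsFirst (X.speed s) a U then
      (if t < ringTime (X.speed s) a U then f s
        else X.valueAt f n (X.next s a) (t - ringTime (X.speed s) a U)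
          (restClocks (X.speed s) a U)) else 0 := fun U => rfl
  simp_rw [h0]
  rw [lintegral_finsetSum _ fun a _ => hm a]
  refine Finset.sum_congr rfl fun a _ => ?_
  rw [lintegral_ringsFirst ν hl hν (hsp s) a (g := fun w U =>
    if t < w then f s else X.valueAt f n (X.next s a) (t - w) U) (hg a)]
  refine lintegral_congr fun w => ?_
  unfold rate totalRate rate
  congr 1
  split_ifs with h <;> simp

/-- The function `v s t = c s + exp (-β t) * d s` is a supersolution of the backward equation:
`hsuper` says that the generator applied to `v` is at most its time derivative, and `hf` compares
the initial values. Conditioning on the first ring propagates the bound from `n` to `n + 1` jumps.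
-/
theorem lintegral_valueAt_le (hl : ∀ a, 0 < l a) (hν : ∀ a, ν a = expMeasure (l a))
    (hsp : ∀ s a, 0 ≤ X.speed s a) (hpos : ∀ s, 0 < X.totalRate l s) (f : S → ℝ≥0∞)
    (c d : S → ℝ) (β : ℝ) (hnn : ∀ s t, 0 ≤ t → 0 ≤ c s + Real.exp (-(β * t)) * d s)
    (hf : ∀ s, f s ≤ ENNReal.ofReal (c s + d s))
    (hsuper : ∀ s t, 0 ≤ t →
      ∑ a, X.rate l s a * (c (X.next s a) + Real.exp (-(β * t)) * d (X.next s a))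
        ≤ X.totalRate l s * (c s + Real.exp (-(β * t)) * d s) - β * Real.exp (-(β * t)) * d s)
    (n : ℕ) (s : S) (t : ℝ) (ht : 0 ≤ t) :
    ∫⁻ U, X.valueAt f n s t U ∂(clockLaw ν)
      ≤ ENNReal.ofReal (c s + Real.exp (-(β * t)) * d s) := by
  have hr := X.rate_nonneg hl hsp
  induction n generalizing s t with
  | zero => simp [valueAt]
  | succ n ih =>
    set Λ := X.totalRate l s with hΛ
    have hΛ0 : 0 < Λ := hpos s
    -- `G w` is minus the derivative in `w` of `exp (-Λ w) * v s (t - w)`, so its integral over `[0,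
    -- t]` and the contribution of a first ring after `t` add up to `v s t`.
    set G : ℝ → ℝ := fun w => Real.exp (-(Λ * w)) *
      (Λ * (c s + Real.exp (-(β * (t - w))) * d s) - β * Real.exp (-(β * (t - w))) * d s) with hG
    have hv0 : 0 ≤ c s + d s := by simpa using hnn s 0 le_rfl
    rw [X.lintegral_valueAt_succ ν hl hν hsp f n s t]
    have hsplit : ∀ g : ℝ → ℝ≥0∞, ∫⁻ w in Ioi 0, g w
        = (∫⁻ w in Ioc 0 t, g w) + ∫⁻ w in Ioi t, g w := by
      intro g
      rw [← Ioc_union_Ioi_eq_Ioi ht, lintegral_union measurableSet_Ioi (Ioc_disjoint_Ioi le_rfl)]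
    simp_rw [hsplit]
    rw [Finset.sum_add_distrib]
    have hlate : ∑ a, ∫⁻ w in Ioi t, ENNReal.ofReal (X.rate l s a * Real.exp (-(Λ * w))) *
          (if t < w then f s else ∫⁻ U, X.valueAt f n (X.next s a) (t - w) U ∂(clockLaw ν))
        ≤ ENNReal.ofReal (Real.exp (-(Λ * t)) * (c s + d s)) := by
      have h1 : ∀ a, ∫⁻ w in Ioi t, ENNReal.ofReal (X.rate l s a * Real.exp (-(Λ * w))) *
          (if t < w then f s else ∫⁻ U, X.valueAt f n (X.next s a) (t - w) U ∂(clockLaw ν))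
          = ENNReal.ofReal (X.rate l s a * (Real.exp (-(Λ * t)) / Λ)) * f s := by
        intro a
        rw [setLIntegral_congr_fun measurableSet_Ioi (g := fun w =>
          ENNReal.ofReal (X.rate l s a * Real.exp (-(Λ * w))) * f s)
          (fun w hw => by simp only [if_pos (show t < w from hw)])]
        rw [lintegral_mul_const _ (by fun_prop)]
        congr 1
        have hi := integrableOn_exp_mul_Ioi (a := -Λ) (by linarith) t
        have hi2 := integral_exp_mul_Ioi (a := -Λ) (by linarith) t
        simp only [neg_mul] at hi hi2
        rw [← ofReal_integral_eq_lintegral_ofReal (hi.const_mul _)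
          (ae_of_all _ fun w => mul_nonneg (hr s a) (Real.exp_pos _).le),
          integral_const_mul, hi2, neg_div_neg_eq]
      simp_rw [h1]
      rw [← Finset.sum_mul, ← ENNReal.ofReal_sum_of_nonneg
        (fun a _ => mul_nonneg (hr s a) (by positivity)), ← Finset.sum_mul]
      have h2 : ∑ a, X.rate l s a = Λ := rfl
      rw [h2, mul_div_cancel₀ _ hΛ0.ne', ENNReal.ofReal_mul (Real.exp_pos _).le]
      gcongr
      exact hf s
    have hGnn : ∀ w ∈ Ioc 0 t, 0 ≤ G w := by
      intro w hw
      refine mul_nonneg (Real.exp_pos _).le (le_trans ?_ (hsuper s (t - w) (by linarith [hw.2])))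
      exact Finset.sum_nonneg fun a _ => mul_nonneg (hr s a) (hnn _ _ (by linarith [hw.2]))
    have hearly : ∑ a, ∫⁻ w in Ioc 0 t, ENNReal.ofReal (X.rate l s a * Real.exp (-(Λ * w))) *
          (if t < w then f s else ∫⁻ U, X.valueAt f n (X.next s a) (t - w) U ∂(clockLaw ν))
        ≤ ∫⁻ w in Ioc 0 t, ENNReal.ofReal (G w) := by
      calc _ ≤ ∑ a, ∫⁻ w in Ioc 0 t, ENNReal.ofReal (X.rate l s a * Real.exp (-(Λ * w)) *
            (c (X.next s a) + Real.exp (-(β * (t - w))) * d (X.next s a))) := by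
            refine Finset.sum_le_sum fun a _ => setLIntegral_mono' measurableSet_Ioc fun w hw => ?_
            rw [if_neg (not_lt.2 hw.2), ENNReal.ofReal_mul
              (mul_nonneg (hr s a) (Real.exp_pos _).le)]
            gcongr
            exact ih _ _ (by linarith [hw.2])
        _ = ∫⁻ w in Ioc 0 t, ∑ a, ENNReal.ofReal (X.rate l s a * Real.exp (-(Λ * w)) *
            (c (X.next s a) + Real.exp (-(β * (t - w))) * d (X.next s a))) := by
            rw [lintegral_finsetSum]
            intro a _
            fun_prop
        _ ≤ _ := by
            refine setLIntegral_mono' measurableSet_Ioc fun w hw => ?_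
            rw [← ENNReal.ofReal_sum_of_nonneg (fun a _ => mul_nonneg
              (mul_nonneg (hr s a) (Real.exp_pos _).le) (hnn _ _ (by linarith [hw.2])))]
            refine ENNReal.ofReal_le_ofReal ?_
            simp only [hG]
            refine le_trans (le_of_eq ?_) (mul_le_mul_of_nonneg_left
              (hsuper s (t - w) (by linarith [hw.2])) (Real.exp_pos (-(Λ * w))).le)
            rw [Finset.mul_sum]
            exact Finset.sum_congr rfl fun a _ => by ring
    have hGc : Continuous G := by simp only [hG]; fun_prop
    have hFTC : ∫ w in (0 : ℝ)..t, G w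
        = c s + Real.exp (-(β * t)) * d s - Real.exp (-(Λ * t)) * (c s + d s) := by
      have hd : ∀ w ∈ uIcc 0 t, HasDerivAt
          (fun w => -(Real.exp (-(Λ * w)) * (c s + Real.exp (-(β * (t - w))) * d s))) (G w) w := by
        intro w _
        have e1 : HasDerivAt (fun w => Real.exp (-(Λ * w))) (Real.exp (-(Λ * w)) * (-Λ)) w := by
          have := ((hasDerivAt_id w).const_mul Λ).neg.exp
          simpa using this
        have e2 : HasDerivAt (fun w => Real.exp (-(β * (t - w)))) (Real.exp (-(β * (t - w))) * β)
            w := by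
          have := (((hasDerivAt_id w).const_sub t).const_mul β).neg.exp
          simpa using this
        have := (e1.mul ((e2.mul_const (d s)).const_add (c s))).neg
        refine this.congr_deriv ?_
        simp only [hG]
        ring
      rw [intervalIntegral.integral_eq_sub_of_hasDerivAt hd (hGc.intervalIntegrable 0 t)]
      simp
      ring
    refine (add_le_add hearly hlate).trans ?_
    have hGint : ∫⁻ w in Ioc 0 t, ENNReal.ofReal (G w)
        = ENNReal.ofReal (c s + Real.exp (-(β * t)) * d s - Real.exp (-(Λ * t)) * (c s + d s)) := by
      rw [← hFTC, intervalIntegral.integral_of_le ht, ofReal_integral_eq_lintegral_ofReal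
        (hGc.intervalIntegrable 0 t).1
        ((ae_restrict_iff' measurableSet_Ioc).2 (ae_of_all _ hGnn))]
    rw [hGint, ← ENNReal.ofReal_add _ (mul_nonneg (Real.exp_pos _).le hv0), sub_add_cancel]
    rw [← hFTC, intervalIntegral.integral_of_le ht]
    exact setIntegral_nonneg measurableSet_Ioc hGnn

open Classical in
/-- The expectation of `expHit`. -/
def hitMoment (l : A → ℝ) (D : S → Prop) (β : ℝ) : ℕ → S → ℝ
  | 0, _ => 1
  | n + 1, s => if D s then 1
      else (∑ a, X.rate l s a * hitMoment l D β n (X.next s a)) / (X.totalRate l s - β)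

theorem hitMoment_nonneg (hl : ∀ a, 0 < l a) (hsp : ∀ s a, 0 ≤ X.speed s a) (D : S → Prop)
    {β : ℝ} (hβ : ∀ s, β < X.totalRate l s) (n : ℕ) (s : S) : 0 ≤ X.hitMoment l D β n s := by
  induction n generalizing s with
  | zero => exact zero_le_one
  | succ n ih =>
    unfold hitMoment
    split_ifs
    · exact zero_le_one
    · exact div_nonneg (Finset.sum_nonneg fun a _ => mul_nonneg (X.rate_nonneg hl hsp s a) (ih _))
        (by linarith [hβ s])

/-- The time to the first ring is exponential with the total rate as parameter, so its exponential
moment of order `β` is finite below that rate; integrating it turns the rates into the quotients in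
`hitMoment`. -/
theorem lintegral_expHit (hl : ∀ a, 0 < l a) (hν : ∀ a, ν a = expMeasure (l a))
    (hsp : ∀ s a, 0 ≤ X.speed s a) (D : S → Prop)
    {β : ℝ} (hβ : ∀ s, β < X.totalRate l s) (n : ℕ) (s : S) :
    ∫⁻ U, X.expHit D β n s U ∂(clockLaw ν) = ENNReal.ofReal (X.hitMoment l D β n s) := by
  classical
  induction n generalizing s with
  | zero => simp [expHit, hitMoment]
  | succ n ih =>
    by_cases hD : D s
    · simp [expHit, hitMoment, hD]
    have h0 : ∀ U, X.expHit D β (n + 1) s U = ∑ a, if RingsFirst (X.speed s) a U then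
        ENNReal.ofReal (Real.exp (β * ringTime (X.speed s) a U)) *
          X.expHit D β n (X.next s a) (restClocks (X.speed s) a U) else 0 := by
      intro U
      simp only [expHit, if_neg hD]
    have hg : ∀ a, Measurable (Function.uncurry fun (w : ℝ) (U : A × ℕ → ℝ) =>
        ENNReal.ofReal (Real.exp (β * w)) * X.expHit D β n (X.next s a) U) := fun a =>
      (measurable_fst.const_mul β).exp.ennreal_ofReal.mul
        ((X.measurable_expHit D β n (X.next s a)).comp measurable_snd)
    simp_rw [h0]
    have hm : ∀ a, Measurable fun U => if RingsFirst (X.speed s) a U then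
        ENNReal.ofReal (Real.exp (β * ringTime (X.speed s) a U)) *
          X.expHit D β n (X.next s a) (restClocks (X.speed s) a U) else 0 := fun a =>
      Measurable.ite (measurableSet_ringsFirst (X.speed s) a)
        ((hg a).comp ((measurable_ringTime (X.speed s) a).prodMk
          (measurable_restClocks (X.speed s) a))) measurable_const
    rw [lintegral_finsetSum _ fun a _ => hm a]
    have h1 : ∀ a, ∫⁻ U, (if RingsFirst (X.speed s) a U then
        ENNReal.ofReal (Real.exp (β * ringTime (X.speed s) a U)) *
          X.expHit D β n (X.next s a) (restClocks (X.speed s) a U) else 0) ∂(clockLaw ν)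
        = ENNReal.ofReal (X.rate l s a * X.hitMoment l D β n (X.next s a) /
            (X.totalRate l s - β)) := by
      intro a
      rw [lintegral_ringsFirst ν hl hν (hsp s) a (g := fun w U =>
        ENNReal.ofReal (Real.exp (β * w)) * X.expHit D β n (X.next s a) U) (hg a)]
      have h2 : ∀ w : ℝ, ∫⁻ U, ENNReal.ofReal (Real.exp (β * w)) *
          X.expHit D β n (X.next s a) U ∂(clockLaw ν)
          = ENNReal.ofReal (Real.exp (β * w)) *
            ENNReal.ofReal (X.hitMoment l D β n (X.next s a)) := fun w => by
        rw [lintegral_const_mul _ (X.measurable_expHit D β n _), ih]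
      simp_rw [h2]
      have hr := X.rate_nonneg hl hsp s a
      have h3 : ∀ w : ℝ, ENNReal.ofReal (l a * X.speed s a *
          Real.exp (-((∑ b, l b * X.speed s b) * w))) *
          (ENNReal.ofReal (Real.exp (β * w)) *
            ENNReal.ofReal (X.hitMoment l D β n (X.next s a)))
          = ENNReal.ofReal (X.rate l s a * X.hitMoment l D β n (X.next s a)) *
            ENNReal.ofReal (Real.exp (-((X.totalRate l s - β) * w))) := by
        intro w
        have hm := X.hitMoment_nonneg hl hsp D hβ n (X.next s a)
        rw [← ENNReal.ofReal_mul (Real.exp_pos _).le, ← ENNReal.ofReal_mul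
          (mul_nonneg (show 0 ≤ l a * X.speed s a from hr) (Real.exp_pos _).le), ← ENNReal.ofReal_mul (mul_nonneg hr hm)]
        congr 1
        have : Real.exp (-((X.totalRate l s - β) * w))
            = Real.exp (-((∑ b, l b * X.speed s b) * w)) * Real.exp (β * w) := by
          rw [← Real.exp_add]
          congr 1
          unfold totalRate rate
          ring
        rw [this]
        unfold rate
        ring
      simp_rw [h3]
      rw [lintegral_const_mul' _ _ ENNReal.ofReal_ne_top,
        lintegral_exp_neg (by linarith [hβ s]), ← ENNReal.ofReal_mul
        (mul_nonneg hr (X.hitMoment_nonneg hl hsp D hβ n (X.next s a)))]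
      congr 1
      ring
    simp_rw [h1]
    rw [← ENNReal.ofReal_sum_of_nonneg]
    · simp only [hitMoment, if_neg hD, Finset.sum_div]
    · intro a _
      exact div_nonneg (mul_nonneg (X.rate_nonneg hl hsp s a)
        (X.hitMoment_nonneg hl hsp D hβ n (X.next s a))) (by linarith [hβ s])

section Comparison

variable (hl : ∀ a, 0 < l a) (hsp : ∀ s a, 0 ≤ X.speed s a) (D : S → Prop)
  {β : ℝ} (hβ0 : 0 ≤ β) (hβ : ∀ s, β < X.totalRate l s)
include hl hsp hβ

theorem hitMoment_le {Φ : S → ℝ} (hΦ : ∀ s, 1 ≤ Φ s)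
    (hD : ∀ s, ¬ D s → ∑ a, X.rate l s a * Φ (X.next s a) ≤ (X.totalRate l s - β) * Φ s)
    (n : ℕ) (s : S) : X.hitMoment l D β n s ≤ Φ s := by
  induction n generalizing s with
  | zero => exact hΦ s
  | succ n ih =>
    unfold hitMoment
    split_ifs with h
    · exact hΦ s
    · rw [div_le_iff₀ (by linarith [hβ s]), mul_comm]
      refine le_trans (Finset.sum_le_sum fun a _ => ?_) (hD s h)
      exact mul_le_mul_of_nonneg_left (ih _) (X.rate_nonneg hl hsp s a)

include hβ0 in
theorem hitMoment_mono (s : S) : Monotone fun n => X.hitMoment l D β n s := by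
  refine monotone_nat_of_le_succ fun n => ?_
  induction n generalizing s with
  | zero =>
    rw [hitMoment]
    simp only [hitMoment]
    split_ifs with h
    · exact le_rfl
    · rw [le_div_iff₀ (by linarith [hβ s])]
      simp only [mul_one, totalRate]
      linarith
  | succ n ih =>
    rw [hitMoment, hitMoment]
    split_ifs with h
    · exact le_rfl
    · refine div_le_div_of_nonneg_right ?_ (by linarith [hβ s])
      exact Finset.sum_le_sum fun a _ =>
        mul_le_mul_of_nonneg_left (ih _) (X.rate_nonneg hl hsp s a)

include hβ0 in
-- The moments increase with the number of jumps and are bounded by the supersolution `Φ`, so they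
-- converge. That the limit dominates the subsolution `u` is a uniqueness statement: since `Φ` is a
-- supersolution even for the larger exponent `β₁` and the rates are bounded by `L`, the gap to `u`
-- contracts geometrically relative to `Φ`.
theorem exists_hitMoment_limit {β₁ L : ℝ} (hβ₁ : β < β₁) (hL : ∀ s, X.totalRate l s ≤ L)
    (hβ₁L : β₁ ≤ L) {Φ u : S → ℝ} (hΦ : ∀ s, 1 ≤ Φ s)
    (hΦD : ∀ s, ¬ D s → ∑ a, X.rate l s a * Φ (X.next s a) ≤ (X.totalRate l s - β₁) * Φ s)
    (huΦ : ∀ s, u s ≤ Φ s) (huD : ∀ s, D s → u s ≤ 1)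
    (hu : ∀ s, ¬ D s → (X.totalRate l s - β) * u s ≤ ∑ a, X.rate l s a * u (X.next s a)) :
    ∃ V : S → ℝ, (∀ s, Tendsto (fun n => X.hitMoment l D β n s) atTop (𝓝 (V s))) ∧
      (∀ n s, X.hitMoment l D β n s ≤ V s) ∧ (∀ s, 1 ≤ V s) ∧ (∀ s, u s ≤ V s) ∧
      ∀ s, ¬ D s → ∑ a, X.rate l s a * V (X.next s a) ≤ (X.totalRate l s - β) * V s := by
  have hr := X.rate_nonneg hl hsp
  have hΦD' : ∀ s, ¬ D s →
      ∑ a, X.rate l s a * Φ (X.next s a) ≤ (X.totalRate l s - β) * Φ s := fun s hs =>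
    (hΦD s hs).trans (mul_le_mul_of_nonneg_right (by linarith) (by linarith [hΦ s]))
  have hmono := X.hitMoment_mono hl hsp D hβ0 hβ
  have hbdd : ∀ s, BddAbove (range fun n => X.hitMoment l D β n s) := fun s =>
    ⟨Φ s, by rintro _ ⟨n, rfl⟩; exact X.hitMoment_le hl hsp D hβ hΦ hΦD' n s⟩
  have htend : ∀ s, Tendsto (fun n => X.hitMoment l D β n s) atTop
      (𝓝 (⨆ n, X.hitMoment l D β n s)) := fun s => tendsto_atTop_ciSup (hmono s) (hbdd s)
  -- The contraction factor, chosen such that `Λ - β₁ ≤ θ * (Λ - β)` for all total rates `Λ ≤ L`.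
  set θ : ℝ := 1 - (β₁ - β) / L with hθ
  have hL0 : 0 < L := by linarith
  have hθ0 : 0 ≤ θ := by
    rw [hθ, sub_nonneg, div_le_one hL0]; linarith
  have hθ1 : θ < 1 := by
    have : 0 < (β₁ - β) / L := div_pos (by linarith) hL0
    linarith
  have hcontr : ∀ s, X.totalRate l s - β₁ ≤ θ * (X.totalRate l s - β) := by
    intro s
    have h1 : (β₁ - β) / L * (X.totalRate l s - β) ≤ (β₁ - β) / L * L :=
      mul_le_mul_of_nonneg_left (by linarith [hL s]) (div_nonneg (by linarith) hL0.le)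
    rw [div_mul_cancel₀ _ hL0.ne'] at h1
    rw [hθ]
    linarith
  have hlow : ∀ n s, u s ≤ X.hitMoment l D β n s + θ ^ n * Φ s := by
    intro n
    induction n with
    | zero => intro s; simp only [hitMoment, pow_zero, one_mul]; linarith [huΦ s]
    | succ n ih =>
      intro s
      have hp : 0 ≤ θ ^ (n + 1) * Φ s := mul_nonneg (pow_nonneg hθ0 _) (by linarith [hΦ s])
      by_cases h : D s
      · simp only [hitMoment, if_pos h]
        linarith [huD s h]
      · have hpos : 0 < X.totalRate l s - β := by linarith [hβ s]
        have h1 : (X.totalRate l s - β) * u s ≤ ∑ a, X.rate l s a *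
            (X.hitMoment l D β n (X.next s a) + θ ^ n * Φ (X.next s a)) :=
          (hu s h).trans (Finset.sum_le_sum fun a _ =>
            mul_le_mul_of_nonneg_left (ih _) (hr s a))
        have h2 : ∑ a, X.rate l s a *
            (X.hitMoment l D β n (X.next s a) + θ ^ n * Φ (X.next s a))
            = ∑ a, X.rate l s a * X.hitMoment l D β n (X.next s a)
              + θ ^ n * ∑ a, X.rate l s a * Φ (X.next s a) := by
          rw [Finset.mul_sum, ← Finset.sum_add_distrib]
          exact Finset.sum_congr rfl fun a _ => by ring
        have h3 : θ ^ n * ∑ a, X.rate l s a * Φ (X.next s a)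
            ≤ θ ^ n * (θ * (X.totalRate l s - β) * Φ s) :=
          mul_le_mul_of_nonneg_left ((hΦD s h).trans (mul_le_mul_of_nonneg_right (hcontr s)
            (by linarith [hΦ s]))) (pow_nonneg hθ0 _)
        simp only [hitMoment, if_neg h]
        rw [← sub_le_iff_le_add, le_div_iff₀ hpos]
        rw [pow_succ]
        linarith
  refine ⟨fun s => ⨆ n, X.hitMoment l D β n s, htend, fun n s => le_ciSup (hbdd s) n,
    fun s => le_ciSup (hbdd s) 0, fun s => ?_, fun s hs => ?_⟩
  · have h1 : Tendsto (fun n => X.hitMoment l D β n s + θ ^ n * Φ s) atTop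
        (𝓝 ((⨆ n, X.hitMoment l D β n s) + 0 * Φ s)) :=
      (htend s).add ((tendsto_pow_atTop_nhds_zero_of_lt_one hθ0 hθ1).mul_const _)
    rw [zero_mul, add_zero] at h1
    exact ge_of_tendsto' h1 fun n => hlow n s
  · have h1 : Tendsto (fun n => ∑ a, X.rate l s a * X.hitMoment l D β n (X.next s a)) atTop
        (𝓝 (∑ a, X.rate l s a * ⨆ n, X.hitMoment l D β n (X.next s a))) :=
      tendsto_finsetSum _ fun a _ => (htend _).const_mul _
    refine le_of_tendsto' h1 fun n => ?_
    have hpos : 0 < X.totalRate l s - β := by linarith [hβ s]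
    have h2 : X.hitMoment l D β (n + 1) s ≤ ⨆ n, X.hitMoment l D β n s := le_ciSup (hbdd s) (n + 1)
    simp only [hitMoment, if_neg hs] at h2
    rw [div_le_iff₀ hpos, mul_comm] at h2
    exact h2

end Comparison

end JumpProcess

/-! ### Renewal counting processes -/

section Renewal

variable {ξ : ℕ → ℝ}

/-- Unboundedness of the partial sums makes the supremum in `renewalCount` a genuine maximum. The
resulting Galois connection replaces the definition in all that follows. -/
theorem le_renewalCount_iff (hpos : ∀ n, 0 < ξ n)
    (hunb : ∀ M : ℝ, ∃ k, M < ∑ n ∈ Finset.range k, ξ n) {t : ℝ} (ht : 0 ≤ t) (k : ℕ) :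
    k ≤ renewalCount ξ t ↔ ∑ n ∈ Finset.range k, ξ n ≤ t := by
  have hmono : StrictMono fun k => ∑ n ∈ Finset.range k, ξ n :=
    strictMono_nat_of_lt_succ fun k => by rw [Finset.sum_range_succ]; linarith [hpos k]
  have hbdd : BddAbove {k | ∑ n ∈ Finset.range k, ξ n ≤ t} := by
    obtain ⟨K, hK⟩ := hunb t
    refine ⟨K, fun k hk => ?_⟩
    by_contra h
    have := hmono (not_le.1 h)
    simp only [mem_ofPred_eq] at hk this
    linarith
  constructor
  · intro h
    have hmem : renewalCount ξ t ∈ {k | ∑ n ∈ Finset.range k, ξ n ≤ t} :=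
      Nat.sSup_mem ⟨0, by simpa using ht⟩ hbdd
    exact (hmono.monotone h).trans hmem
  · intro h
    exact le_csSup hbdd h

theorem renewalCount_mono (hpos : ∀ n, 0 < ξ n)
    (hunb : ∀ M : ℝ, ∃ k, M < ∑ n ∈ Finset.range k, ξ n) {t u : ℝ} (ht : 0 ≤ t) (htu : t ≤ u) :
    renewalCount ξ t ≤ renewalCount ξ u := by
  rw [le_renewalCount_iff hpos hunb (ht.trans htu)]
  exact ((le_renewalCount_iff hpos hunb ht _).1 le_rfl).trans htu

theorem renewalCount_eq_zero (hpos : ∀ n, 0 < ξ n)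
    (hunb : ∀ M : ℝ, ∃ k, M < ∑ n ∈ Finset.range k, ξ n) {t : ℝ} (ht : 0 ≤ t) (h : t < ξ 0) :
    renewalCount ξ t = 0 := by
  by_contra hne
  have := (le_renewalCount_iff hpos hunb ht 1).1 (Nat.one_le_iff_ne_zero.2 hne)
  simp at this
  linarith

theorem renewalCount_right_const (hpos : ∀ n, 0 < ξ n)
    (hunb : ∀ M : ℝ, ∃ k, M < ∑ n ∈ Finset.range k, ξ n) {t : ℝ} (ht : 0 ≤ t) :
    ∃ T, t < T ∧ ∀ u, t ≤ u → u < T → renewalCount ξ u = renewalCount ξ t := by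
  refine ⟨∑ n ∈ Finset.range (renewalCount ξ t + 1), ξ n, ?_, fun u h1 h2 => ?_⟩
  · rw [← not_le, ← le_renewalCount_iff hpos hunb ht]; omega
  · refine le_antisymm ?_ (renewalCount_mono hpos hunb ht h1)
    rw [← not_le, ← le_renewalCount_iff hpos hunb (ht.trans h1)] at h2
    omega

theorem renewalCount_first_add (hpos : ∀ n, 0 < ξ n)
    (hunb : ∀ M : ℝ, ∃ k, M < ∑ n ∈ Finset.range k, ξ n)
    (hunb' : ∀ M : ℝ, ∃ k, M < ∑ n ∈ Finset.range k, ξ (n + 1)) {v : ℝ} (hv : 0 ≤ v) :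
    renewalCount ξ (ξ 0 + v) = renewalCount (fun n => ξ (n + 1)) v + 1 := by
  refine eq_of_forall_le_iff fun k => ?_
  rw [le_renewalCount_iff hpos hunb (add_nonneg (hpos 0).le hv)]
  cases k with
  | zero => simpa using add_nonneg (hpos 0).le hv
  | succ k =>
    rw [Nat.succ_le_succ_iff, le_renewalCount_iff (fun n => hpos (n + 1)) hunb' hv,
      Finset.sum_range_succ']
    constructor <;> intro h <;> linarith

theorem renewalCount_sub_first {ξ' : ℕ → ℝ} (hpos : ∀ n, 0 < ξ n)
    (hunb : ∀ M : ℝ, ∃ k, M < ∑ n ∈ Finset.range k, ξ n) (hpos' : ∀ n, 0 < ξ' n)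
    (hunb' : ∀ M : ℝ, ∃ k, M < ∑ n ∈ Finset.range k, ξ' n) {u v : ℝ} (hu : 0 ≤ u) (hv : 0 ≤ v)
    (h0 : ξ' 0 = ξ 0 - u) (h1 : ∀ n, ξ' (n + 1) = ξ (n + 1)) :
    renewalCount ξ (u + v) = renewalCount ξ' v := by
  refine eq_of_forall_le_iff fun k => ?_
  rw [le_renewalCount_iff hpos hunb (add_nonneg hu hv), le_renewalCount_iff hpos' hunb' hv]
  cases k with
  | zero => simpa [hv] using add_nonneg hu hv
  | succ k =>
    rw [Finset.sum_range_succ', Finset.sum_range_succ', h0]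
    simp_rw [h1]
    constructor <;> intro h <;> linarith

end Renewal

/-! ### Depletion in terms of the history of a path -/

theorem le_hitTime (A : ℝ → Prop) (a : EReal) : a ≤ hitTime A a := by
  refine le_sInf ?_
  rintro _ ⟨t, ht, rfl⟩
  exact ht.2.1

theorem hitTime_le {A : ℝ → Prop} {a : EReal} {t : ℝ} (h0 : 0 ≤ t) (ha : a ≤ t) (hA : A t) :
    hitTime A a ≤ t :=
  sInf_le ⟨t, ⟨h0, ha, hA⟩, rfl⟩

/-- The hypothesis `hA` says that `A` cannot begin immediately after a time at which it fails; this
holds for paths that are locally constant to the right and puts the infimum into the set. -/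
theorem hitTime_attained {A : ℝ → Prop} {a : EReal}
    (hA : ∀ t, 0 ≤ t → ∃ T, t < T ∧ ∀ u, t ≤ u → u < T → A u → A t)
    (h : hitTime A a ≠ ⊤) : ∃ τ : ℝ, hitTime A a = τ ∧ 0 ≤ τ ∧ a ≤ τ ∧ A τ := by
  set S := {t : ℝ | 0 ≤ t ∧ a ≤ t ∧ A t} with hS
  have hne : S.Nonempty := by
    by_contra hn
    rw [not_nonempty_iff_eq_empty] at hn
    apply h
    unfold hitTime
    rw [← hS, hn]
    simp
  have hbdd : BddBelow S := ⟨0, fun t ht => ht.1⟩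
  set τ := sInf S with hτ
  have hτ0 : 0 ≤ τ := le_csInf hne fun t ht => ht.1
  obtain ⟨T, hT, hTA⟩ := hA τ hτ0
  obtain ⟨t, ht, htT⟩ := exists_lt_of_csInf_lt hne hT
  have hAτ : A τ := hTA t (csInf_le hbdd ht) htT ht.2.2
  have haτ : a ≤ τ := by
    induction a with
    | bot => exact bot_le
    | coe a =>
      exact EReal.coe_le_coe_iff.2 (le_csInf hne fun t ht => EReal.coe_le_coe_iff.1 ht.2.1)
    | top => exact absurd ht.2.1 (by simp)
  refine ⟨τ, le_antisymm (hitTime_le hτ0 haτ hAτ) ?_, hτ0, haτ, hAτ⟩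
  refine le_sInf ?_
  rintro _ ⟨t, ht, rfl⟩
  exact EReal.coe_le_coe_iff.2 (csInf_le hbdd ht)

/-- At some time up to `t` the path was below `lo` (or it was depleted at the outset), and it has
stayed below `hi` since. -/
def DepletedHistory (lo hi : ℝ) (z : Prop) (x : ℝ → ℝ) (t : ℝ) : Prop :=
  ∃ s, 0 ≤ s ∧ s ≤ t ∧ (x s < lo ∨ (s = 0 ∧ z)) ∧ ∀ u, s ≤ u → u ≤ t → x u < hi

theorem depletedHistory_of_const {lo hi : ℝ} {z : Prop} {x : ℝ → ℝ} {c t : ℝ} (ht : 0 ≤ t)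
    (hx : ∀ u, 0 ≤ u → u ≤ t → x u = c) :
    DepletedHistory lo hi z x t ↔ (c < lo ∨ z) ∧ c < hi := by
  constructor
  · rintro ⟨s, h0, h1, h2, h3⟩
    have hs := hx s h0 h1
    refine ⟨h2.imp (fun h => hs ▸ h) fun h => h.2, hs ▸ h3 s le_rfl h1⟩
  · rintro ⟨h1, h2⟩
    refine ⟨0, le_rfl, ht, h1.imp (fun h => (hx 0 le_rfl ht).symm ▸ h) fun h => ⟨rfl, h⟩, ?_⟩
    intro u h3 h4
    rwa [hx u h3 h4]

/-- While the path is constant, all that must be remembered of its past is one bit, the depletion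
indicator corrected by the current value. This makes queue lengths with indicators Markovian. -/
theorem depletedHistory_shift {lo hi : ℝ} {z : Prop} {x : ℝ → ℝ} {c T t : ℝ} (hT : 0 < T)
    (ht : 0 ≤ t) (hx : ∀ u, 0 ≤ u → u < T → x u = c) :
    DepletedHistory lo hi z x (T + t)
      ↔ DepletedHistory lo hi ((c < lo ∨ z) ∧ c < hi) (fun u => x (T + u)) t := by
  constructor
  · rintro ⟨s, h0, h1, h2, h3⟩
    by_cases hs : s < T
    · have hxs := hx s h0 hs
      refine ⟨0, le_rfl, ht, Or.inr ⟨rfl, h2.imp (fun h => hxs ▸ h) fun h => h.2,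
        hxs ▸ h3 s le_rfl h1⟩, fun u h4 h5 => h3 _ (by linarith) (by linarith)⟩
    · push Not at hs
      have h4 : x s < lo := h2.resolve_right fun h => by linarith [h.1]
      refine ⟨s - T, by linarith, by linarith, Or.inl ?_, fun u h5 h6 =>
        h3 _ (by linarith) (by linarith)⟩
      simpa using h4
  · rintro ⟨s, h0, h1, h2, h3⟩
    rcases h2 with h2 | ⟨rfl, h4, h5⟩
    · refine ⟨T + s, by linarith, by linarith, Or.inl h2, fun u h6 h7 => ?_⟩
      have := h3 (u - T) (by linarith) (by linarith)
      simpa using this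
    · refine ⟨0, le_rfl, by linarith, h4.imp (fun h => (hx 0 le_rfl hT).symm ▸ h) fun h =>
        ⟨rfl, h⟩, fun u h6 h7 => ?_⟩
      by_cases hu : u < T
      · rwa [hx u h6 hu]
      · have := h3 (u - T) (by linarith) (by linarith)
        simpa using this

section Switch

variable {lo hi : ℝ} {z : Prop} {x : ℝ → ℝ}

theorem switchTime_le_succ (n : ℕ) : switchTime lo hi z x n ≤ switchTime lo hi z x (n + 1) := by
  conv_rhs => unfold switchTime
  split_ifs with h1 h2
  · rw [h2.1]; simp [switchTime]
  · exact le_hitTime _ _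
  · exact le_hitTime _ _

theorem switchTime_mono : Monotone (switchTime lo hi z x) :=
  monotone_nat_of_le_succ switchTime_le_succ

variable (hr : ∀ t, 0 ≤ t → ∃ T, t < T ∧ ∀ u, t ≤ u → u < T → x u = x t)
include hr

theorem switchTime_odd (n : ℕ) (h : switchTime lo hi z x (2 * n + 1) ≠ ⊤) :
    ∃ τ : ℝ, switchTime lo hi z x (2 * n + 1) = τ ∧ 0 ≤ τ ∧ (x τ < lo ∨ (n = 0 ∧ τ = 0 ∧ z)) := by
  unfold switchTime at h ⊢
  rw [if_pos (even_two_mul n)] at h ⊢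
  split_ifs at h ⊢ with h2
  · exact ⟨0, rfl, le_rfl, Or.inr ⟨by omega, rfl, h2.2⟩⟩
  · obtain ⟨τ, h3, h4, -, h5⟩ := hitTime_attained (fun t ht => by
      obtain ⟨T, h1, h2⟩ := hr t ht
      exact ⟨T, h1, fun u h3 h4 h5 => h2 u h3 h4 ▸ h5⟩) h
    exact ⟨τ, h3, h4, Or.inl h5⟩

theorem switchTime_even (n : ℕ) (h : switchTime lo hi z x (2 * n + 2) ≠ ⊤) :
    ∃ τ : ℝ, switchTime lo hi z x (2 * n + 2) = τ ∧ 0 ≤ τ ∧ hi ≤ x τ := by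
  unfold switchTime at h ⊢
  rw [if_neg (by simp)] at h ⊢
  obtain ⟨τ, h3, h4, -, h5⟩ := hitTime_attained (fun t ht => by
      obtain ⟨T, h1, h2⟩ := hr t ht
      exact ⟨T, h1, fun u h3 h4 h5 => h2 u h3 h4 ▸ h5⟩) h
  exact ⟨τ, h3, h4, h5⟩

variable (hl : ∀ t, 0 < t → ∃ T, T < t ∧ ∃ v, ∀ u, 0 ≤ u → T < u → u < t → x u = v)
  (hlh : lo < hi)
include hl hlh

/-- Otherwise the switching times accumulate at some `σ`, and just before `σ` the path is both below
`lo` and at least `hi`, although it is constant there. -/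
theorem exists_lt_switchTime (t : ℝ) : ∃ n, (t : EReal) < switchTime lo hi z x n := by
  by_contra hcon
  push Not at hcon
  have hne : ∀ n, switchTime lo hi z x n ≠ ⊤ := fun n h => by
    have := hcon n; rw [h] at this; simp at this
  have hex : ∀ n, ∃ τ : ℝ, switchTime lo hi z x n = τ ∧ 0 ≤ τ := by
    intro n
    rcases Nat.even_or_odd' n with ⟨k, rfl | rfl⟩
    · cases k with
      | zero => exact ⟨0, by simp [switchTime], le_rfl⟩
      | succ k =>
        obtain ⟨τ, h1, h2, -⟩ := switchTime_even hr k (hne _)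
        exact ⟨τ, h1, h2⟩
    · obtain ⟨τ, h1, h2, -⟩ := switchTime_odd hr k (hne _)
      exact ⟨τ, h1, h2⟩
  choose τ hτ hτ0 using hex
  have hmono : Monotone τ := fun a b hab => by
    have := switchTime_mono (lo := lo) (hi := hi) (z := z) (x := x) hab
    rw [hτ, hτ] at this
    exact EReal.coe_le_coe_iff.1 this
  have hbdd : BddAbove (range τ) := ⟨t, by
    rintro _ ⟨n, rfl⟩
    have := hcon n
    rw [hτ] at this
    exact EReal.coe_le_coe_iff.1 this⟩
  -- The first depletion time is left out: it may be due to the initial indicator and not to the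
  -- path.
  have hodd : ∀ n, x (τ (2 * (n + 1) + 1)) < lo := by
    intro n
    obtain ⟨τ', h1, -, h3⟩ := switchTime_odd hr (n + 1) (hne _)
    rw [hτ] at h1
    rw [EReal.coe_eq_coe_iff.1 h1]
    exact h3.resolve_right fun h => by omega
  have heven : ∀ n, hi ≤ x (τ (2 * n + 2)) := by
    intro n
    obtain ⟨τ', h1, -, h3⟩ := switchTime_even hr n (hne _)
    rw [hτ] at h1
    rw [EReal.coe_eq_coe_iff.1 h1]
    exact h3
  set σ := ⨆ n, τ n with hσ
  have hle : ∀ n, τ n ≤ σ := fun n => le_ciSup hbdd n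
  have hlt : ∀ n, τ n < σ := by
    intro N
    by_contra h
    have hN : ∀ n, N ≤ n → τ n = σ := fun n hn =>
      le_antisymm (hle n) ((not_lt.1 h).trans (hmono hn))
    have h1 := hodd N
    have h2 := heven N
    rw [hN _ (by omega)] at h1 h2
    linarith
  obtain ⟨T, hT, v, hv⟩ := hl σ ((hτ0 0).trans_lt (hlt 0))
  obtain ⟨N, hN⟩ := exists_lt_of_lt_ciSup hT
  have h1 := hodd N
  have h2 := heven N
  rw [hv _ (hτ0 _) (hN.trans_le (hmono (by omega))) (hlt _)] at h1 h2
  linarith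

/-- Only finitely many switches occur up to `t`, so there is a last one, and its parity decides. A
history of depletion excludes an even last switch, since a depletion time would have followed it by
`t`. -/
theorem isDepleted_iff {t : ℝ} (ht : 0 ≤ t) :
    IsDepleted lo hi z x t ↔ DepletedHistory lo hi z x t := by
  constructor
  · rintro ⟨n, h1, h2⟩
    obtain ⟨τ, h3, h4, h5⟩ := switchTime_odd hr n (h1.trans_lt (EReal.coe_lt_top t)).ne
    have hτt : τ ≤ t := EReal.coe_le_coe_iff.1 (h3 ▸ h1)
    refine ⟨τ, h4, hτt, h5.imp id fun h => h.2, fun u h6 h7 => ?_⟩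
    by_contra h8
    have h9 : switchTime lo hi z x (2 * n + 2) ≤ u := by
      unfold switchTime
      rw [if_neg (by simp)]
      exact hitTime_le (h4.trans h6) (by rw [h3]; exact EReal.coe_le_coe_iff.2 h6) (not_lt.1 h8)
    exact absurd (h2.trans_le h9) (not_lt.2 (EReal.coe_le_coe_iff.2 h7))
  · rintro ⟨s, h0, h1, h2, h3⟩
    classical
    -- `n` is the first switch after `t`, and its predecessor `k` is the last one up to `t`.
    have hex := exists_lt_switchTime (z := z) hr hl hlh t
    set n := Nat.find hex with hn
    have h4 : (t : EReal) < switchTime lo hi z x n := Nat.find_spec hex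
    have hn0 : n ≠ 0 := by
      intro h
      rw [h] at h4
      simp only [switchTime] at h4
      exact absurd h4 (not_lt.2 (by exact_mod_cast ht))
    obtain ⟨k, hk⟩ := Nat.exists_eq_succ_of_ne_zero hn0
    have h5 : switchTime lo hi z x k ≤ t := not_lt.1 (Nat.find_min hex (by omega))
    rw [hk] at h4
    rcases Nat.even_or_odd' k with ⟨m, rfl | rfl⟩
    · exfalso
      have hst : (s : EReal) ≤ t := EReal.coe_le_coe_iff.2 h1
      simp only [Nat.succ_eq_add_one] at h4
      cases m with
      | zero =>
        simp only [switchTime, Even.zero, if_true, true_and] at h4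
        split_ifs at h4 with hz
        · exact absurd h4 (not_lt.2 (by exact_mod_cast ht))
        · have h6 := h2.resolve_right fun h => hz h.2
          exact absurd (h4.trans_le (hitTime_le h0 (by exact_mod_cast h0) h6)) (not_lt.2 hst)
      | succ m =>
        obtain ⟨τ, h6, h7, h8⟩ := switchTime_even hr m (h5.trans_lt (EReal.coe_lt_top t)).ne
        have h6' : switchTime lo hi z x (2 * (m + 1)) = τ := h6
        have h9 : τ ≤ t := by rw [h6'] at h5; exact EReal.coe_le_coe_iff.1 h5
        have h10 : τ < s := by
          by_contra h
          exact absurd (h3 τ (not_lt.1 h) h9) (not_lt.2 h8)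
        have h11 : x s < lo := h2.resolve_right fun h => by linarith [h.1]
        have h12 : switchTime lo hi z x (2 * (m + 1) + 1) ≤ s := by
          rw [switchTime, if_pos (even_two_mul _), if_neg (by omega), h6']
          exact hitTime_le h0 (EReal.coe_le_coe_iff.2 h10.le) h11
        exact absurd (h4.trans_le h12) (not_lt.2 hst)
    · exact ⟨m, h5, h4⟩

end Switch

/-! ### The queue length process as a jump process -/

/-- The state of the network just before the depletion indicators react to the queue lengths. -/
structure NetState (J : ℕ) where
  /-- queue lengths -/
  queue : Fin J → ℕ
  /-- depletion indicators before the last jump -/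
  dep : Fin J → Bool
  /-- whether a given set has been visited before the last jump -/
  hit : Bool

section Path

variable {J : ℕ} (lo hi : ℝ) (y : Set (Fin J) → Fin J → ℝ) (D : (Fin J → ℤ) → Prop)

/-- Queue `j` is depleted. -/
def NetState.Depleted (s : NetState J) (j : Fin J) : Prop :=
  ((s.queue j : ℝ) < lo ∨ s.dep j = true) ∧ (s.queue j : ℝ) < hi

/-- The queue lengths are in `D`, or have been before. -/
def NetState.Hit (s : NetState J) : Prop := s.hit = true ∨ D fun j => s.queue j

open Classical in
/-- The flow rate of job type `j`. -/
def NetState.flow (s : NetState J) (j : Fin J) : ℝ :=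
  if s.Depleted lo hi j then 0 else y {k | hi ≤ (s.queue k : ℝ)} j

open Classical in
/-- The queue length process with depletion indicators; clocks `inl j` are arrivals and clocks
`inr j` are services of type `j`. -/
def netProcess : JumpProcess (Fin J ⊕ Fin J) (NetState J) where
  speed s := Sum.elim (fun _ => 1) (s.flow lo hi y)
  next s a :=
    { queue := Sum.elim (fun j => Function.update s.queue j (s.queue j + 1))
        (fun j => Function.update s.queue j (s.queue j - 1)) a
      dep := fun j => decide (s.Depleted lo hi j)
      hit := decide (s.Hit D) }

open Classical in
/-- The flow rate of type `j` at time `t` when the queue lengths follow `Q` and the initial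
depletion indicators are `z`. -/
def pathFlow (z : Fin J → Bool) (Q : ℝ → Fin J → ℤ) (t : ℝ) (j : Fin J) : ℝ :=
  if DepletedHistory lo hi (z j = true) (fun u => (Q u j : ℝ)) t then 0
  else y {k | hi ≤ (Q t k : ℝ)} j

/-- `Q` is a queue length path from `s` when arrivals and services are counted by the clocks. -/
structure IsQueuePath (s : NetState J) (U : (Fin J ⊕ Fin J) × ℕ → ℝ) (Q : ℝ → Fin J → ℤ) :
    Prop where
  integrable : ∀ t, 0 ≤ t → ∀ j,
    IntervalIntegrable (fun u => pathFlow lo hi y s.dep Q u j) volume 0 t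
  queue_eq : ∀ t, 0 ≤ t → ∀ j, Q t j = (s.queue j : ℤ)
    + (renewalCount (fun k => U (Sum.inl j, k)) t : ℤ)
    - (renewalCount (fun k => U (Sum.inr j, k))
        (∫ u in (0 : ℝ)..t, pathFlow lo hi y s.dep Q u j) : ℤ)

/-- All variables are positive and no clock rings infinitely often in finite time. -/
structure GoodClocks {A : Type*} (U : A × ℕ → ℝ) : Prop where
  pos : ∀ p, 0 < U p
  unbounded : ∀ a, ∀ M : ℝ, ∃ k, M < ∑ n ∈ Finset.range k, U (a, n)

/-- The case `m = 1` is for the clock that has lost its first variable, `m = 0` for a clock whose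
first variable has been reduced. -/
theorem unbounded_of_tail {ξ ξ' : ℕ → ℝ} (h : ∀ M : ℝ, ∃ k, M < ∑ n ∈ Finset.range k, ξ n)
    {m : ℕ} (hm : ∀ n, 1 ≤ n → ξ' (n - m) = ξ n) (hm1 : m ≤ 1) :
    ∀ M : ℝ, ∃ k, M < ∑ n ∈ Finset.range k, ξ' n := by
  intro M
  -- The maximum with `0` rules out an empty sum.
  obtain ⟨k, hk⟩ := h (max 0 (M + ξ 0 - (if m = 0 then ξ' 0 else 0)))
  cases k with
  | zero => simp at hk
  | succ k =>
    rw [Finset.sum_range_succ'] at hk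
    have h1 := (le_max_right _ _).trans_lt hk
    rcases Nat.le_one_iff_eq_zero_or_eq_one.1 hm1 with rfl | rfl
    · refine ⟨k + 1, ?_⟩
      rw [Finset.sum_range_succ']
      have : ∀ n, ξ' (n + 1) = ξ (n + 1) := fun n => by simpa using hm (n + 1) (by omega)
      simp_rw [this]
      simp at h1
      linarith
    · refine ⟨k, ?_⟩
      have : ∀ n, ξ' n = ξ (n + 1) := fun n => by simpa using hm (n + 1) (by omega)
      simp_rw [this]
      simp at h1
      linarith

section Rest

set_option linter.unusedSectionVars false

variable {A : Type*} [DecidableEq A] {sp : A → ℝ} {a : A} {U : A × ℕ → ℝ}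

theorem ringTime_pos (hU : GoodClocks U) (ha : RingsFirst sp a U) : 0 < ringTime sp a U :=
  div_pos (hU.pos _) ha.1

theorem speed_mul_ringTime (ha : RingsFirst sp a U) : sp a * ringTime sp a U = U (a, 0) :=
  mul_div_cancel₀ _ ha.1.ne'

theorem speed_mul_ringTime_le (ha : RingsFirst sp a U) (b : A) :
    sp b * ringTime sp a U ≤ U (b, 0) := by
  by_cases h : b = a
  · rw [h, speed_mul_ringTime ha]
  · exact (ha.2 b h).le

theorem GoodClocks.rest (hU : GoodClocks U) (ha : RingsFirst sp a U) :
    GoodClocks (restClocks sp a U) where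
  pos := by
    rintro ⟨b, k⟩
    unfold restClocks
    split_ifs with h1 h2
    · exact hU.pos _
    · simp only at h2 h1
      subst h2
      linarith [ha.2 b h1]
    · exact hU.pos _
  unbounded := by
    intro b
    by_cases hb : b = a
    · subst hb
      refine unbounded_of_tail (hU.unbounded b) (m := 1) (fun n hn => ?_) le_rfl
      simp [restClocks, Nat.sub_add_cancel hn]
    · refine unbounded_of_tail (hU.unbounded b) (m := 0) (fun n hn => ?_) zero_le_one
      have : n ≠ 0 := by omega
      simp [restClocks, hb, this]

theorem renewalCount_rest (hU : GoodClocks U) (ha : RingsFirst sp a U) {b : A} (hb : 0 ≤ sp b)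
    {v : ℝ} (hv : 0 ≤ v) :
    renewalCount (fun k => U (b, k)) (sp b * ringTime sp a U + v)
      = renewalCount (fun k => restClocks sp a U (b, k)) v + if b = a then 1 else 0 := by
  have hR := hU.rest ha
  by_cases h : b = a
  · subst h
    have h1 : (fun k => restClocks sp b U (b, k)) = fun k => U (b, k + 1) := by
      funext k; simp [restClocks]
    rw [speed_mul_ringTime ha, if_pos rfl, h1]
    exact renewalCount_first_add (ξ := fun k => U (b, k)) (fun n => hU.pos _) (hU.unbounded b)
      (by have := hR.unbounded b; simpa [restClocks] using this) hv
  · rw [if_neg h, add_zero]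
    exact renewalCount_sub_first (fun n => hU.pos _) (hU.unbounded b) (fun n => hR.pos _)
      (hR.unbounded b) (mul_nonneg hb (ringTime_pos hU ha).le) hv (by simp [restClocks, h])
      (fun n => by simp [restClocks, h])

end Rest

variable {lo hi y D}

theorem pathFlow_mem {Y : ℝ} (hy : ∀ s j, 0 ≤ y s j ∧ y s j ≤ Y) (hY : 0 ≤ Y) (z : Fin J → Bool)
    (Q : ℝ → Fin J → ℤ) (t : ℝ) (j : Fin J) :
    0 ≤ pathFlow lo hi y z Q t j ∧ pathFlow lo hi y z Q t j ≤ Y := by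
  unfold pathFlow
  split_ifs
  · exact ⟨le_rfl, hY⟩
  · exact hy _ _

theorem pathFlow_of_const {s : NetState J} {Q : ℝ → Fin J → ℤ} {t : ℝ} (ht : 0 ≤ t)
    (hQ : ∀ u, 0 ≤ u → u ≤ t → ∀ j, Q u j = s.queue j) (j : Fin J) :
    pathFlow lo hi y s.dep Q t j = s.flow lo hi y j := by
  have h1 : DepletedHistory lo hi (s.dep j = true) (fun u => (Q u j : ℝ)) t
      ↔ s.Depleted lo hi j :=
    depletedHistory_of_const ht fun u h0 h1 => by rw [hQ u h0 h1 j]; simp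
  have h2 : ∀ k, (Q t k : ℝ) = s.queue k := fun k => by rw [hQ t ht le_rfl k]; simp
  have h3 : {k | hi ≤ (Q t k : ℝ)} = {k | hi ≤ (s.queue k : ℝ)} := by
    ext k; rw [mem_ofPred_eq, mem_ofPred_eq, h2]
  unfold pathFlow NetState.flow
  by_cases h : s.Depleted lo hi j
  · rw [if_pos h, if_pos (h1.2 h)]
  · rw [if_neg h, if_neg (mt h1.1 h), h3]

theorem integral_eq_of_eq_const {f : ℝ → ℝ} {c t : ℝ} (ht : 0 ≤ t)
    (hf : ∀ u, 0 ≤ u → u < t → f u = c) : ∫ u in (0 : ℝ)..t, f u = c * t := by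
  rw [intervalIntegral.integral_of_le ht, integral_Ioc_eq_integral_Ioo,
    setIntegral_congr_fun measurableSet_Ioo (g := fun _ => c) fun u hu => hf u hu.1.le hu.2]
  simp [ht, mul_comm]

section Bounded

variable {f : ℝ → ℝ} {Y : ℝ} (hf : ∀ t, 0 ≤ f t ∧ f t ≤ Y)
  (hint : ∀ t, 0 ≤ t → IntervalIntegrable f volume 0 t)
include hf hint

theorem integral_sub_integral_mem {t u : ℝ} (ht : 0 ≤ t) (htu : t ≤ u) :
    0 ≤ (∫ v in (0 : ℝ)..u, f v) - ∫ v in (0 : ℝ)..t, f v ∧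
      (∫ v in (0 : ℝ)..u, f v) - (∫ v in (0 : ℝ)..t, f v) ≤ Y * (u - t) := by
  have hii : IntervalIntegrable f volume t u := (hint t ht).symm.trans (hint u (ht.trans htu))
  rw [intervalIntegral.integral_interval_sub_left (hint u (ht.trans htu)) (hint t ht)]
  refine ⟨intervalIntegral.integral_nonneg htu fun v _ => (hf v).1, ?_⟩
  have := intervalIntegral.integral_mono_on htu hii
    (intervalIntegrable_const (c := Y)) fun v _ => (hf v).2
  simpa [mul_comm] using this

end Bounded

section Step

variable {s : NetState J} {U : (Fin J ⊕ Fin J) × ℕ → ℝ} {Q : ℝ → Fin J → ℤ} {Y : ℝ}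

theorem NetState.flow_mem (hy : ∀ s j, 0 ≤ y s j ∧ y s j ≤ Y) (hY : 0 ≤ Y) (s : NetState J)
    (j : Fin J) : 0 ≤ s.flow lo hi y j ∧ s.flow lo hi y j ≤ Y := by
  unfold NetState.flow
  split_ifs
  · exact ⟨le_rfl, hY⟩
  · exact hy _ _

theorem netProcess_speed_nonneg (hy : ∀ s j, 0 ≤ y s j ∧ y s j ≤ Y) (hY : 0 ≤ Y)
    (s : NetState J) (a : Fin J ⊕ Fin J) : 0 ≤ (netProcess lo hi y D).speed s a := by
  cases a with
  | inl j => exact zero_le_one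
  | inr j => exact (s.flow_mem hy hY j).1

theorem netProcess_speed_le (hy : ∀ s j, 0 ≤ y s j ∧ y s j ≤ Y) (hY : 0 ≤ Y)
    (s : NetState J) (a : Fin J ⊕ Fin J) : (netProcess lo hi y D).speed s a ≤ max 1 Y := by
  cases a with
  | inl j => exact le_max_left _ _
  | inr j => exact (s.flow_mem hy hY j).2.trans (le_max_right _ _)

variable (hy : ∀ s j, 0 ≤ y s j ∧ y s j ≤ Y) (hY : 0 ≤ Y) (hQ : IsQueuePath lo hi y s U Q)
  (hU : GoodClocks U) {a : Fin J ⊕ Fin J}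
  (ha : RingsFirst ((netProcess lo hi y D).speed s) a U)
include hy hY hQ hU ha

/-- The path determines the flow that drives it, so this is a continuation argument. Up to the
infimum `t₁` of the times of deviation the flow is constant and no clock has been used up; as the
flow is bounded, none is used up for some time after `t₁` either. -/
theorem IsQueuePath.const {t : ℝ} (ht0 : 0 ≤ t)
    (ht : t < ringTime ((netProcess lo hi y D).speed s) a U) (j : Fin J) :
    Q t j = s.queue j := by
  set sp := (netProcess lo hi y D).speed s with hsp
  set T := ringTime sp a U with hT
  by_contra hne
  set S := {t : ℝ | 0 ≤ t ∧ t < T ∧ ∃ j, Q t j ≠ s.queue j} with hS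
  have hSne : S.Nonempty := ⟨t, ht0, ht, j, hne⟩
  have hbdd : BddBelow S := ⟨0, fun t ht => ht.1⟩
  set t₁ := sInf S with ht₁
  have ht₁0 : 0 ≤ t₁ := le_csInf hSne fun t ht => ht.1
  have ht₁T : t₁ < T := (csInf_le hbdd ⟨ht0, ht, j, hne⟩).trans_lt ht
  have hconst : ∀ u, 0 ≤ u → u < t₁ → ∀ j, Q u j = s.queue j := by
    intro u h0 h1 k
    by_contra h
    exact absurd (csInf_le hbdd (show u ∈ S from ⟨h0, h1.trans ht₁T, k, h⟩)) (not_le.2 h1)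
  have hB : ∀ k, ∫ u in (0 : ℝ)..t₁, pathFlow lo hi y s.dep Q u k = sp (Sum.inr k) * t₁ := by
    intro k
    refine integral_eq_of_eq_const ht₁0 fun u h0 h1 => ?_
    exact pathFlow_of_const h0 (fun v h2 h3 => hconst v h2 (h3.trans_lt h1)) k
  have hlt : ∀ k, sp (Sum.inr k) * t₁ < U (Sum.inr k, 0) := by
    intro k
    have h1 := speed_mul_ringTime_le ha (Sum.inr k)
    rcases (netProcess_speed_nonneg (D := D) hy hY s (Sum.inr k)).eq_or_lt with h2 | h2
    · rw [hsp, ← h2, zero_mul]; exact hU.pos _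
    · exact (mul_lt_mul_of_pos_left ht₁T h2).trans_le h1
  -- A common waiting time for all service clocks; `Y + 1` replaces `Y` because `Y` may vanish.
  have hε : ∃ ε > 0, ∀ k, (Y + 1) * ε ≤ U (Sum.inr k, 0) - sp (Sum.inr k) * t₁ := by
    have hj : Nonempty (Fin J) := ⟨j⟩
    obtain ⟨k₀, hk₀⟩ := Finite.exists_min fun k => U (Sum.inr k, 0) - sp (Sum.inr k) * t₁
    refine ⟨(U (Sum.inr k₀, 0) - sp (Sum.inr k₀) * t₁) / (Y + 1),
      div_pos (by linarith [hlt k₀]) (by linarith), fun k => ?_⟩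
    rw [mul_div_cancel₀ _ (by linarith : Y + 1 ≠ 0)]
    exact hk₀ k
  obtain ⟨ε, hε0, hε⟩ := hε
  obtain ⟨u, hu, huε⟩ := exists_lt_of_csInf_lt hSne (show sInf S < t₁ + ε by linarith)
  obtain ⟨hu0, huT, k, hk⟩ := hu
  have htu : t₁ ≤ u := csInf_le hbdd ⟨hu0, huT, k, hk⟩
  apply hk
  have hflow := fun t => pathFlow_mem (lo := lo) (hi := hi) hy hY s.dep Q t k
  have h1 := integral_sub_integral_mem hflow (fun t ht => hQ.integrable t ht k) ht₁0 htu
  have h2 := integral_sub_integral_mem hflow (fun t ht => hQ.integrable t ht k) le_rfl hu0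
  rw [hB] at h1
  simp only [intervalIntegral.integral_same, sub_zero] at h2
  have h3 : Y * (u - t₁) < (Y + 1) * ε := by nlinarith
  rw [hQ.queue_eq u hu0 k, renewalCount_eq_zero (fun n => hU.pos _) (hU.unbounded _) hu0,
    renewalCount_eq_zero (fun n => hU.pos _) (hU.unbounded _) h2.1]
  · simp
  · linarith [hε k]
  · have := speed_mul_ringTime_le ha (Sum.inl k)
    have h4 : sp (Sum.inl k) = 1 := rfl
    rw [h4, one_mul] at this
    exact huT.trans_le this

/-- The path restarts at the first ring: arrival clocks have advanced by the elapsed time and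
service clocks by the allocated effort, which are exactly the amounts removed by `restClocks`. -/
theorem IsQueuePath.next (hlo : 0 < lo) (hlh : lo < hi) :
    IsQueuePath lo hi y ((netProcess lo hi y D).next s a)
      (restClocks ((netProcess lo hi y D).speed s) a U)
      (fun t => Q (ringTime ((netProcess lo hi y D).speed s) a U + t)) := by
  have hconst := fun t h0 h1 => IsQueuePath.const (t := t) hy hY hQ hU ha h0 h1
  set sp := (netProcess lo hi y D).speed s with hsp
  set T := ringTime sp a U with hT
  set s' := (netProcess lo hi y D).next s a with hs'
  have hT0 : 0 < T := ringTime_pos hU ha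
  have hflow : ∀ t, 0 ≤ t → ∀ j,
      pathFlow lo hi y s'.dep (fun t => Q (T + t)) t j = pathFlow lo hi y s.dep Q (T + t) j := by
    intro t ht j
    have h1 := depletedHistory_shift (lo := lo) (hi := hi) (z := s.dep j = true)
      (x := fun u => (Q u j : ℝ)) (c := s.queue j) hT0 ht
      (fun u h0 h1 => by rw [hconst u h0 h1]; simp)
    have h2 : (s'.dep j = true) ↔
        ((s.queue j : ℝ) < lo ∨ s.dep j = true) ∧ (s.queue j : ℝ) < hi := by
      simp only [hs', netProcess, decide_eq_true_iff]
      rfl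
    have h3 := h1.trans (iff_of_eq (congrArg (fun p => DepletedHistory lo hi p
      (fun u => (Q (T + u) j : ℝ)) t) (propext h2.symm)))
    unfold pathFlow
    by_cases h : DepletedHistory lo hi (s.dep j = true) (fun u => (Q u j : ℝ)) (T + t)
    · rw [if_pos h, if_pos (h3.1 h)]
    · rw [if_neg h, if_neg (mt h3.2 h)]
  have hint : ∀ t, 0 ≤ t → ∀ j,
      IntervalIntegrable (fun u => pathFlow lo hi y s.dep Q (T + u) j) volume 0 t := by
    intro t ht j
    have h1 : IntervalIntegrable (fun u => pathFlow lo hi y s.dep Q u j) volume T (T + t) :=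
      (hQ.integrable T hT0.le j).symm.trans (hQ.integrable (T + t) (by linarith) j)
    have := h1.comp_add_left T
    simpa using this
  have hB : ∀ t, 0 ≤ t → ∀ j, ∫ u in (0 : ℝ)..(T + t), pathFlow lo hi y s.dep Q u j
      = sp (Sum.inr j) * T +
        ∫ u in (0 : ℝ)..t, pathFlow lo hi y s'.dep (fun t => Q (T + t)) u j := by
    intro t ht j
    rw [← intervalIntegral.integral_add_adjacent_intervals (hQ.integrable T hT0.le j)
      ((hQ.integrable T hT0.le j).symm.trans (hQ.integrable (T + t) (by linarith) j))]
    congr 1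
    · exact integral_eq_of_eq_const hT0.le fun u h0 h1 =>
        pathFlow_of_const h0 (fun v h2 h3 k => hconst v h2 (h3.trans_lt h1) k) j
    · have h1 : ∫ u in (0 : ℝ)..t, pathFlow lo hi y s'.dep (fun t => Q (T + t)) u j
          = ∫ u in (0 : ℝ)..t, pathFlow lo hi y s.dep Q (T + u) j :=
        intervalIntegral.integral_congr fun u hu => hflow u (by
          rw [uIcc_of_le ht] at hu; exact hu.1) j
      rw [h1, intervalIntegral.integral_comp_add_left
        (fun u => pathFlow lo hi y s.dep Q u j) T, add_zero]
  refine ⟨fun t ht j => ?_, fun t ht j => ?_⟩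
  · refine (hint t ht j).congr fun u hu => ?_
    rw [uIoc_of_le ht] at hu
    exact (hflow u hu.1.le j).symm
  · have hnn : 0 ≤ ∫ u in (0 : ℝ)..t, pathFlow lo hi y s'.dep (fun t => Q (T + t)) u j :=
      intervalIntegral.integral_nonneg ht fun u _ => (pathFlow_mem hy hY _ _ _ _).1
    have hl := renewalCount_rest hU ha (b := Sum.inl j) zero_le_one ht
    have hr := renewalCount_rest hU ha (b := Sum.inr j)
      (netProcess_speed_nonneg (D := D) hy hY s (Sum.inr j)) hnn
    have h4 : sp (Sum.inl j) = 1 := rfl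
    rw [h4, one_mul] at hl
    rw [hQ.queue_eq (T + t) (by linarith) j, hB t ht j, hl, hr]
    cases a with
    | inl k =>
      by_cases hk : j = k
      · subst hk
        simp [hs', netProcess]
        ring
      · simp [hs', netProcess, hk]
    | inr k =>
      by_cases hk : j = k
      · subst hk
        -- A service clock that rings has positive speed, so its queue is not depleted and exceeds
        -- `lo > 0`. Hence the subtraction of natural numbers in `next` is not truncated.
        have hq : 1 ≤ s.queue j := by
          have h5 : ¬ s.Depleted lo hi j := by
            intro h
            have : sp (Sum.inr j) = 0 := if_pos h
            exact absurd ha.1 (by rw [this]; exact lt_irrefl _)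
          by_contra h
          have h6 : s.queue j = 0 := by omega
          unfold NetState.Depleted at h5
          rw [h6] at h5
          push_cast at h5
          exact h5 ⟨Or.inl hlo, hlo.trans hlh⟩
        simp [hs', netProcess, Nat.cast_sub hq]
        ring
      · simp [hs', netProcess, hk]

end Step

end Path

/-! ### The jump process along queue length paths -/

/-- A bounded set of natural numbers has a maximum, so the monotone function attains its supremum
over `[0, t)` at some `T` and keeps it until `t`. -/
theorem exists_left_const {m : ℝ → ℕ} (hm : ∀ a b, 0 ≤ a → a ≤ b → m a ≤ m b) {t : ℝ} (ht : 0 < t) :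
    ∃ T, T < t ∧ ∃ v, ∀ u, 0 ≤ u → T < u → u < t → m u = v := by
  set S := m '' Ico 0 t with hS
  have hne : S.Nonempty := ⟨m 0, 0, ⟨le_rfl, ht⟩, rfl⟩
  have hbdd : BddAbove S := ⟨m t, by rintro _ ⟨u, hu, rfl⟩; exact hm _ _ hu.1 hu.2.le⟩
  obtain ⟨T, hT, hTv⟩ := Nat.sSup_mem hne hbdd
  refine ⟨T, hT.2, sSup S, fun u h0 h1 h2 => le_antisymm (le_csSup hbdd ⟨u, ⟨h0, h2⟩, rfl⟩) ?_⟩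
  rw [← hTv]
  exact hm _ _ hT.1 h1.le

section Regularity

variable {ξ ξ' : ℕ → ℝ} (hpos : ∀ n, 0 < ξ n)
  (hunb : ∀ M : ℝ, ∃ k, M < ∑ n ∈ Finset.range k, ξ n) (hpos' : ∀ n, 0 < ξ' n)
  (hunb' : ∀ M : ℝ, ∃ k, M < ∑ n ∈ Finset.range k, ξ' n)
  {f : ℝ → ℝ} {Y : ℝ} (hf : ∀ t, 0 ≤ f t ∧ f t ≤ Y)
  (hint : ∀ t, 0 ≤ t → IntervalIntegrable f volume 0 t) {x : ℝ → ℤ} {q : ℤ}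
  (hx : ∀ t, 0 ≤ t → x t = q + (renewalCount ξ t : ℤ)
    - (renewalCount ξ' (∫ u in (0 : ℝ)..t, f u) : ℤ))
include hpos hunb hpos' hunb' hf hint hx

theorem queue_right_const {t : ℝ} (ht : 0 ≤ t) :
    ∃ T, t < T ∧ ∀ u, t ≤ u → u < T → x u = x t := by
  have hY : 0 ≤ Y := (hf 0).1.trans (hf 0).2
  have hB0 : 0 ≤ ∫ u in (0 : ℝ)..t, f u :=
    intervalIntegral.integral_nonneg ht fun u _ => (hf u).1
  obtain ⟨T₁, h1, h2⟩ := renewalCount_right_const hpos hunb ht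
  obtain ⟨T₂, h3, h4⟩ := renewalCount_right_const hpos' hunb' hB0
  set ε := (T₂ - ∫ u in (0 : ℝ)..t, f u) / (Y + 1) with hε
  have hε0 : 0 < ε := div_pos (by linarith) (by linarith)
  have hεY : (Y + 1) * ε = T₂ - ∫ u in (0 : ℝ)..t, f u := mul_div_cancel₀ _ (by linarith)
  refine ⟨min T₁ (t + ε), lt_min h1 (by linarith), fun u h5 h6 => ?_⟩
  have h7 := integral_sub_integral_mem hf hint ht h5
  have h8 : u < t + ε := h6.trans_le (min_le_right _ _)
  rw [hx u (ht.trans h5), hx t ht, h2 u h5 (h6.trans_le (min_le_left _ _)),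
    h4 _ (by linarith [h7.1]) (by nlinarith [h7.2])]

theorem queue_left_const {t : ℝ} (ht : 0 < t) :
    ∃ T, T < t ∧ ∃ v, ∀ u, 0 ≤ u → T < u → u < t → x u = v := by
  obtain ⟨T₁, h1, v₁, h2⟩ := exists_left_const (m := renewalCount ξ)
    (fun a b h0 h => renewalCount_mono hpos hunb h0 h) ht
  obtain ⟨T₂, h3, v₂, h4⟩ := exists_left_const
    (m := fun t => renewalCount ξ' (∫ u in (0 : ℝ)..t, f u))
    (fun a b h0 h => renewalCount_mono hpos' hunb'
      (intervalIntegral.integral_nonneg h0 fun u _ => (hf u).1)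
      (by linarith [(integral_sub_integral_mem hf hint h0 h).1])) ht
  refine ⟨max T₁ T₂, max_lt h1 h3, q + v₁ - v₂, fun u h0 h5 h6 => ?_⟩
  rw [hx u h0, h2 u h0 ((le_max_left _ _).trans_lt h5) h6,
    h4 u h0 ((le_max_right _ _).trans_lt h5) h6]

end Regularity

/-- The number of times that the clocks ring up to time `t` if all of them run at speed `C`. -/
def ringCount {A : Type*} [Fintype A] (C : ℝ) (U : A × ℕ → ℝ) (t : ℝ) : ℕ :=
  ∑ a, renewalCount (fun k => U (a, k)) (C * t)

/-- The termination measure for following a path jump by jump: real speeds are at most `C`, so every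
ring consumes at least one of the rings available at full speed. -/
theorem ringCount_rest_lt {A : Type*} [Fintype A] [DecidableEq A] {sp : A → ℝ} {a : A}
    {U : A × ℕ → ℝ} (hU : GoodClocks U) (ha : RingsFirst sp a U) {C : ℝ}
    (hsp : ∀ b, 0 ≤ sp b ∧ sp b ≤ C) {t : ℝ} (ht : ringTime sp a U ≤ t) :
    ringCount C (restClocks sp a U) (t - ringTime sp a U) < ringCount C U t := by
  have hC : 0 ≤ C := (hsp a).1.trans (hsp a).2
  have hT := ringTime_pos hU ha
  have key : ∀ b, renewalCount (fun k => restClocks sp a U (b, k)) (C * (t - ringTime sp a U))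
      + (if b = a then 1 else 0) ≤ renewalCount (fun k => U (b, k)) (C * t) := by
    intro b
    rw [← renewalCount_rest hU ha (hsp b).1 (mul_nonneg hC (sub_nonneg.2 ht))]
    refine renewalCount_mono (fun n => hU.pos _) (hU.unbounded b) ?_ ?_
    · exact add_nonneg (mul_nonneg (hsp b).1 hT.le) (mul_nonneg hC (sub_nonneg.2 ht))
    · nlinarith [mul_le_mul_of_nonneg_right (hsp b).2 hT.le]
  unfold ringCount
  refine Finset.sum_lt_sum (fun b _ => (Nat.le_add_right _ _).trans (key b))
    ⟨a, Finset.mem_univ a, ?_⟩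
  have := key a
  rw [if_pos rfl] at this
  omega

open Classical in
theorem sum_ringsFirst {A : Type*} [Fintype A] {sp : A → ℝ} {a : A} {U : A × ℕ → ℝ}
    (ha : RingsFirst sp a U) (g : A → ℝ≥0∞) :
    ∑ b, (if RingsFirst sp b U then g b else 0) = g a := by
  classical
  rw [Finset.sum_eq_single a (fun b _ hb => if_neg fun h => hb (h.eq ha))
    (fun h => absurd (Finset.mem_univ a) h), if_pos ha]

theorem one_le_expHit {A S : Type*} [Fintype A] [DecidableEq A] (X : JumpProcess A S) {D : S → Prop} {β : ℝ} (hβ : 0 ≤ β) (n : ℕ) {s : S}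
    {U : A × ℕ → ℝ} (hU : GoodClocks U) (htie : X.NoTies n s U) :
    1 ≤ X.expHit D β n s U := by
  classical
  induction n generalizing s U with
  | zero => exact le_rfl
  | succ n ih =>
    obtain ⟨a, ha, htie⟩ := htie
    rw [JumpProcess.expHit]
    split_ifs
    · exact le_rfl
    rw [sum_ringsFirst ha]
    refine one_le_mul ?_ (ih (hU.rest ha) htie)
    rw [← ENNReal.ofReal_one]
    exact ENNReal.ofReal_le_ofReal
      (Real.one_le_exp (mul_nonneg hβ (ringTime_pos hU ha).le))

section Path

variable {J : ℕ} {lo hi : ℝ} {y : Set (Fin J) → Fin J → ℝ} {D : (Fin J → ℤ) → Prop}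
  {s : NetState J} {U : (Fin J ⊕ Fin J) × ℕ → ℝ} {Q : ℝ → Fin J → ℤ} {Y : ℝ}
  (hlo : 0 < lo) (hlh : lo < hi)
  (hy : ∀ s j, 0 ≤ y s j ∧ y s j ≤ Y) (hY : 0 ≤ Y)

include hlo hlh hy hY

/-- The path is followed from ring to ring by `IsQueuePath.const` and `IsQueuePath.next`. Once `n`
exceeds the ring count, the cut-off in `valueAt` is not reached. -/
theorem valueAt_eq (g : (Fin J → ℤ) → ℝ≥0∞) (n : ℕ) {t : ℝ} (ht : 0 ≤ t)
    (hQ : IsQueuePath lo hi y s U Q) (hU : GoodClocks U)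
    (htie : (netProcess lo hi y D).NoTies n s U) (hn : ringCount (max 1 Y) U t < n) :
    (netProcess lo hi y D).valueAt (fun s => g fun j => s.queue j) n s t U = g (Q t) := by
  classical
  induction n generalizing s U Q t with
  | zero => omega
  | succ n ih =>
    obtain ⟨a, ha, htie⟩ := htie
    rw [JumpProcess.valueAt]
    rw [sum_ringsFirst ha]
    split_ifs with h
    · congr 1
      funext j
      exact (hQ.const hy hY hU ha ht h j).symm
    · push Not at h
      have h1 := ringCount_rest_lt hU ha (C := max 1 Y) (fun b =>
        ⟨netProcess_speed_nonneg hy hY s b, netProcess_speed_le hy hY s b⟩) h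
      rw [ih (sub_nonneg.2 h) (hQ.next hy hY hU ha hlo hlh) (hU.rest ha) htie (by omega)]
      congr 2
      ring

theorem expHit_le {β : ℝ} (hβ : 0 ≤ β) (n : ℕ) {t : ℝ} (ht : 0 ≤ t)
    (hQ : IsQueuePath lo hi y s U Q) (hU : GoodClocks U)
    (htie : (netProcess lo hi y D).NoTies n s U) (hD : D (Q t)) :
    (netProcess lo hi y D).expHit (fun s => D fun j => s.queue j) β n s U
      ≤ ENNReal.ofReal (Real.exp (β * t)) := by
  classical
  have hone : ∀ t : ℝ, 0 ≤ t → 1 ≤ ENNReal.ofReal (Real.exp (β * t)) := fun t ht => by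
    rw [← ENNReal.ofReal_one]
    exact ENNReal.ofReal_le_ofReal (Real.one_le_exp (mul_nonneg hβ ht))
  induction n generalizing s U Q t with
  | zero => exact hone t ht
  | succ n ih =>
    obtain ⟨a, ha, htie⟩ := htie
    rw [JumpProcess.expHit]
    split_ifs with hs
    · exact hone t ht
    rw [sum_ringsFirst ha]
    by_cases h : t < ringTime ((netProcess lo hi y D).speed s) a U
    · have h1 : Q t = fun j => (s.queue j : ℤ) := funext fun j => hQ.const hy hY hU ha ht h j
      exact absurd (h1 ▸ hD) hs
    · push Not at h
      have h1 := ih (sub_nonneg.2 h) (hQ.next hy hY hU ha hlo hlh) (hU.rest ha) htie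
        (by simpa using hD)
      refine (mul_le_mul_right h1 _).trans (le_of_eq ?_)
      rw [← ENNReal.ofReal_mul (Real.exp_pos _).le, ← Real.exp_add]
      congr 2
      ring

/-- Together with `expHit_le` this encloses the exponential of the hitting time. Here `n` must be
large enough for the jump process to survive until `t`. -/
theorem le_expHit {β : ℝ} (hβ : 0 ≤ β) (n : ℕ) {t : ℝ} (ht : 0 ≤ t)
    (hQ : IsQueuePath lo hi y s U Q) (hU : GoodClocks U)
    (htie : (netProcess lo hi y D).NoTies n s U) (hn : ringCount (max 1 Y) U t < n)
    (hD : ∀ u, 0 ≤ u → u < t → ¬ D (Q u)) :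
    ENNReal.ofReal (Real.exp (β * t))
      ≤ (netProcess lo hi y D).expHit (fun s => D fun j => s.queue j) β n s U := by
  classical
  induction n generalizing s U Q t with
  | zero => omega
  | succ n ih =>
    obtain ⟨a, ha, htie⟩ := htie
    have hT := ringTime_pos hU ha
    rw [JumpProcess.expHit]
    split_ifs with hs
    · have h1 : Q 0 = fun j => (s.queue j : ℤ) :=
        funext fun j => hQ.const hy hY hU ha le_rfl hT j
      have h2 : t = 0 := by
        by_contra h
        exact hD 0 le_rfl (lt_of_le_of_ne ht (Ne.symm h)) (h1 ▸ hs)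
      simp [h2]
    rw [sum_ringsFirst ha]
    by_cases h : t < ringTime ((netProcess lo hi y D).speed s) a U
    · have h1 := one_le_expHit (netProcess lo hi y D) (D := fun s => D fun j => s.queue j) hβ n (hU.rest ha) htie
      refine le_trans ?_ (mul_le_mul_right h1 _)
      rw [mul_one]
      exact ENNReal.ofReal_le_ofReal (Real.exp_le_exp.2 (mul_le_mul_of_nonneg_left h.le hβ))
    · push Not at h
      have h1 := ringCount_rest_lt hU ha (C := max 1 Y) (fun b =>
        ⟨netProcess_speed_nonneg hy hY s b, netProcess_speed_le hy hY s b⟩) h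
      have h2 := ih (sub_nonneg.2 h) (hQ.next hy hY hU ha hlo hlh) (hU.rest ha) htie (by omega)
        (fun u hu0 hu => hD _ (by linarith) (by linarith))
      refine le_trans (le_of_eq ?_) (mul_le_mul_right h2 _)
      rw [← ENNReal.ofReal_mul (Real.exp_pos _).le, ← Real.exp_add]
      congr 2
      ring

end Path

/-! ### Realizations of the network -/

namespace Network

variable {I J : ℕ} (N : Network I J)

/-- The rates of the arrival clocks and of the service clocks. -/
def clockRate (r : ℝ) : Fin J ⊕ Fin J → ℝ := Sum.elim (N.lamR r) (N.muR r)

/-- All inter-arrival times and job sizes. -/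
def clocks {Ω : Type*} (η Δ : Fin J → ℕ → Ω → ℝ) (ω : Ω) : (Fin J ⊕ Fin J) × ℕ → ℝ :=
  fun p => Sum.elim (fun j => η j p.2 ω) (fun j => Δ j p.2 ω) p.1

variable {N}

section Realization

variable {m : ℕ} {ρ : Fin m → Fin J} {α c₁ c₂ r : ℝ} {q : Fin J → ℕ} {z : Fin J → Bool}
  {Ω : Type*} [MeasurableSpace Ω] {P : Measure Ω}
  {η Δ : Fin J → ℕ → Ω → ℝ} {Q : Ω → ℝ → Fin J → ℤ} {B : Ω → ℝ → Fin J → ℝ}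

theorem IsRealization.hasLaw_clocks [IsProbabilityMeasure P]
    (hR : N.IsRealization ρ α c₁ c₂ r q z P η Δ Q B)
    (ν : Fin J ⊕ Fin J → Measure ℝ) [∀ a, IsProbabilityMeasure (ν a)]
    (hν : ∀ a, ν a = expMeasure (N.clockRate r a)) :
    HasLaw (clocks η Δ) (clockLaw ν) P := by
  have h1 := hR.indep.precomp (g := fun p : (Fin J ⊕ Fin J) × ℕ =>
    (Sum.map (fun j => (j, p.2)) (fun j => (j, p.2)) p.1 : (Fin J × ℕ) ⊕ (Fin J × ℕ))) (by
      rintro ⟨a | a, k⟩ ⟨b | b, n⟩ h <;> simp_all)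
  have h2 : ∀ p : (Fin J ⊕ Fin J) × ℕ, HasLaw (fun ω => clocks η Δ ω p) (ν p.1) P := by
    rintro ⟨a | a, k⟩
    · rw [hν]; exact hR.law_arrival a k
    · rw [hν]; exact hR.law_size a k
  have h3 : iIndepFun (fun (p : (Fin J ⊕ Fin J) × ℕ) ω => clocks η Δ ω p) P := by
    convert! h1 using 2 with p
    rcases p with ⟨a | a, k⟩ <;> rfl
  exact iIndepFun.hasLaw_infinitePi h2 h3
    (aemeasurable_pi_iff.2 fun p => (h2 p).aemeasurable)

/-- The properties of the queue length paths that hold almost surely. -/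
structure IsRegularPath (N : Network I J) {m : ℕ} (ρ : Fin m → Fin J) (lo hi : ℝ)
    (D : (Fin J → ℤ) → Prop) (s : NetState J) (U : (Fin J ⊕ Fin J) × ℕ → ℝ)
    (Q : ℝ → Fin J → ℤ) : Prop where
  path : IsQueuePath lo hi (N.rate ρ) s U Q
  good : GoodClocks U
  noTies : ∀ n, (netProcess lo hi (N.rate ρ) D).NoTies n s U
  right_const : ∀ t, 0 ≤ t → ∃ T, t < T ∧ ∀ u, t ≤ u → u < T → Q u = Q t

theorem exists_forall_gt {ι : Type*} [Finite ι] {p : ι → ℝ → Prop} {t : ℝ}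
    (h : ∀ i, ∃ T, t < T ∧ ∀ u, t ≤ u → u < T → p i u) :
    ∃ T, t < T ∧ ∀ u, t ≤ u → u < T → ∀ i, p i u := by
  choose T hT hp using h
  rcases isEmpty_or_nonempty ι with hι | hι
  · exact ⟨t + 1, by linarith, fun u _ _ i => (hι.false i).elim⟩
  · obtain ⟨i₀, hi₀⟩ := Finite.exists_min T
    exact ⟨T i₀, hT i₀, fun u h1 h2 i => hp i u h1 (h2.trans_le (hi₀ i))⟩

theorem totalRate_pos [Nonempty (Fin J)] {lo hi Y : ℝ} {y : Set (Fin J) → Fin J → ℝ}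
    {D : (Fin J → ℤ) → Prop} (hy : ∀ s j, 0 ≤ y s j ∧ y s j ≤ Y) (hY : 0 ≤ Y)
    {l : Fin J ⊕ Fin J → ℝ} (hl : ∀ a, 0 < l a) (s : NetState J) :
    0 < (netProcess lo hi y D).totalRate l s := by
  obtain ⟨j⟩ := ‹Nonempty (Fin J)›
  refine Finset.sum_pos' (fun a _ => mul_nonneg (hl a).le (netProcess_speed_nonneg hy hY s a))
    ⟨Sum.inl j, Finset.mem_univ _, ?_⟩
  have : (netProcess lo hi y D).speed s (Sum.inl j) = 1 := rfl
  rw [JumpProcess.rate, this, mul_one]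
  exact hl _

/-- The queue equation and the bounded flow alone make the paths piecewise constant. This regularity
is what allows switching times to be replaced by depletion histories in the flow. -/
theorem IsRealization.ae_isRegularPath [IsProbabilityMeasure P] [Nonempty (Fin J)]
    (hR : N.IsRealization ρ α c₁ c₂ r q z P η Δ Q B) (hl : ∀ a, 0 < N.clockRate r a)
    (hlh : c₁ * r ^ α < c₂ * r ^ α) {Y : ℝ}
    (hy : ∀ s j, 0 ≤ N.rate ρ s j ∧ N.rate ρ s j ≤ Y) (hY : 0 ≤ Y) (D : (Fin J → ℤ) → Prop) :
    ∀ᵐ ω ∂P, IsRegularPath N ρ (c₁ * r ^ α) (c₂ * r ^ α) D ⟨q, z, false⟩ (clocks η Δ ω) (Q ω) := by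
  have hprob : ∀ a, IsProbabilityMeasure (expMeasure (N.clockRate r a)) := fun a =>
    isProbabilityMeasure_expMeasure (hl a)
  have hlaw := hR.hasLaw_clocks (fun a => expMeasure (N.clockRate r a)) fun a => rfl
  have htrans : ∀ {p : ((Fin J ⊕ Fin J) × ℕ → ℝ) → Prop},
      (∀ᵐ U ∂(clockLaw fun a => expMeasure (N.clockRate r a)), p U) →
      ∀ᵐ ω ∂P, p (clocks η Δ ω) := fun h => by
    rw [← hlaw.map_eq] at h
    exact ae_of_ae_map hlaw.aemeasurable h
  have hpos := htrans (ae_clockLaw_pos _ fun a => rfl)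
  have hunb := htrans (ae_clockLaw_unbounded _ hl fun a => rfl)
  have htie : ∀ᵐ ω ∂P, ∀ n, (netProcess (c₁ * r ^ α) (c₂ * r ^ α) (N.rate ρ) D).NoTies n
      ⟨q, z, false⟩ (clocks η Δ ω) := ae_all_iff.2 fun n =>
    htrans (JumpProcess.ae_noTies _ _ hl (fun a => rfl) (netProcess_speed_nonneg hy hY)
      (totalRate_pos hy hY hl) n _)
  filter_upwards [hpos, hunb, htie, hR.flow_integrable, hR.alloc_eq, hR.queue_eq] with
    ω h1 h2 h3 h4 h5 h6
  have hflow : ∀ t j, 0 ≤ N.flow ρ α c₁ c₂ r z (Q ω) t j ∧ N.flow ρ α c₁ c₂ r z (Q ω) t j ≤ Y := by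
    intro t j
    unfold flow
    split_ifs
    · exact ⟨le_rfl, hY⟩
    · exact hy _ _
  have hx : ∀ j t, 0 ≤ t → Q ω t j = (q j : ℤ) + (renewalCount (fun k => η j k ω) t : ℤ)
      - (renewalCount (fun k => Δ j k ω)
        (∫ u in (0 : ℝ)..t, N.flow ρ α c₁ c₂ r z (Q ω) u j) : ℤ) := fun j t ht => by
    rw [h6 t ht j, h5 t ht j]
  have hright : ∀ j t, 0 ≤ t → ∃ T, t < T ∧ ∀ u, t ≤ u → u < T → Q ω u j = Q ω t j :=
    fun j t ht => queue_right_const (fun n => h1 (Sum.inl j, n)) (h2 (Sum.inl j))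
      (fun n => h1 (Sum.inr j, n)) (h2 (Sum.inr j)) (fun t => hflow t j) (fun t ht => h4 t ht j)
      (hx j) ht
  have hleft : ∀ j t, 0 < t → ∃ T, T < t ∧ ∃ v, ∀ u, 0 ≤ u → T < u → u < t → Q ω u j = v :=
    fun j t ht => queue_left_const (fun n => h1 (Sum.inl j, n)) (h2 (Sum.inl j))
      (fun n => h1 (Sum.inr j, n)) (h2 (Sum.inr j)) (fun t => hflow t j) (fun t ht => h4 t ht j)
      (hx j) ht
  have hfl : ∀ j t, 0 ≤ t → N.flow ρ α c₁ c₂ r z (Q ω) t j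
      = pathFlow (c₁ * r ^ α) (c₂ * r ^ α) (N.rate ρ) z (Q ω) t j := by
    intro j t ht
    have h7 := isDepleted_iff (lo := c₁ * r ^ α) (hi := c₂ * r ^ α) (z := z j = true)
      (x := fun s => (Q ω s j : ℝ)) (fun t ht => by
        obtain ⟨T, hT, h⟩ := hright j t ht
        exact ⟨T, hT, fun u h8 h9 => by rw [h u h8 h9]⟩) (fun t ht => by
        obtain ⟨T, hT, v, h⟩ := hleft j t ht
        exact ⟨T, hT, v, fun u h8 h9 h10 => by rw [h u h8 h9 h10]⟩) hlh ht
    unfold flow pathFlow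
    by_cases h8 : DepletedHistory (c₁ * r ^ α) (c₂ * r ^ α) (z j = true)
      (fun s => (Q ω s j : ℝ)) t
    · rw [if_pos h8, if_pos (h7.2 h8)]
    · rw [if_neg h8, if_neg (mt h7.1 h8)]
  refine ⟨⟨fun t ht j => (h4 t ht j).congr fun u hu => ?_, fun t ht j => ?_⟩, ⟨h1, h2⟩, h3,
    fun t ht => ?_⟩
  · rw [uIoc_of_le ht] at hu
    exact hfl j u hu.1.le
  · rw [hx j t ht]
    have : ∫ u in (0 : ℝ)..t, N.flow ρ α c₁ c₂ r z (Q ω) u j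
        = ∫ u in (0 : ℝ)..t, pathFlow (c₁ * r ^ α) (c₂ * r ^ α) (N.rate ρ) z (Q ω) u j :=
      intervalIntegral.integral_congr fun u hu => hfl j u (by
        rw [uIcc_of_le ht] at hu; exact hu.1)
    rw [this]
    rfl
  · obtain ⟨T, hT, h⟩ := exists_forall_gt (p := fun j u => Q ω u j = Q ω t j)
      fun j => hright j t ht
    exact ⟨T, hT, fun u h8 h9 => funext fun j => h u h8 h9 j⟩

/-- Almost surely `valueAt` equals `g (Q ω t)` for all large `n`, so Fatou's lemma applies.
Measurability is needed only of the functions of the clocks, not of `Q`. -/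
theorem IsRealization.lintegral_queue_le [IsProbabilityMeasure P] [Nonempty (Fin J)]
    (hR : N.IsRealization ρ α c₁ c₂ r q z P η Δ Q B)
    (hlo : 0 < c₁ * r ^ α) (hlh : c₁ * r ^ α < c₂ * r ^ α) {Y : ℝ}
    (hy : ∀ s j, 0 ≤ N.rate ρ s j ∧ N.rate ρ s j ≤ Y) (hY : 0 ≤ Y) (D : (Fin J → ℤ) → Prop)
    (ν : Fin J ⊕ Fin J → Measure ℝ) [∀ a, IsProbabilityMeasure (ν a)]
    (hν : ∀ a, ν a = expMeasure (N.clockRate r a)) (hl : ∀ a, 0 < N.clockRate r a)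
    (g : (Fin J → ℤ) → ℝ≥0∞) {t : ℝ} (ht : 0 ≤ t) {C : ℝ≥0∞}
    (hC : ∀ n, ∫⁻ U, (netProcess (c₁ * r ^ α) (c₂ * r ^ α) (N.rate ρ) D).valueAt
      (fun s => g fun j => s.queue j) n ⟨q, z, false⟩ t U ∂(clockLaw ν) ≤ C) :
    ∫⁻ ω, g (Q ω t) ∂P ≤ C := by
  set X := netProcess (c₁ * r ^ α) (c₂ * r ^ α) (N.rate ρ) D
  set F : ℕ → ((Fin J ⊕ Fin J) × ℕ → ℝ) → ℝ≥0∞ := fun n U => X.valueAt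
      (fun s => g fun j => s.queue j) n ⟨q, z, false⟩ t U with hF
  have hFm : ∀ n, Measurable (F n) := fun n =>
    (X.measurable_valueAt _ n _).comp (measurable_const.prodMk measurable_id)
  have hlaw := hR.hasLaw_clocks ν hν
  calc ∫⁻ ω, g (Q ω t) ∂P ≤ ∫⁻ ω, liminf (fun n => F n (clocks η Δ ω)) atTop ∂P := by
        refine lintegral_mono_ae ?_
        filter_upwards [hR.ae_isRegularPath hl hlh hy hY D] with ω hω
        refine le_liminf_of_le (by isBoundedDefault) ?_
        filter_upwards [eventually_gt_atTop (ringCount (max 1 Y) (clocks η Δ ω) t)] with n hn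
        rw [hF]
        exact (valueAt_eq hlo hlh hy hY g n ht hω.path hω.good (hω.noTies n) hn).ge
    _ ≤ liminf (fun n => ∫⁻ ω, F n (clocks η Δ ω) ∂P) atTop :=
        lintegral_liminf_le' fun n => (hFm n).comp_aemeasurable hlaw.aemeasurable
    _ ≤ C := by
        refine (liminf_le_liminf (v := fun _ => C) (Eventually.of_forall fun n => ?_)).trans
          (by simp)
        rw [← lintegral_map' (hFm n).aemeasurable hlaw.aemeasurable, hlaw.map_eq]
        exact hC n

/-- Almost surely `F n ≤ exp (β τ) ≤ liminf F`, where `τ` is the hitting time; integration and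
Fatou's lemma then pin down the limit. The exponent `β / r ^ 2` compensates for the time scale `r ^
2`. -/
theorem IsRealization.V_eq [IsProbabilityMeasure P] [Nonempty (Fin J)]
    (hR : N.IsRealization ρ α c₁ c₂ r q z P η Δ Q B) (hr : 0 < r)
    (hlo : 0 < c₁ * r ^ α) (hlh : c₁ * r ^ α < c₂ * r ^ α) {Y : ℝ}
    (hy : ∀ s j, 0 ≤ N.rate ρ s j ∧ N.rate ρ s j ≤ Y) (hY : 0 ≤ Y) (D : (Fin J → ℤ) → Prop)
    (ν : Fin J ⊕ Fin J → Measure ℝ) [∀ a, IsProbabilityMeasure (ν a)]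
    (hν : ∀ a, ν a = expMeasure (N.clockRate r a)) (hl : ∀ a, 0 < N.clockRate r a)
    (i : Fin I) (hD : ∀ (Q : ℝ → Fin J → ℤ) (t : ℝ),
      |N.workload r Q t i| ≤ 2 * N.c₃ c₂ ↔ D (Q (r ^ 2 * t))) {β v : ℝ} (hβ : 0 < β)
    (hv : Tendsto (fun n => ∫⁻ U, (netProcess (c₁ * r ^ α) (c₂ * r ^ α) (N.rate ρ) D).expHit
      (fun s => D fun j => s.queue j) (β / r ^ 2) n ⟨q, z, false⟩ U ∂(clockLaw ν)) atTop
      (𝓝 (ENNReal.ofReal v))) :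
    N.V c₂ r β P Q i = ENNReal.ofReal v := by
  set X := netProcess (c₁ * r ^ α) (c₂ * r ^ α) (N.rate ρ) D
  set F : ℕ → ((Fin J ⊕ Fin J) × ℕ → ℝ) → ℝ≥0∞ := fun n U => X.expHit
      (fun s => D fun j => s.queue j) (β / r ^ 2) n ⟨q, z, false⟩ U with hF
  have hFm : ∀ n, Measurable (F n) := fun n => X.measurable_expHit _ _ n _
  have hlaw := hR.hasLaw_clocks ν hν
  have hβ' : 0 ≤ β / r ^ 2 := by positivity
  have hr2 : 0 < r ^ 2 := by positivity
  have hFP : ∀ n, ∫⁻ ω, F n (clocks η Δ ω) ∂P = ∫⁻ U, F n U ∂(clockLaw ν) := fun n => by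
    rw [← lintegral_map' (hFm n).aemeasurable hlaw.aemeasurable, hlaw.map_eq]
  have hscale : ∀ t : ℝ, EReal.exp ((β : EReal) * t)
      = ENNReal.ofReal (Real.exp (β / r ^ 2 * (r ^ 2 * t))) := fun t => by
    rw [← EReal.coe_mul, EReal.exp_coe]
    congr 2
    field_simp
  have hupper : ∀ᵐ ω ∂P, ∀ n,
      F n (clocks η Δ ω) ≤ EReal.exp ((β : EReal) * N.hittingTime c₂ r (Q ω) i) := by
    filter_upwards [hR.ae_isRegularPath hl hlh hy hY D] with ω hω n
    by_cases htop : N.hittingTime c₂ r (Q ω) i = ⊤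
    · rw [htop, EReal.coe_mul_top_of_pos hβ]
      simp
    · obtain ⟨τ, h1, h2, -, h3⟩ := hitTime_attained (fun t ht => by
        obtain ⟨T, hT, h⟩ := hω.right_const (r ^ 2 * t) (by positivity)
        refine ⟨T / r ^ 2, by rw [lt_div_iff₀ hr2]; linarith, fun u h4 h5 h6 => ?_⟩
        rw [hD] at h6 ⊢
        rw [lt_div_iff₀ hr2] at h5
        rwa [← h (r ^ 2 * u) (mul_le_mul_of_nonneg_left h4 hr2.le) (by linarith)]) htop
      rw [hittingTime, h1, hscale]
      exact expHit_le hlo hlh hy hY hβ' n (by positivity) hω.path hω.good (hω.noTies n)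
        ((hD _ _).1 h3)
  have hlower : ∀ᵐ ω ∂P, EReal.exp ((β : EReal) * N.hittingTime c₂ r (Q ω) i)
      ≤ liminf (fun n => F n (clocks η Δ ω)) atTop := by
    filter_upwards [hR.ae_isRegularPath hl hlh hy hY D] with ω hω
    have key : ∀ t : ℝ, 0 ≤ t → (t : EReal) ≤ N.hittingTime c₂ r (Q ω) i →
        ENNReal.ofReal (Real.exp (β * t)) ≤ liminf (fun n => F n (clocks η Δ ω)) atTop := by
      intro t ht hle
      refine le_liminf_of_le (by isBoundedDefault) ?_
      filter_upwards [eventually_gt_atTop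
        (ringCount (max 1 Y) (clocks η Δ ω) (r ^ 2 * t))] with n hn
      have h1 : β * t = β / r ^ 2 * (r ^ 2 * t) := by field_simp
      rw [h1]
      refine le_expHit hlo hlh hy hY hβ' n (by positivity) hω.path hω.good (hω.noTies n) hn ?_
      intro u h2 h3 h4
      have h5 : r ^ 2 * (u / r ^ 2) = u := by field_simp
      have h6 : N.hittingTime c₂ r (Q ω) i ≤ ((u / r ^ 2 : ℝ) : EReal) :=
        hitTime_le (by positivity) (by exact_mod_cast div_nonneg h2 hr2.le)
          ((hD _ _).2 (by rwa [h5]))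
      have h7 := EReal.coe_le_coe_iff.1 (hle.trans h6)
      rw [le_div_iff₀ hr2] at h7
      linarith
    have h0 : (0 : EReal) ≤ N.hittingTime c₂ r (Q ω) i := le_hitTime _ _
    generalize N.hittingTime c₂ r (Q ω) i = h at key h0
    induction h with
    | bot => simp at h0
    | coe t =>
      rw [← EReal.coe_mul, EReal.exp_coe]
      exact key t (by exact_mod_cast h0) le_rfl
    | top =>
      rw [EReal.coe_mul_top_of_pos hβ, EReal.exp_top, top_le_iff]
      refine ENNReal.eq_top_of_forall_nnreal_le fun x => ?_
      refine le_trans ?_ (key (x / β) (by positivity) le_top)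
      rw [mul_div_cancel₀ _ hβ.ne', ← ENNReal.ofReal_coe_nnreal]
      exact ENNReal.ofReal_le_ofReal (by linarith [Real.add_one_le_exp (x : ℝ)])
  refine le_antisymm ?_ ?_
  · calc N.V c₂ r β P Q i ≤ ∫⁻ ω, liminf (fun n => F n (clocks η Δ ω)) atTop ∂P :=
          lintegral_mono_ae hlower
      _ ≤ liminf (fun n => ∫⁻ ω, F n (clocks η Δ ω) ∂P) atTop :=
          lintegral_liminf_le' fun n => (hFm n).comp_aemeasurable hlaw.aemeasurable
      _ = ENNReal.ofReal v := by
          simp_rw [hFP]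
          exact hv.liminf_eq
  · refine le_of_tendsto' hv fun n => ?_
    have h1 : ∫⁻ U, F n U ∂(clockLaw ν) ≤ N.V c₂ r β P Q i := by
      rw [← hFP]
      refine lintegral_mono_ae ?_
      filter_upwards [hupper] with ω hω
      exact hω n
    exact h1

end Realization

end Network

/-! ### The allocation rates -/

/-- The terms below `k` add up to `4 - 4 * 2 ^ k`, so term `k` leaves a surplus of `4`, of which the
terms above `k` use less than `1 / 2 ^ k ≤ 1`. -/
theorem sum_range_two_pow_le (n k : ℕ) (hk : k < n) :
    (3 : ℝ) ≤ ∑ l ∈ Finset.range n, (if l < k then -(4 * 2 ^ l) else if l = k then 4 * 2 ^ k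
      else -(1 / 2 ^ l) : ℝ) := by
  have h1 : ∀ n, n ≤ k → ∑ l ∈ Finset.range n, (if l < k then -(4 * 2 ^ l) else if l = k then
      4 * 2 ^ k else -(1 / 2 ^ l) : ℝ) = 4 - 4 * 2 ^ n := by
    intro n
    induction n with
    | zero => intro _; simp
    | succ n ih =>
      intro hn
      rw [Finset.sum_range_succ, ih (by omega), if_pos (by omega)]
      ring
  have h2 : ∀ t, (3 : ℝ) + 1 / 2 ^ (k + t) ≤ ∑ l ∈ Finset.range (k + 1 + t), (if l < k then
      -(4 * 2 ^ l) else if l = k then 4 * 2 ^ k else -(1 / 2 ^ l) : ℝ) := by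
    intro t
    induction t with
    | zero =>
      rw [add_zero, Finset.sum_range_succ, h1 k le_rfl, if_neg (lt_irrefl k), if_pos rfl]
      have : (1 : ℝ) / 2 ^ k ≤ 1 := by
        rw [div_le_one (by positivity)]; exact one_le_pow₀ (by norm_num)
      linarith
    | succ t ih =>
      rw [show k + 1 + (t + 1) = (k + 1 + t) + 1 by ring, Finset.sum_range_succ,
        if_neg (by omega), if_neg (by omega), show k + (t + 1) = k + 1 + t by ring]
      have h3 : (1 : ℝ) / 2 ^ (k + t) = 2 * (1 / 2 ^ (k + 1 + t)) := by
        rw [show k + 1 + t = k + t + 1 by ring, pow_succ]; field_simp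
      linarith
  obtain ⟨t, rfl⟩ : ∃ t, n = k + 1 + t := ⟨n - (k + 1), by omega⟩
  have := h2 t
  have h5 : (0 : ℝ) < 1 / 2 ^ (k + t) := by positivity
  linarith

namespace Network

variable {I J m : ℕ} {N : Network I J}

theorem mem_S1_iff (j : Fin J) : j ∈ N.S1 ↔ ∃ i, N.res j = {i} := by
  have h : ∑ i, N.K i j = ((N.res j).card : ℝ) := by
    simp [K, Matrix.of_apply]
  unfold S1
  rw [mem_ofPred_eq, h, ← Finset.card_eq_one]
  norm_cast

theorem delta_pos [Nonempty (Fin J)] (hheavy : N.HeavyTraffic) : 0 < N.delta := by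
  obtain ⟨j₀, hj₀⟩ := Finite.exists_min N.load
  have h1 : 0 < N.load j₀ := div_pos (hheavy.lam_pos _) (hheavy.mu_pos _)
  have h2 : 0 < J := Fin.pos_iff_nonempty.2 ‹_›
  exact div_pos (h1.trans_le (le_ciInf hj₀)) (by positivity)

theorem mul_delta_le [Nonempty (Fin J)] (j : Fin J) : 2 * J * N.delta ≤ N.load j := by
  have h2 : 0 < J := Fin.pos_iff_nonempty.2 ‹_›
  unfold delta
  rw [mul_div_cancel₀ _ (by positivity)]
  exact ciInf_le (Finite.bddBelow_range _) j

section Ranking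

variable {ρ : Fin m → Fin J} (hρ : BijOn ρ univ N.Sm)
include hρ

theorem ranked_or_primary {l : Fin J} (hl : l ∉ N.S1) : l ∈ N.Sp ∨ ∃ k, ρ k = l := by
  by_cases h : l ∈ N.Sp
  · exact Or.inl h
  · obtain ⟨k, -, hk⟩ := hρ.surjOn (show l ∈ N.Sm from ⟨h, hl⟩)
    exact Or.inr ⟨k, hk⟩

theorem ranked_notMem_Sp (k : Fin m) : ρ k ∉ N.Sp := (hρ.mapsTo (mem_univ k)).1

theorem ranked_inj {k k' : Fin m} (h : ρ k = ρ k') : k = k' :=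
  hρ.injOn (mem_univ _) (mem_univ _) h

open Classical in
theorem rateMulti_ranked (s : Set (Fin J)) (k : Fin m) : N.rateMulti ρ s (ρ k) =
    if ∀ i ∈ N.res (ρ k), (N.zeta ρ i k ∩ s).Nonempty then
      N.load (ρ k) - 2 ^ (k : ℕ) / 2 ^ (m + 1) * N.delta
    else if ρ k ∈ s then N.load (ρ k) + 2 ^ (k : ℕ) / 2 ^ (m + 1) * N.delta
    else N.load (ρ k) - 1 / (2 ^ (k : ℕ) * 2 ^ (m + 3)) * N.delta := by
  have hk : ∃ k', ρ k' = ρ k := ⟨k, rfl⟩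
  have hc : hk.choose = k := ranked_inj hρ hk.choose_spec
  have e1 : (2 : ℝ) ^ (((k : ℕ) : ℤ) + 1 - m - 2) = 2 ^ (k : ℕ) / 2 ^ (m + 1) := by
    rw [show ((k : ℕ) : ℤ) + 1 - m - 2 = ((k : ℕ) : ℤ) - ((m + 1 : ℕ) : ℤ) by push_cast; ring,
      zpow_sub₀ (by norm_num), zpow_natCast, zpow_natCast]
  have e2 : (2 : ℝ) ^ (-(((k : ℕ) : ℤ) + 1) - m - 2) = 1 / (2 ^ (k : ℕ) * 2 ^ (m + 3)) := by
    rw [show -(((k : ℕ) : ℤ) + 1) - m - 2 = -(((k : ℕ) + (m + 3) : ℕ) : ℤ) by push_cast; ring,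
      zpow_neg, zpow_natCast, pow_add, one_div]
  unfold rateMulti
  rw [if_neg (ranked_notMem_Sp hρ k), dif_pos hk, hc, e1, e2]

omit hρ in
theorem rateMulti_primary (s : Set (Fin J)) {l : Fin J} (hl : l ∈ N.Sp) [Decidable (l ∈ s)] :
    N.rateMulti ρ s l =
      if l ∈ s then N.load l + N.delta else N.load l - N.delta / (J * 2 ^ (m + 3)) := by
  classical
  unfold rateMulti
  rw [if_pos hl]
  congr

theorem rateMulti_mem [Nonempty (Fin J)] (hδ : 0 < N.delta) (s : Set (Fin J)) {l : Fin J}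
    (hl : l ∉ N.S1) : N.load l - N.delta ≤ N.rateMulti ρ s l ∧
      N.rateMulti ρ s l ≤ N.load l + N.delta ∧ (l ∉ s → N.rateMulti ρ s l < N.load l) := by
  classical
  have hJ : 0 < J := Fin.pos_iff_nonempty.2 ‹_›
  rcases ranked_or_primary hρ hl with h | ⟨k, rfl⟩
  · rw [rateMulti_primary s h]
    have h1 : 0 < N.delta / (J * 2 ^ (m + 3)) := by positivity
    have h2 : N.delta / (J * 2 ^ (m + 3)) ≤ N.delta := by
      refine div_le_self hδ.le ?_
      have h3 : (1 : ℝ) ≤ J := by exact_mod_cast hJ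
      have h4 : (1 : ℝ) ≤ 2 ^ (m + 3) := one_le_pow₀ (by norm_num)
      nlinarith
    split_ifs with hs
    · exact ⟨by linarith, le_rfl, fun h => absurd hs h⟩
    · exact ⟨by linarith, by linarith, fun _ => by linarith⟩
  · rw [rateMulti_ranked hρ]
    have h1 : 0 < (2 : ℝ) ^ (k : ℕ) / 2 ^ (m + 1) * N.delta := by positivity
    have h2 : (2 : ℝ) ^ (k : ℕ) / 2 ^ (m + 1) * N.delta ≤ N.delta := by
      refine mul_le_of_le_one_left hδ.le ?_
      rw [div_le_one (by positivity)]
      exact pow_le_pow_right₀ (by norm_num) (by omega)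
    have h3 : 0 < 1 / ((2 : ℝ) ^ (k : ℕ) * 2 ^ (m + 3)) * N.delta := by positivity
    have h4 : 1 / ((2 : ℝ) ^ (k : ℕ) * 2 ^ (m + 3)) * N.delta ≤ N.delta := by
      refine mul_le_of_le_one_left hδ.le ?_
      rw [div_le_one (by positivity)]
      exact one_le_mul_of_one_le_of_one_le (one_le_pow₀ (by norm_num)) (one_le_pow₀ (by norm_num))
    split_ifs with h5 hs
    · exact ⟨by linarith, by linarith, fun _ => by linarith⟩
    · exact ⟨by linarith, by linarith, fun h => absurd hs h⟩
    · exact ⟨by linarith, by linarith, fun _ => by linarith⟩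

/-- At a resource with stocked work, whose local type `j` is not stocked, the other types take more
than their loads. A stocked primary type gains `δ`, which beats all possible losses. Without one,
the stocked type `ρ k₀` with the largest index gains more than the ranked types before it can lose,
and those after it lose only inverse powers of two. -/
theorem sum_rateMulti_sub_load_pos [Nonempty (Fin J)] (hδ : 0 < N.delta) (s : Set (Fin J))
    {i : Fin I} {j : Fin J} (hj : j ∉ s) {T : Finset (Fin J)}
    (hT : ∀ l, l ∈ T ↔ l ≠ j ∧ i ∈ N.res l) (hT1 : ∀ l ∈ T, l ∉ N.S1) (hex : ∃ l ∈ T, l ∈ s) :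
    0 < ∑ l ∈ T, (N.rateMulti ρ s l - N.load l) := by
  classical
  have hJ : 0 < J := Fin.pos_iff_nonempty.2 ‹_›
  set e := N.delta / (J * 2 ^ (m + 3)) with he
  have he0 : 0 < e := by positivity
  have hTe : ∑ l ∈ T, e ≤ N.delta / 2 ^ (m + 3) := by
    rw [Finset.sum_const, nsmul_eq_mul]
    have h1 : (T.card : ℝ) ≤ J := by
      exact_mod_cast (Finset.card_le_univ T).trans (by simp)
    calc (T.card : ℝ) * e ≤ J * e := mul_le_mul_of_nonneg_right h1 he0.le
      _ = N.delta / 2 ^ (m + 3) := by rw [he]; field_simp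
  have hpow : (2 : ℝ) ^ (m + 3) = 4 * 2 ^ (m + 1) := by ring
  have hP : (0 : ℝ) < 2 ^ (m + 1) := by positivity
  by_cases hprim : ∃ p ∈ T, p ∈ N.Sp ∧ p ∈ s
  · obtain ⟨p, hpT, hp, hps⟩ := hprim
    -- Worst losses of the ranked types; they add up to at most `δ / 2`, and those of the primary
    -- types to at most `δ / 4`.
    set w : Fin m → ℝ := fun k => 2 ^ (k : ℕ) / 2 ^ (m + 1) * N.delta with hw
    have hw0 : ∀ k, 0 ≤ w k := fun k => by simp only [hw]; positivity
    have hlow : ∀ l ∈ T, (if l = p then N.delta else 0) - e - ∑ k, (if ρ k = l then w k else 0)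
        ≤ N.rateMulti ρ s l - N.load l := by
      intro l hl
      have hs0 : 0 ≤ ∑ k, (if ρ k = l then w k else 0) :=
        Finset.sum_nonneg fun k _ => by split_ifs; exacts [hw0 k, le_rfl]
      rcases ranked_or_primary hρ (hT1 l hl) with h | ⟨k, rfl⟩
      · rw [rateMulti_primary s h]
        by_cases hlp : l = p
        · subst hlp
          rw [if_pos rfl, if_pos hps]
          linarith
        · rw [if_neg hlp]
          split_ifs <;> linarith
      · have h1 : ∑ k', (if ρ k' = ρ k then w k' else 0) = w k := by
          rw [Finset.sum_eq_single k (fun b _ hb => if_neg fun h => hb (ranked_inj hρ h))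
            (fun h => absurd (Finset.mem_univ k) h), if_pos rfl]
        have h2 : ρ k ≠ p := fun h => ranked_notMem_Sp hρ k (h ▸ hp)
        rw [h1, if_neg h2, rateMulti_ranked hρ]
        have h3 : 0 ≤ 1 / ((2 : ℝ) ^ (k : ℕ) * 2 ^ (m + 3)) * N.delta := by positivity
        have h4 : 1 / ((2 : ℝ) ^ (k : ℕ) * 2 ^ (m + 3)) * N.delta ≤ w k := by
          refine mul_le_mul_of_nonneg_right ?_ hδ.le
          have h6 : (1 : ℝ) ≤ 2 ^ (k : ℕ) := one_le_pow₀ (by norm_num)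
          rw [div_le_div_iff₀ (by positivity) hP, hpow]
          nlinarith [mul_le_mul h6 h6 zero_le_one (by positivity)]
        have h5 := hw0 k
        split_ifs
        · simp only [hw]; linarith
        · simp only [hw] at h5 ⊢; linarith
        · linarith
    refine lt_of_lt_of_le ?_ (Finset.sum_le_sum hlow)
    rw [Finset.sum_sub_distrib, Finset.sum_sub_distrib, Finset.sum_ite_eq' T p, if_pos hpT,
      Finset.sum_comm]
    have h1 : ∑ k, ∑ l ∈ T, (if ρ k = l then w k else 0) ≤ ∑ k, w k := by
      refine Finset.sum_le_sum fun k _ => ?_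
      rw [Finset.sum_ite_eq]
      split_ifs
      exacts [le_rfl, hw0 k]
    have h2 : ∑ k, w k ≤ N.delta / 2 := by
      simp only [hw]
      rw [← Finset.sum_mul, ← Finset.sum_div,
        Fin.sum_univ_eq_sum_range (fun k => (2 : ℝ) ^ k) m, geom_sum_eq (by norm_num)]
      have : ((2 : ℝ) ^ m - 1) / (2 - 1) / 2 ^ (m + 1) ≤ 1 / 2 := by
        rw [div_le_div_iff₀ hP (by norm_num), pow_succ]; linarith
      nlinarith
    have h3 : N.delta / 2 ^ (m + 3) ≤ N.delta / 4 := by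
      refine div_le_div_of_nonneg_left hδ.le (by norm_num) ?_
      rw [hpow]
      have : (1 : ℝ) ≤ 2 ^ (m + 1) := one_le_pow₀ (by norm_num)
      linarith
    linarith
  · have hnp : ∀ p ∈ T, p ∈ N.Sp → p ∉ s := fun p h1 h2 h3 => hprim ⟨p, h1, h2, h3⟩
    set R : Finset (Fin m) := Finset.univ.filter fun k => ρ k ∈ T ∧ ρ k ∈ s with hR
    have hRne : R.Nonempty := by
      obtain ⟨l, hl, hls⟩ := hex
      rcases ranked_or_primary hρ (hT1 l hl) with h | ⟨k, rfl⟩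
      · exact absurd hls (hnp l hl h)
      · exact ⟨k, by simp [hR, hl, hls]⟩
    set k₀ := R.max' hRne with hk₀
    have hk₀R : k₀ ∈ R := R.max'_mem hRne
    have hk₀' : ρ k₀ ∈ T ∧ ρ k₀ ∈ s := by simpa [hR] using hk₀R
    have hmax : ∀ k, ρ k ∈ T → ρ k ∈ s → k ≤ k₀ := fun k h1 h2 =>
      R.le_max' k (by simp [hR, h1, h2])
    -- From `k₀` on the first clause of the policy fails at `i` itself, since everything stocked at
    -- `i` has index at most `k₀`.
    have hzeta : ∀ k, k₀ ≤ k → ¬ (N.zeta ρ i k ∩ s).Nonempty := by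
      rintro k hk ⟨l, ⟨hl1, hl2⟩, hls⟩
      have hlT : l ∈ T := (hT l).2 ⟨fun h => hj (h ▸ hls), hl2⟩
      rcases ranked_or_primary hρ (hT1 l hlT) with h | ⟨k', rfl⟩
      · exact hnp l hlT h hls
      · exact hl1 ⟨k', (hmax k' hlT hls).trans hk, rfl⟩
    -- Lower bounds for the deviations of the ranked types in units of `δ / 2 ^ (m + 3)`. They sum
    -- to at least `3`, while all primary types together lose at most `1`.
    set a : ℕ → ℝ := fun l => if l < k₀ then -(4 * 2 ^ l) else if l = k₀ then 4 * 2 ^ (k₀ : ℕ)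
      else -(1 / 2 ^ l) with ha
    set w : Fin m → ℝ := fun k => a k * (N.delta / 2 ^ (m + 3)) with hw
    have hu : 0 < N.delta / 2 ^ (m + 3) := by positivity
    have hlow : ∀ l ∈ T, ∑ k, (if ρ k = l then w k else 0) - e
        ≤ N.rateMulti ρ s l - N.load l := by
      intro l hl
      rcases ranked_or_primary hρ (hT1 l hl) with h | ⟨k, rfl⟩
      · have h1 : ∑ k, (if ρ k = l then w k else 0) = 0 :=
          Finset.sum_eq_zero fun k _ => if_neg fun (h' : ρ k = l) =>
            ranked_notMem_Sp hρ k (by rw [h']; exact h)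
        rw [rateMulti_primary s h, if_neg (hnp l hl h), h1]
        linarith
      · have h1 : ∑ k', (if ρ k' = ρ k then w k' else 0) = w k := by
          rw [Finset.sum_eq_single k (fun b _ hb => if_neg fun h => hb (ranked_inj hρ h))
            (fun h => absurd (Finset.mem_univ k) h), if_pos rfl]
        rw [h1]
        have e1 : (2 : ℝ) ^ (k : ℕ) / 2 ^ (m + 1) * N.delta
            = 4 * 2 ^ (k : ℕ) * (N.delta / 2 ^ (m + 3)) := by rw [hpow]; field_simp
        have e2 : 1 / ((2 : ℝ) ^ (k : ℕ) * 2 ^ (m + 3)) * N.delta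
            = 1 / 2 ^ (k : ℕ) * (N.delta / 2 ^ (m + 3)) := by field_simp
        have p1 : 0 < 4 * 2 ^ (k : ℕ) * (N.delta / 2 ^ (m + 3)) := by positivity
        have p2 : 1 / 2 ^ (k : ℕ) * (N.delta / 2 ^ (m + 3))
            ≤ 4 * 2 ^ (k : ℕ) * (N.delta / 2 ^ (m + 3)) := by
          refine mul_le_mul_of_nonneg_right ?_ hu.le
          have h6 : (1 : ℝ) ≤ 2 ^ (k : ℕ) := one_le_pow₀ (by norm_num)
          rw [div_le_iff₀ (by positivity)]
          nlinarith
        rw [rateMulti_ranked hρ, e1, e2]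
        simp only [hw, ha]
        have hi : i ∈ N.res (ρ k) := ((hT _).1 hl).2
        rcases lt_trichotomy (k : ℕ) k₀ with h2 | h2 | h2
        · rw [if_pos h2]
          split_ifs <;> linarith
        · obtain rfl : k = k₀ := Fin.ext h2
          rw [if_neg (lt_irrefl _), if_pos rfl, if_neg fun h => hzeta _ le_rfl (h i hi),
            if_pos hk₀'.2]
          linarith
        · have h3 : k₀ ≤ k := Fin.le_def.2 h2.le
          have h4 : ρ k ∉ s := fun h => absurd (hmax k hl h) (not_le.2 (Fin.lt_def.2 h2))
          rw [if_neg (by omega), if_neg (by omega), if_neg fun h => hzeta _ h3 (h i hi), if_neg h4]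
          linarith
    refine lt_of_lt_of_le ?_ (Finset.sum_le_sum hlow)
    rw [Finset.sum_sub_distrib, Finset.sum_comm]
    have h1 : ∑ k, w k ≤ ∑ k, ∑ l ∈ T, (if ρ k = l then w k else 0) := by
      refine Finset.sum_le_sum fun k _ => ?_
      rw [Finset.sum_ite_eq]
      split_ifs with h
      · exact le_rfl
      · have h2 : (k : ℕ) ≠ k₀ := fun h' => h (by rw [Fin.ext h']; exact hk₀'.1)
        refine mul_nonpos_of_nonpos_of_nonneg ?_ hu.le
        simp only [ha, if_neg h2]
        split_ifs
        · have : (0 : ℝ) < 4 * 2 ^ (k : ℕ) := by positivity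
          linarith
        · have : (0 : ℝ) < 1 / 2 ^ (k : ℕ) := by positivity
          linarith
    have h2 : 3 * (N.delta / 2 ^ (m + 3)) ≤ ∑ k, w k := by
      simp only [hw]
      rw [← Finset.sum_mul, Fin.sum_univ_eq_sum_range a m]
      exact mul_le_mul_of_nonneg_right (sum_range_two_pow_le m k₀ k₀.2) hu.le
    linarith

end Ranking

/-- The set `T` holds the competitors of the local type at `i`. Distinct resource sets keep other
local types out of it, and criticality turns the leftover capacity into the load minus the excess of
the competitors. -/
theorem rate_of_res_eq (hN : N.Basic) (hheavy : N.HeavyTraffic) {ρ : Fin m → Fin J}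
    (s : Set (Fin J)) {i : Fin I} {j : Fin J} (hj : N.res j = {i}) :
    ∃ T : Finset (Fin J), (∀ l, l ∈ T ↔ l ≠ j ∧ i ∈ N.res l) ∧ (∀ l ∈ T, l ∉ N.S1) ∧
      (∀ f : Fin J → ℝ, ∑ l, N.K i l * f l = f j + ∑ l ∈ T, f l) ∧
      ((∃ l ∈ s, i ∈ N.res l) →
        N.rate ρ s j = N.load j - ∑ l ∈ T, (N.rateMulti ρ s l - N.load l)) ∧
      ((¬ ∃ l ∈ s, i ∈ N.res l) → N.rate ρ s j = N.load j - N.delta) := by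
  classical
  set T : Finset (Fin J) := Finset.univ.filter fun l => l ≠ j ∧ i ∈ N.res l with hT
  have hTm : ∀ l, l ∈ T ↔ l ≠ j ∧ i ∈ N.res l := fun l => by simp [hT]
  have hsum : ∀ f : Fin J → ℝ, ∑ l, N.K i l * f l = f j + ∑ l ∈ T, f l := by
    intro f
    have hij : i ∈ N.res j := by rw [hj]; simp
    rw [← Finset.add_sum_erase _ _ (Finset.mem_univ j)]
    congr 1
    · simp [K, hij]
    · rw [Finset.sum_filter, ← Finset.add_sum_erase Finset.univ _ (Finset.mem_univ j)]
      simp only [ne_eq, not_true_eq_false, false_and, if_false, zero_add]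
      refine Finset.sum_congr rfl fun l hl => ?_
      have := Finset.ne_of_mem_erase hl
      by_cases h : i ∈ N.res l <;> simp [K, h, this]
  have hi : ∃ i, N.res j = {i} := ⟨i, hj⟩
  have hc : hi.choose = i := Finset.singleton_injective (hi.choose_spec.symm.trans hj)
  refine ⟨T, hTm, fun l hl hl1 => ?_, hsum, fun h => ?_, fun h => ?_⟩
  · obtain ⟨i', hi'⟩ := (mem_S1_iff l).1 hl1
    have h1 := ((hTm l).1 hl).2
    rw [hi', Finset.mem_singleton] at h1
    exact ((hTm l).1 hl).1 (hN.distinct l j (by rw [hi', hj, h1]))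
  · unfold rate
    rw [dif_pos hi, hc, if_pos h]
    have hC : N.C i = N.load j + ∑ l ∈ T, N.load l := by
      rw [hheavy.critical, ← hsum]
      rfl
    have hT' : (Finset.univ.filter fun l => l ≠ j ∧ i ∈ N.res l) = T := rfl
    rw [hC, Finset.sum_sub_distrib]
    have : ∑ l with l ≠ j ∧ i ∈ N.res l, N.rateMulti ρ s l = ∑ l ∈ T, N.rateMulti ρ s l := by
      refine Finset.sum_congr ?_ fun _ _ => rfl
      ext l; simp [hTm]
    rw [this]
    ring
  · unfold rate
    rw [dif_pos hi, hc, if_neg h]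

theorem rate_of_notMem_S1 {ρ : Fin m → Fin J} (s : Set (Fin J)) {j : Fin J} (hj : j ∉ N.S1) :
    N.rate ρ s j = N.rateMulti ρ s j := by
  unfold rate
  rw [dif_neg fun h => hj ((mem_S1_iff j).2 h)]

/-- Competitors exceed their loads by at most `δ` each, in total by at most `J * δ`, which is at
most half the load by the choice of `δ`. -/
theorem rate_nonneg [Nonempty (Fin J)] (hN : N.Basic) (hheavy : N.HeavyTraffic)
    {ρ : Fin m → Fin J} (hρ : BijOn ρ univ N.Sm) (s : Set (Fin J)) (j : Fin J) :
    0 ≤ N.rate ρ s j := by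
  have hδ := delta_pos hheavy
  have hJ : 0 < J := Fin.pos_iff_nonempty.2 ‹_›
  have hJ1 : (1 : ℝ) ≤ J := by exact_mod_cast hJ
  have hload := mul_delta_le (N := N) j
  by_cases hj : j ∈ N.S1
  · obtain ⟨i, hi⟩ := (mem_S1_iff j).1 hj
    obtain ⟨T, hT, hT1, -, h1, h2⟩ := rate_of_res_eq (ρ := ρ) hN hheavy s hi
    by_cases h : ∃ l ∈ s, i ∈ N.res l
    · rw [h1 h]
      have h3 : ∑ l ∈ T, (N.rateMulti ρ s l - N.load l) ≤ T.card • N.delta :=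
        Finset.sum_le_card_nsmul _ _ _ fun l hl => by
          linarith [(rateMulti_mem hρ hδ s (hT1 l hl)).2.1]
      have h4 : (T.card : ℝ) ≤ J := by
        exact_mod_cast (Finset.card_le_univ T).trans (by simp)
      rw [nsmul_eq_mul] at h3
      nlinarith
    · rw [h2 h]
      nlinarith
  · rw [rate_of_notMem_S1 s hj]
    have := (rateMulti_mem hρ hδ s hj).1
    nlinarith

/-- The source of the upward push on low queues. For local types it is `sum_rateMulti_sub_load_pos`;
for the others it is built into the policy. -/
theorem rate_lt_load [Nonempty (Fin J)] (hN : N.Basic) (hheavy : N.HeavyTraffic)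
    {ρ : Fin m → Fin J} (hρ : BijOn ρ univ N.Sm) (s : Set (Fin J)) {j : Fin J} (hjs : j ∉ s) :
    N.rate ρ s j < N.load j := by
  have hδ := delta_pos hheavy
  by_cases hj : j ∈ N.S1
  · obtain ⟨i, hi⟩ := (mem_S1_iff j).1 hj
    obtain ⟨T, hT, hT1, -, h1, h2⟩ := rate_of_res_eq (ρ := ρ) hN hheavy s hi
    by_cases h : ∃ l ∈ s, i ∈ N.res l
    · rw [h1 h]
      obtain ⟨l, hls, hil⟩ := h
      have := sum_rateMulti_sub_load_pos hρ hδ s hjs hT hT1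
        ⟨l, (hT l).2 ⟨fun h => hjs (h ▸ hls), hil⟩, hls⟩
      linarith
    · rw [h2 h]
      linarith
  · rw [rate_of_notMem_S1 s hj]
    exact (rateMulti_mem hρ hδ s hj).2.2 hjs

/-- No nominal idling: by local traffic the resource has a local type, and this type takes up the
slack. -/
theorem sum_K_mul_rate (hN : N.Basic) (hloc : N.LocalTraffic) (hheavy : N.HeavyTraffic)
    {ρ : Fin m → Fin J} (s : Set (Fin J)) (i : Fin I) (h : ∃ l ∈ s, i ∈ N.res l) :
    ∑ j, N.K i j * N.rate ρ s j = N.C i := by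
  have hi : i ∈ ⋃ j ∈ N.S1, (N.res j : Set (Fin I)) := by rw [hloc]; trivial
  simp only [mem_iUnion, Finset.mem_coe] at hi
  obtain ⟨j, hj, hij⟩ := hi
  obtain ⟨i', hi'⟩ := (mem_S1_iff j).1 hj
  obtain rfl : i = i' := by rw [hi'] at hij; simpa using hij
  obtain ⟨T, hT, hT1, hsum, h1, -⟩ := rate_of_res_eq (ρ := ρ) hN hheavy s hi'
  have hC : N.C i = N.load j + ∑ l ∈ T, N.load l := by
    rw [hheavy.critical, ← hsum]
    rfl
  rw [hsum, h1 h, hC, Finset.sum_congr rfl fun l hl => rate_of_notMem_S1 s (hT1 l hl),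
    Finset.sum_sub_distrib]
  ring

theorem exists_rate_bounds [Nonempty (Fin J)] (hN : N.Basic) (hheavy : N.HeavyTraffic)
    {ρ : Fin m → Fin J} (hρ : BijOn ρ univ N.Sm) :
    ∃ ε Y : ℝ, 0 < ε ∧ 0 < Y ∧ (∀ s j, 0 ≤ N.rate ρ s j ∧ N.rate ρ s j ≤ Y) ∧
      ∀ s j, j ∉ s → N.rate ρ s j ≤ N.load j - ε := by
  classical
  obtain ⟨⟨s₁, j₁⟩, h1⟩ := Finite.exists_max fun p : Set (Fin J) × Fin J => N.rate ρ p.1 p.2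
  -- Finitely many pairs give a uniform margin; the value `1` for stocked types is a harmless
  -- positive default.
  obtain ⟨⟨s₂, j₂⟩, h2⟩ := Finite.exists_min fun p : Set (Fin J) × Fin J =>
    if p.2 ∈ p.1 then 1 else N.load p.2 - N.rate ρ p.1 p.2
  refine ⟨if j₂ ∈ s₂ then 1 else N.load j₂ - N.rate ρ s₂ j₂, N.rate ρ s₁ j₁ + 1, ?_, by linarith [rate_nonneg hN hheavy hρ s₁ j₁],
    fun s j => ⟨rate_nonneg hN hheavy hρ s j, by linarith [h1 (s, j)]⟩, fun s j hj => ?_⟩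
  · split_ifs with h
    · exact one_pos
    · linarith [rate_lt_load hN hheavy hρ s₂ h]
  · have := h2 (s, j)
    simp only [if_neg hj] at this
    linarith

end Network

/-! ### Exponential Lyapunov functions -/

theorem exp_le_one_add_add_sq {x : ℝ} (hx : |x| ≤ 1) : Real.exp x ≤ 1 + x + x ^ 2 := by
  have := (abs_le.1 (Real.abs_exp_sub_one_sub_id_le hx)).2
  linarith

theorem exp_le_one_add_two_mul_abs {x : ℝ} (hx : |x| ≤ 1) : Real.exp x ≤ 1 + 2 * |x| := by
  have h1 := exp_le_one_add_add_sq hx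
  have h2 : x ^ 2 ≤ |x| := by
    rw [← sq_abs]; nlinarith [abs_nonneg x]
  linarith [le_abs_self x]

theorem exp_add_le {x y : ℝ} (hy : |y| ≤ 1) :
    Real.exp (x + y) ≤ Real.exp x + Real.exp x * y + Real.exp x * y ^ 2 := by
  rw [Real.exp_add]
  have := mul_le_mul_of_nonneg_left (exp_le_one_add_add_sq hy) (Real.exp_pos x).le
  linarith

theorem exp_posPart_add_le {x y : ℝ} (hy : |y| ≤ 1) :
    Real.exp (max (x + y) 0) ≤ (1 + 2 * |y|) * Real.exp (max x 0) := by
  have h1 : max (x + y) 0 ≤ max x 0 + |y| :=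
    max_le (add_le_add (le_max_left _ _) (le_abs_self y))
      (add_nonneg (le_max_right _ _) (abs_nonneg y))
  calc Real.exp (max (x + y) 0) ≤ Real.exp (max x 0 + |y|) := Real.exp_le_exp.2 h1
    _ = Real.exp |y| * Real.exp (max x 0) := by rw [Real.exp_add, mul_comm]
    _ ≤ _ := by
      have := exp_le_one_add_two_mul_abs (x := |y|) (by rwa [abs_abs])
      rw [abs_abs] at this
      exact mul_le_mul_of_nonneg_right this (Real.exp_pos _).le

/-- The function `exp x⁺ - x⁺` has the continuous derivative `exp x⁺ - 1`, which vanishes for `x ≤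
0`. Hence a second order estimate holds across the kink, and no first order information is needed on
the left of it. -/
theorem exp_sub_posPart_add_le {x y : ℝ} (hy : |y| ≤ 1) :
    Real.exp (max (x + y) 0) - max (x + y) 0 ≤ Real.exp (max x 0) - max x 0
      + (Real.exp (max x 0) - 1) * y + Real.exp (max x 0) * y ^ 2 := by
  rcases le_total 0 x with hx | hx
  · rw [max_eq_left hx]
    have h1 := exp_add_le (x := x) hy
    rcases le_total 0 (x + y) with h | h
    · rw [max_eq_left h]; linarith
    · rw [max_eq_right h, Real.exp_zero]
      linarith [Real.add_one_le_exp (x + y)]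
  · rw [max_eq_right hx, Real.exp_zero]
    rcases le_total 0 (x + y) with h | h
    · rw [max_eq_left h]
      have h2 : |x + y| ≤ 1 := by
        rw [abs_of_nonneg h]; linarith [le_abs_self y]
      have h1 := exp_le_one_add_add_sq h2
      have h3 : (x + y) ^ 2 ≤ y ^ 2 := pow_le_pow_left₀ h (by linarith) 2
      linarith
    · rw [max_eq_right h, Real.exp_zero]
      nlinarith [sq_nonneg y]

namespace JumpProcess

variable {A S : Type*} [Fintype A] {X : JumpProcess A S} {l : A → ℝ}

/-- The workload `w` has jumps of size at most `h`, and a drift between `-κ₂` and `-κ + B`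
whenever it exceeds `c`; the potential `Ψ` makes up for the error `B`. -/
structure HasDrift (X : JumpProcess A S) (l : A → ℝ) (w Ψ B : S → ℝ)
    (c h η κ κ₂ e₁ e₂ : ℝ) : Prop where
  rate_nonneg : ∀ s a, 0 ≤ X.rate l s a
  w_nonneg : ∀ s, 0 ≤ w s
  potential_nonneg : ∀ s, 0 ≤ Ψ s
  potential_le : ∀ s, Ψ s ≤ 1
  error_nonneg : ∀ s, 0 ≤ B s
  jump : ∀ s a, X.rate l s a ≠ 0 → |w (X.next s a) - w s| ≤ h
  drift_le : ∀ s, c < w s → ∑ a, X.rate l s a * (w (X.next s a) - w s) ≤ -κ + B s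
  le_drift : ∀ s, c < w s → -κ₂ ≤ ∑ a, X.rate l s a * (w (X.next s a) - w s)
  sq : ∀ s, ∑ a, X.rate l s a * (w (X.next s a) - w s) ^ 2 ≤ e₂
  potential : ∀ s, ∑ a, X.rate l s a * ((1 + η) * Ψ (X.next s a) - Ψ s) ≤ -B s + e₁

namespace HasDrift

variable {w Ψ B : S → ℝ} {c h η κ κ₂ e₁ e₂ γ : ℝ}

/-- A Taylor estimate for `φ (w)` corrected by `φb (w) * Ψ`. The drift error `φ' * B` is at most `φb
* B`, which the drift of the potential cancels; the factor `1 + η` absorbs the change of `φb` during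
the same jump. Where `φ'` vanishes, the drift of `w` is irrelevant. -/
theorem sum_le (H : X.HasDrift l w Ψ B c h η κ κ₂ e₁ e₂) {φ φ' φb : ℝ → ℝ}
    (hφ : ∀ x y, |y| ≤ h → φ (x + y) ≤ φ x + φ' x * y + γ ^ 2 * φb x * y ^ 2)
    (hφb : ∀ x y, |y| ≤ h → φb (x + y) ≤ (1 + η) * φb x) (hφb0 : ∀ x, 0 ≤ φb x)
    (hφ'0 : ∀ x, 0 ≤ φ' x) (hφ' : ∀ x, φ' x ≤ φb x) {s : S} (hs : w s ≤ c → φ' (w s) = 0) :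
    ∑ a, X.rate l s a * (φ (w (X.next s a)) + φb (w (X.next s a)) * Ψ (X.next s a))
      ≤ X.totalRate l s * (φ (w s) + φb (w s) * Ψ s)
        - κ * φ' (w s) + φb (w s) * (γ ^ 2 * e₂ + e₁) := by
  set y : A → ℝ := fun a => w (X.next s a) - w s with hy
  have h1 : ∀ a, X.rate l s a * (φ (w (X.next s a)) + φb (w (X.next s a)) * Ψ (X.next s a))
      ≤ X.rate l s a * (φ (w s) + φb (w s) * Ψ s) + φ' (w s) * (X.rate l s a * y a)
        + γ ^ 2 * φb (w s) * (X.rate l s a * y a ^ 2)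
        + φb (w s) * (X.rate l s a * ((1 + η) * Ψ (X.next s a) - Ψ s)) := by
    intro a
    by_cases ha : X.rate l s a = 0
    · simp [ha]
    have e : w (X.next s a) = w s + y a := by simp [hy]
    have h2 := hφ (w s) (y a) (H.jump s a ha)
    have h3 := mul_le_mul_of_nonneg_right (hφb (w s) (y a) (H.jump s a ha))
      (H.potential_nonneg (X.next s a))
    rw [e]
    have h4 := mul_le_mul_of_nonneg_left (add_le_add h2 h3) (H.rate_nonneg s a)
    linarith
  refine (Finset.sum_le_sum fun a _ => h1 a).trans ?_
  rw [Finset.sum_add_distrib, Finset.sum_add_distrib, Finset.sum_add_distrib, ← Finset.sum_mul,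
    ← Finset.mul_sum, ← Finset.mul_sum, ← Finset.mul_sum]
  have h2 : φ' (w s) * ∑ a, X.rate l s a * y a ≤ φ' (w s) * (-κ + B s) := by
    rcases le_or_gt (w s) c with h | h
    · rw [hs h, zero_mul, zero_mul]
    · exact mul_le_mul_of_nonneg_left (H.drift_le s h) (hφ'0 _)
  have h3 := mul_le_mul_of_nonneg_left (H.sq s) (mul_nonneg (sq_nonneg γ) (hφb0 (w s)))
  have h4 := mul_le_mul_of_nonneg_left (H.potential s) (hφb0 (w s))
  have h5 := mul_le_mul_of_nonneg_right (hφ' (w s)) (H.error_nonneg s)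
  rw [show ∑ a, X.rate l s a = X.totalRate l s from rfl]
  linarith

/-- By `he` the second order terms use up at most half of the decay `κ γ`; the bound `1 + Ψ ≤ 2`
costs another factor of two. -/
theorem sum_exp_le (H : X.HasDrift l w Ψ B c h η κ κ₂ e₁ e₂) (hγ : 0 ≤ γ) (hγ1 : γ ≤ 1)
    (hγh : γ * h ≤ 1) (hη : 2 * (γ * h) ≤ η) (he : γ ^ 2 * e₂ + e₁ ≤ κ * γ / 2) (hκ : 0 ≤ κ)
    {s : S} (hs : c < w s) :
    ∑ a, X.rate l s a * (Real.exp (γ * w (X.next s a)) * (1 + Ψ (X.next s a)))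
      ≤ (X.totalRate l s - κ * γ / 4) * (Real.exp (γ * w s) * (1 + Ψ s)) := by
  have hy1 : ∀ {y}, |y| ≤ h → |γ * y| ≤ γ * h := fun {y} hy => by
    rw [abs_mul, abs_of_nonneg hγ]; exact mul_le_mul_of_nonneg_left hy hγ
  have h1 := H.sum_le (γ := γ) (φ := fun x => Real.exp (γ * x))
    (φ' := fun x => γ * Real.exp (γ * x)) (φb := fun x => Real.exp (γ * x)) (s := s)
    (fun x y hy => by
      have := exp_add_le (x := γ * x) ((hy1 hy).trans hγh)
      rw [mul_add]
      linarith)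
    (fun x y hy => by
      rw [mul_add, Real.exp_add, mul_comm]
      refine mul_le_mul_of_nonneg_right ?_ (Real.exp_pos _).le
      have := exp_le_one_add_two_mul_abs ((hy1 hy).trans hγh)
      linarith [hy1 hy])
    (fun x => (Real.exp_pos _).le) (fun x => by positivity)
    (fun x => mul_le_of_le_one_left (Real.exp_pos _).le hγ1) (fun h => absurd hs (not_lt.2 h))
  simp only [mul_add, mul_one] at h1 ⊢
  refine h1.trans ?_
  have h2 := mul_le_mul_of_nonneg_left he (Real.exp_pos (γ * w s)).le
  have h3 := mul_le_mul_of_nonneg_left (H.potential_le s)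
    (show 0 ≤ κ * γ / 4 * Real.exp (γ * w s) by positivity)
  linarith

/-- A Lyapunov function with a bounded derivative where the workload is at most `c`. -/
def truncatedExp (γ c : ℝ) (x : ℝ) : ℝ :=
  Real.exp (max (γ * (x - c)) 0) - max (γ * (x - c)) 0

/-- Valid in every state, since the derivative vanishes where nothing is known about the drift. The
price is the constant `κ * γ`, from the `-1` in that derivative. -/
theorem sum_truncatedExp_le (H : X.HasDrift l w Ψ B c h η κ κ₂ e₁ e₂) (hγ : 0 ≤ γ) (hγ1 : γ ≤ 1)
    (hγh : γ * h ≤ 1) (hη : 2 * (γ * h) ≤ η) (he : γ ^ 2 * e₂ + e₁ ≤ κ * γ / 2) (hκ : 0 ≤ κ)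
    (s : S) :
    ∑ a, X.rate l s a * (truncatedExp γ c (w (X.next s a))
        + Real.exp (max (γ * (w (X.next s a) - c)) 0) * Ψ (X.next s a))
      ≤ (X.totalRate l s - κ * γ / 4) * (truncatedExp γ c (w s)
        + Real.exp (max (γ * (w s - c)) 0) * Ψ s) + κ * γ := by
  have hy1 : ∀ {y}, |y| ≤ h → |γ * y| ≤ γ * h := fun {y} hy => by
    rw [abs_mul, abs_of_nonneg hγ]; exact mul_le_mul_of_nonneg_left hy hγ
  have hx : ∀ x y, γ * (x + y - c) = γ * (x - c) + γ * y := fun x y => by ring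
  have hpos : ∀ x, 1 ≤ Real.exp (max (γ * (x - c)) 0) := fun x =>
    Real.one_le_exp (le_max_right _ _)
  have h1 := H.sum_le (γ := γ) (φ := truncatedExp γ c)
    (φ' := fun x => γ * (Real.exp (max (γ * (x - c)) 0) - 1))
    (φb := fun x => Real.exp (max (γ * (x - c)) 0)) (s := s)
    (fun x y hy => by
      have := exp_sub_posPart_add_le (x := γ * (x - c)) ((hy1 hy).trans hγh)
      unfold truncatedExp
      rw [hx]
      linarith)
    (fun x y hy => by
      have := exp_posPart_add_le (x := γ * (x - c)) ((hy1 hy).trans hγh)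
      rw [hx]
      refine this.trans (mul_le_mul_of_nonneg_right ?_ (Real.exp_pos _).le)
      linarith [hy1 hy])
    (fun x => (Real.exp_pos _).le) (fun x => mul_nonneg hγ (by linarith [hpos x]))
    (fun x => (mul_le_of_le_one_left (by linarith [hpos x]) hγ1).trans (by linarith))
    (fun h => by
      rw [max_eq_right (mul_nonpos_of_nonneg_of_nonpos hγ (by linarith)), Real.exp_zero]; simp)
  refine h1.trans ?_
  set E := Real.exp (max (γ * (w s - c)) 0) with hE
  have h2 := mul_le_mul_of_nonneg_left he (show 0 ≤ E from (Real.exp_pos _).le)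
  have h3 : truncatedExp γ c (w s) ≤ E := sub_le_self _ (le_max_right _ _)
  have h4 : E * Ψ s ≤ E := mul_le_of_le_one_right (Real.exp_pos _).le (H.potential_le s)
  have h5 := mul_le_mul_of_nonneg_left (add_le_add h3 h4) (show 0 ≤ κ * γ / 4 by positivity)
  linarith

/-- Convexity in the form `1 + y ≤ exp y`, with the lower bound on the drift: the workload cannot
fall too fast, so a high workload forces a large hitting time moment. -/
theorem le_sum_exp (H : X.HasDrift l w Ψ B c h η κ κ₂ e₁ e₂) {β : ℝ} (hγ : 0 ≤ γ)
    (hβ : γ * κ₂ ≤ β) {s : S} (hs : c < w s) (x : ℝ) :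
    (X.totalRate l s - β) * Real.exp (γ * (w s - x))
      ≤ ∑ a, X.rate l s a * Real.exp (γ * (w (X.next s a) - x)) := by
  have h1 : ∀ a, X.rate l s a * Real.exp (γ * (w s - x))
      + γ * Real.exp (γ * (w s - x)) * (X.rate l s a * (w (X.next s a) - w s))
      ≤ X.rate l s a * Real.exp (γ * (w (X.next s a) - x)) := by
    intro a
    have e : γ * (w (X.next s a) - x) = γ * (w s - x) + γ * (w (X.next s a) - w s) := by ring
    rw [e, Real.exp_add]
    have h2 := Real.add_one_le_exp (γ * (w (X.next s a) - w s))
    have h3 := mul_le_mul_of_nonneg_left h2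
      (mul_nonneg (H.rate_nonneg s a) (Real.exp_pos (γ * (w s - x))).le)
    linarith
  refine le_trans ?_ (Finset.sum_le_sum fun a _ => h1 a)
  rw [Finset.sum_add_distrib, ← Finset.sum_mul, ← Finset.mul_sum]
  rw [show ∑ a, X.rate l s a = X.totalRate l s from rfl]
  have h2 := mul_le_mul_of_nonneg_left (H.le_drift s hs)
    (mul_nonneg hγ (Real.exp_pos (γ * (w s - x))).le)
  have h3 := mul_le_mul_of_nonneg_right hβ (Real.exp_pos (γ * (w s - x))).le
  linarith

theorem exp_le_truncatedExp {γ₀ x : ℝ} (hγ : γ₀ ≤ γ) (hx : 0 ≤ x) :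
    Real.exp (γ₀ * x) ≤ 2 * Real.exp (γ * c) * truncatedExp γ c x := by
  set v := max (γ * (x - c)) 0 with hv
  have h1 : 2 * v ≤ Real.exp v := by
    have h2 : 0 ≤ v := le_max_right _ _
    have h3 := Real.quadratic_le_exp_of_nonneg h2
    nlinarith [sq_nonneg (v - 1)]
  have h2 : Real.exp (γ * (x - c)) ≤ 2 * truncatedExp γ c x := by
    have : Real.exp (γ * (x - c)) ≤ Real.exp v := Real.exp_le_exp.2 (le_max_left _ _)
    unfold truncatedExp
    linarith
  calc Real.exp (γ₀ * x) ≤ Real.exp (γ * c + γ * (x - c)) := by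
        refine Real.exp_le_exp.2 ?_
        have := mul_le_mul_of_nonneg_right hγ hx
        linarith
    _ = Real.exp (γ * c) * Real.exp (γ * (x - c)) := Real.exp_add _ _
    _ ≤ Real.exp (γ * c) * (2 * truncatedExp γ c x) :=
        mul_le_mul_of_nonneg_left h2 (Real.exp_pos _).le
    _ = _ := by ring

end HasDrift

end JumpProcess

/-! ### The moment bound under a drift condition. -/

namespace JumpProcess

variable {A S : Type*} [Fintype A] [DecidableEq A] {X : JumpProcess A S} {l : A → ℝ}

/-- Bounds on exponential moments of the workload in terms of exponential moments of the first
time at which it is at most `2 * c`. -/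
theorem HasDrift.exists_lintegral_le {w Ψ B : S → ℝ} {c h η κ κ₂ e₁ e₂ γ : ℝ}
    (H : X.HasDrift l w Ψ B c h η κ κ₂ e₁ e₂) (ν : A → Measure ℝ)
    [∀ a, IsProbabilityMeasure (ν a)] (hν : ∀ a, ν a = expMeasure (l a)) (hl : ∀ a, 0 < l a)
    (hsp : ∀ s a, 0 ≤ X.speed s a) (hγ : 0 < γ) (hγ1 : γ ≤ 1)
    (hγh : γ * h ≤ 1) (hη : 2 * (γ * h) ≤ η) (he : γ ^ 2 * e₂ + e₁ ≤ κ * γ / 2) (hκ : 0 < κ)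
    (hc : 0 < c) {D Hit : S → Prop} (hD : ∀ s, D s ↔ w s ≤ 2 * c) (hDH : ∀ s, D s → Hit s)
    (hHit : ∀ s a, Hit (X.next s a) ↔ Hit s ∨ D (X.next s a))
    {β γ₀ L c₀ : ℝ} (hβ : 0 < β) (hβ1 : β < κ * γ / 4) (hL1 : κ * γ / 4 ≤ L)
    (hL : ∀ s, X.totalRate l s ≤ L) (hβL : ∀ s, β < X.totalRate l s)
    (hγ₀ : 0 ≤ γ₀) (hγ₀γ : γ₀ ≤ γ) (hγ₀β : γ₀ * κ₂ ≤ β) (hc₀ : β * c₀ = κ * γ) :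
    ∃ V : S → ℝ, (∀ s, 0 ≤ V s) ∧
      (∀ s, Tendsto (fun n => ∫⁻ U, X.expHit D β n s U ∂(clockLaw ν)) atTop
        (𝓝 (ENNReal.ofReal (V s)))) ∧
      ∀ n s t, 0 ≤ t → (Hit s → D s) →
        ∫⁻ U, X.valueAt (fun s => ENNReal.ofReal (Real.exp (γ₀ * w s))) n s t U ∂(clockLaw ν)
          ≤ ENNReal.ofReal ((2 * Real.exp (γ * c) * (c₀ + 2 * Real.exp (γ * c))
            + Real.exp (γ₀ * (2 * c))) * (1 + Real.exp (-(β * t)) * V s)) := by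
  classical
  -- The supersolution makes the moments finite, and the subsolution yields `exp (γ₀ * (w s - 2 *
  -- c)) ≤ V s`.
  obtain ⟨V, hV, -, hV1, huV, hVs⟩ := X.exists_hitMoment_limit hl hsp D hβ.le hβL hβ1 hL hL1
    (Φ := fun s => Real.exp (γ * w s) * (1 + Ψ s)) (u := fun s => Real.exp (γ₀ * (w s - 2 * c)))
    (fun s => one_le_mul_of_one_le_of_one_le
      (Real.one_le_exp (mul_nonneg hγ.le (H.w_nonneg s))) (by linarith [H.potential_nonneg s]))
    (fun s hs => H.sum_exp_le hγ.le hγ1 hγh hη he hκ.le (by rw [hD, not_le] at hs; linarith))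
    (fun s => by
      have h1 : γ₀ * (w s - 2 * c) ≤ γ * w s :=
        (mul_le_mul_of_nonneg_left (by linarith) hγ₀).trans
          (mul_le_mul_of_nonneg_right hγ₀γ (H.w_nonneg s))
      exact (Real.exp_le_exp.2 h1).trans (le_mul_of_one_le_right (Real.exp_pos _).le
        (by linarith [H.potential_nonneg s])))
    (fun s hs => Real.exp_le_one_iff.2
      (mul_nonpos_of_nonneg_of_nonpos hγ₀ (by linarith [(hD s).1 hs])))
    (fun s hs => H.le_sum_exp hγ₀ hγ₀β (by rw [hD, not_le] at hs; linarith) _)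
  set Φ : S → ℝ := fun s => HasDrift.truncatedExp γ c (w s)
        + Real.exp (max (γ * (w s - c)) 0) * Ψ s with hΦ
  set E := Real.exp (γ * c) with hE
  have hE1 : 1 ≤ E := Real.one_le_exp (by positivity)
  have hc₀' : 0 ≤ c₀ := by
    have : 0 < β * c₀ := by rw [hc₀]; positivity
    exact (pos_of_mul_pos_right this hβ.le).le
  have hexp : ∀ s, Real.exp (γ₀ * w s) ≤ 2 * E * HasDrift.truncatedExp γ c (w s) := fun s =>
    HasDrift.exp_le_truncatedExp hγ₀γ (H.w_nonneg s)
  have htr : ∀ s, 0 ≤ HasDrift.truncatedExp γ c (w s) := fun s => by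
    have := (Real.exp_pos _).trans_le (hexp s)
    exact (pos_of_mul_pos_right this (by positivity)).le
  have hΦle : ∀ s, HasDrift.truncatedExp γ c (w s) ≤ Φ s := fun s =>
    le_add_of_nonneg_right (mul_nonneg (Real.exp_pos _).le (H.potential_nonneg s))
  have hΦ0 : ∀ s, 0 ≤ Φ s := fun s => (htr s).trans (hΦle s)
  have hΦD : ∀ s, D s → Φ s ≤ 2 * E := by
    intro s hs
    have h1 : Real.exp (max (γ * (w s - c)) 0) ≤ E := by
      refine Real.exp_le_exp.2 (max_le (mul_le_mul_of_nonneg_left ?_ hγ.le) (by positivity))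
      linarith [(hD s).1 hs]
    have h2 : HasDrift.truncatedExp γ c (w s) ≤ Real.exp (max (γ * (w s - c)) 0) :=
      sub_le_self _ (le_max_right _ _)
    have h3 : Real.exp (max (γ * (w s - c)) 0) * Ψ s ≤ Real.exp (max (γ * (w s - c)) 0) :=
      mul_le_of_le_one_right (Real.exp_pos _).le (H.potential_le s)
    simp only [hΦ]
    linarith
  set H₀ := 2 * E * (c₀ + 2 * E) with hH₀
  -- The glued supersolution `cc + exp (-β t) * dd`. After the hit it is `2 * E` times the mixture
  -- of `c₀` and `Φ` with weights `1 - exp (-β t)` and `exp (-β t)`, where `β * c₀ = κ * γ` balances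
  -- the constant in the drift of `Φ`. Before the hit it is `H₀` plus a decaying multiple of `V`.
  set cc : S → ℝ := fun s => if Hit s then 2 * E * c₀ else H₀ with hcc
  set dd : S → ℝ := fun s => if Hit s then 2 * E * (Φ s - c₀)
    else Real.exp (γ₀ * (2 * c)) * V s with hdd
  have hV0 : ∀ s, 0 ≤ V s := fun s => zero_le_one.trans (hV1 s)
  have ht1 : ∀ t, 0 ≤ t → Real.exp (-(β * t)) ≤ 1 := fun t ht =>
    Real.exp_le_one_iff.2 (by have := mul_nonneg hβ.le ht; linarith)
  refine ⟨V, hV0, fun s => ?_, fun n s t ht hs => ?_⟩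
  · simp_rw [X.lintegral_expHit ν hl hν hsp D hβL]
    exact ENNReal.tendsto_ofReal (hV s)
  · refine (X.lintegral_valueAt_le ν hl hν hsp (fun s => hβ.trans (hβL s)) _ cc dd β
      ?_ ?_ ?_ n s t ht).trans (ENNReal.ofReal_le_ofReal ?_)
    · intro s t ht
      simp only [hcc, hdd]
      split_ifs with h
      · have h1 := mul_nonneg hc₀' (sub_nonneg.2 (ht1 t ht))
        have h2 := mul_nonneg (Real.exp_pos (-(β * t))).le (hΦ0 s)
        have h3 : 0 ≤ 2 * E * (c₀ * (1 - Real.exp (-(β * t))) + Real.exp (-(β * t)) * Φ s) := by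
          positivity
        linarith
      · have := hV0 s
        positivity
    · intro s
      refine ENNReal.ofReal_le_ofReal ?_
      simp only [hcc, hdd]
      split_ifs with h
      · have := mul_le_mul_of_nonneg_left (hΦle s) (show 0 ≤ 2 * E by positivity)
        linarith [hexp s]
      · have h1 := mul_le_mul_of_nonneg_left (huV s) (Real.exp_pos (γ₀ * (2 * c))).le
        rw [← Real.exp_add, show γ₀ * (2 * c) + γ₀ * (w s - 2 * c) = γ₀ * w s by ring] at h1
        have : 0 ≤ H₀ := by positivity
        linarith
    · intro s t ht
      set ex := Real.exp (-(β * t)) with hex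
      have hex0 : 0 < ex := Real.exp_pos _
      by_cases h : Hit s
      · have hn : ∀ a, Hit (X.next s a) := fun a => (hHit s a).2 (Or.inl h)
        simp only [hcc, hdd, hn, h, if_true]
        have h1 := H.sum_truncatedExp_le hγ.le hγ1 hγh hη he hκ.le s
        have h2 : ∑ a, X.rate l s a * (2 * E * c₀ + ex * (2 * E * (Φ (X.next s a) - c₀)))
            = X.totalRate l s * (2 * E * c₀ * (1 - ex))
              + 2 * E * ex * ∑ a, X.rate l s a * Φ (X.next s a) := by
          rw [totalRate, Finset.sum_mul, Finset.mul_sum, ← Finset.sum_add_distrib]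
          exact Finset.sum_congr rfl fun a _ => by ring
        rw [h2]
        have h3 := mul_le_mul_of_nonneg_left h1 (show 0 ≤ 2 * E * ex by positivity)
        have h4 := mul_le_mul_of_nonneg_right hβ1.le (hΦ0 s)
        have h5 := mul_le_mul_of_nonneg_left h4 (show 0 ≤ 2 * E * ex by positivity)
        have h6 : 2 * E * ex * (β * c₀) = 2 * E * ex * (κ * γ) := by rw [hc₀]
        simp only [hΦ] at h3 h4 h5 h6 ⊢
        linarith
      · have hn : ¬ D s := fun h' => h (hDH s h')
        have h1 := hVs s hn
        -- The two pieces match at a jump into `D`: there `Φ ≤ 2 * E`, so the value after the hit is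
        -- at most `H₀`.
        have h2 : ∀ a, cc (X.next s a) + ex * dd (X.next s a)
            ≤ H₀ + ex * (Real.exp (γ₀ * (2 * c)) * V (X.next s a)) := by
          intro a
          by_cases h' : Hit (X.next s a)
          · have hd : D (X.next s a) := ((hHit s a).1 h').resolve_left h
            simp only [hcc, hdd, if_pos h']
            have g1 := hΦD _ hd
            have g2 : ex * Φ (X.next s a) ≤ 1 * (2 * E) :=
              mul_le_mul (ht1 t ht) g1 (hΦ0 _) zero_le_one
            have g3 := mul_nonneg hex0.le hc₀'
            have g4 : 0 ≤ 2 * E * (2 * E - ex * Φ (X.next s a) + ex * c₀) :=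
              mul_nonneg (by positivity) (by linarith)
            have g5 : 0 ≤ ex * (Real.exp (γ₀ * (2 * c)) * V (X.next s a)) := by
              have := hV0 (X.next s a); positivity
            linarith
          · simp only [hcc, hdd, if_neg h']; exact le_rfl
        refine (Finset.sum_le_sum fun a _ =>
          mul_le_mul_of_nonneg_left (h2 a) (H.rate_nonneg s a)).trans ?_
        have h3 : ∑ a, X.rate l s a * (H₀ + ex * (Real.exp (γ₀ * (2 * c)) * V (X.next s a)))
            = X.totalRate l s * H₀
              + ex * Real.exp (γ₀ * (2 * c)) * ∑ a, X.rate l s a * V (X.next s a) := by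
          rw [totalRate, Finset.sum_mul, Finset.mul_sum, ← Finset.sum_add_distrib]
          exact Finset.sum_congr rfl fun a _ => by ring
        rw [h3]
        simp only [hcc, hdd, if_neg h]
        have h4 := mul_le_mul_of_nonneg_left h1
          (show 0 ≤ ex * Real.exp (γ₀ * (2 * c)) by positivity)
        linarith
    · have hEV : 0 ≤ Real.exp (-(β * t)) * V s := mul_nonneg (Real.exp_pos _).le (hV0 s)
      have hH0 : 0 ≤ H₀ := by positivity
      have hE2 := Real.exp_pos (γ₀ * (2 * c))
      have g1 := mul_nonneg hH0 hEV
      have g2 := mul_nonneg hE2.le hEV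
      simp only [hcc, hdd]
      split_ifs with h
      · have g3 : Real.exp (-(β * t)) * Φ s ≤ 1 * (2 * E) :=
          mul_le_mul (ht1 t ht) (hΦD s (hs h)) (hΦ0 _) zero_le_one
        have g4 := mul_nonneg (Real.exp_pos (-(β * t))).le hc₀'
        have g5 : 0 ≤ 2 * E * (2 * E - Real.exp (-(β * t)) * Φ s + Real.exp (-(β * t)) * c₀) :=
          mul_nonneg (by positivity) (by linarith)
        linarith
      · linarith

end JumpProcess

/-! ### The drift of the queue length process -/

section Potential

variable (lo hi A θ : ℝ)

open Classical in
/-- The potential of a queue: it decreases while the queue is depleted, and decays exponentially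
in the queue length otherwise. -/
def depletionPotential (e : Prop) (q : ℝ) : ℝ :=
  if e then A * (hi + 1 - q) + 2 * A * (hi + 2) * Real.exp (-(θ * (hi - lo)))
  else 2 * A * (hi + 2) * Real.exp (-(θ * (q - lo)))

variable {lo hi A θ} {e : Prop} {q : ℝ}

theorem depletionPotential_mem (hlo : 0 < lo) (hlh : lo < hi) (hA : 0 < A) (hθ : 0 < θ)
    (hsmall : Real.exp (-(θ * (hi - lo))) ≤ 1 / 2) (hq : 0 ≤ q) (he : e → q < hi)
    (hne : ¬ e → lo ≤ q) :
    0 ≤ depletionPotential lo hi A θ e q ∧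
      depletionPotential lo hi A θ e q ≤ 2 * A * (hi + 2) := by
  have hb : 0 < 2 * A * (hi + 2) := mul_pos (by linarith) (by linarith)
  unfold depletionPotential
  split_ifs with h
  · have h1 := mul_le_mul_of_nonneg_left hsmall hb.le
    have h2 : A * (hi + 1 - q) ≤ A * (hi + 2) := mul_le_mul_of_nonneg_left (by linarith) hA.le
    have h3 : 0 ≤ A * (hi + 1 - q) := mul_nonneg hA.le (by linarith [he h])
    exact ⟨by positivity, by linarith⟩
  · refine ⟨by positivity, mul_le_of_le_one_right hb.le (Real.exp_le_one_iff.2 ?_)⟩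
    have := mul_nonneg hθ.le (sub_nonneg.2 (hne h))
    linarith

/-- There are three regimes. While depleted, there is no service and each arrival lowers the
potential by at least `A`; half of the gain `a * A` pays for `b`, half for the terms with `η`. If
the queue is not depleted and below `hi`, the push `ε` makes the exponential decrease on average.
Above `hi` nothing is known about the rates, but the potential is exponentially small. -/
theorem depletionPotential_drift_le (hlo : 0 < lo) (hlh : lo < hi) (hA : 0 < A) (hθ : 0 < θ)
    (hθ1 : θ ≤ 1) (hsmall : Real.exp (-(θ * (hi - lo))) ≤ 1 / 2) (hq : 0 ≤ q) (he : e → q < hi)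
    (hne : ¬ e → lo ≤ q) {e₁ e₂ : Prop} (hup : e₁ ↔ (q + 1 < lo ∨ e) ∧ q + 1 < hi)
    (hdn : e₂ ↔ (q - 1 < lo ∨ e) ∧ q - 1 < hi) {a σ L η ε b : ℝ} (ha : 0 ≤ a) (hσ : 0 ≤ σ)
    (hσL : σ ≤ L) (hσe : e → σ = 0) (hσh : ¬ e → q < hi → σ ≤ a - ε) (hη : 0 ≤ η) (hη1 : η ≤ 1)
    (hηa : 4 * η * L * (hi + 2) ≤ a) (hθa : 4 * a * θ ≤ ε) (hηθ : 2 * η * L ≤ ε * θ)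
    (hb : 2 * b ≤ A * a) [Decidable e] :
    (1 + η) * (a * (depletionPotential lo hi A θ e₁ (q + 1) - depletionPotential lo hi A θ e q)
        + σ * (depletionPotential lo hi A θ e₂ (q - 1) - depletionPotential lo hi A θ e q))
        + η * L * depletionPotential lo hi A θ e q
      ≤ -(if e then b else 0)
        + 5 * L * (2 * A * (hi + 2)) * Real.exp (-(θ * (hi - lo))) := by
  have hmem := depletionPotential_mem hlo hlh hA hθ hsmall hq he hne
  set b₀ := 2 * A * (hi + 2) with hb₀
  have hb₀0 : 0 < b₀ := mul_pos (by linarith) (by linarith)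
  have hL : 0 ≤ L := hσ.trans hσL
  by_cases h : e
  · rw [hσe h, zero_mul, add_zero, if_pos h]
    -- At restocking the linear part still exceeds `A`, and the constant added to it dominates the
    -- exponential from `hi` on.
    have h1 : depletionPotential lo hi A θ e₁ (q + 1)
        ≤ depletionPotential lo hi A θ e q - A := by
      unfold depletionPotential
      rw [if_pos h]
      split_ifs with h'
      · linarith
      · have h2 : hi ≤ q + 1 := not_lt.1 fun h2 => h' (hup.2 ⟨Or.inr h, h2⟩)
        have h3 : Real.exp (-(θ * (q + 1 - lo))) ≤ Real.exp (-(θ * (hi - lo))) := by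
          refine Real.exp_le_exp.2 (neg_le_neg (mul_le_mul_of_nonneg_left (by linarith) hθ.le))
        have h4 := mul_le_mul_of_nonneg_left h3 hb₀0.le
        have h5 : A * 1 ≤ A * (hi + 1 - q) := mul_le_mul_of_nonneg_left (by linarith [he h]) hA.le
        rw [← hb₀]
        linarith
    have h2 : a * (depletionPotential lo hi A θ e₁ (q + 1) - depletionPotential lo hi A θ e q)
        ≤ a * (-A) := mul_le_mul_of_nonneg_left (by linarith) ha
    have h3 := mul_le_mul_of_nonneg_left h2 (show 0 ≤ 1 + η by linarith)
    have h4 := mul_le_mul_of_nonneg_left hmem.2 (mul_nonneg hη hL)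
    have h5 := mul_le_mul_of_nonneg_left hηa hA.le
    have h6 : 0 ≤ η * (a * A) := by positivity
    have h7 : 0 ≤ 5 * L * b₀ * Real.exp (-(θ * (hi - lo))) := by positivity
    rw [hb₀] at h4
    linarith
  · rw [if_neg h]
    have he₁ : ¬ e₁ := fun h' => by
      rcases (hup.1 h').1 with h1 | h1
      · linarith [hne h]
      · exact h h1
    set ψ := depletionPotential lo hi A θ e q with hψ
    have hψe : ψ = b₀ * Real.exp (-(θ * (q - lo))) := by rw [hψ, depletionPotential, if_neg h]
    have h1 : depletionPotential lo hi A θ e₁ (q + 1) = Real.exp (-θ) * ψ := by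
      rw [hψe, depletionPotential, if_neg he₁, ← hb₀,
        show -(θ * (q + 1 - lo)) = -θ + -(θ * (q - lo)) by ring, Real.exp_add]
      ring
    -- Becoming depleted does not raise the potential above the continued exponential, which is at
    -- least `b₀` below `lo`; this is where the factor `2` in `b₀` and `hsmall` are used.
    have h2 : depletionPotential lo hi A θ e₂ (q - 1) ≤ Real.exp θ * ψ := by
      have h3 : Real.exp θ * ψ = b₀ * Real.exp (-(θ * (q - 1 - lo))) := by
        rw [hψe, show -(θ * (q - 1 - lo)) = θ + -(θ * (q - lo)) by ring, Real.exp_add]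
        ring
      rw [h3, depletionPotential, ← hb₀]
      split_ifs with h'
      · have h4 : q - 1 < lo := (hdn.1 h').1.resolve_right h
        have h5 : 1 ≤ Real.exp (-(θ * (q - 1 - lo))) := by
          refine Real.one_le_exp ?_
          have := mul_nonneg hθ.le (show 0 ≤ lo - (q - 1) by linarith)
          linarith
        have h6 := mul_le_mul_of_nonneg_left h5 hb₀0.le
        have h7 := mul_le_mul_of_nonneg_left hsmall hb₀0.le
        have h8 : A * (hi + 1 - (q - 1)) ≤ A * (hi + 2) :=
          mul_le_mul_of_nonneg_left (by linarith) hA.le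
        linarith
      · exact le_rfl
    have hψ0 : 0 ≤ ψ := hmem.1
    have hu1 : Real.exp (-θ) ≤ 1 - θ + θ ^ 2 := by
      have := exp_le_one_add_add_sq (x := -θ) (by rw [abs_neg, abs_of_pos hθ]; exact hθ1)
      linarith [neg_sq θ]
    have hu2 : Real.exp θ ≤ 1 + θ + θ ^ 2 :=
      exp_le_one_add_add_sq (by rw [abs_of_pos hθ]; exact hθ1)
    have hθ2 : θ ^ 2 ≤ θ := by nlinarith
    have h3 : a * (depletionPotential lo hi A θ e₁ (q + 1) - ψ)
          + σ * (depletionPotential lo hi A θ e₂ (q - 1) - ψ)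
        ≤ (a * (-θ + θ ^ 2) + σ * (θ + θ ^ 2)) * ψ := by
      have h4 : depletionPotential lo hi A θ e₁ (q + 1) - ψ ≤ (-θ + θ ^ 2) * ψ := by
        rw [h1]
        have := mul_le_mul_of_nonneg_right hu1 hψ0
        linarith
      have h5 : depletionPotential lo hi A θ e₂ (q - 1) - ψ ≤ (θ + θ ^ 2) * ψ := by
        have := mul_le_mul_of_nonneg_right hu2 hψ0
        linarith
      have h6 := mul_le_mul_of_nonneg_left h4 ha
      have h7 := mul_le_mul_of_nonneg_left h5 hσ
      linarith
    have h4 := mul_le_mul_of_nonneg_left h3 (show 0 ≤ 1 + η by linarith)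
    have hr0 : 0 ≤ 5 * L * b₀ * Real.exp (-(θ * (hi - lo))) := by positivity
    rcases lt_or_ge q hi with hqh | hqh
    · have h5 := mul_le_mul_of_nonneg_right (hσh h hqh) (show 0 ≤ θ + θ ^ 2 by positivity)
      have h6 : 4 * a * θ * θ ≤ ε * θ := mul_le_mul_of_nonneg_right hθa hθ.le
      have hε : 0 ≤ ε := le_trans (by positivity) hθa
      have h7 : a * (-θ + θ ^ 2) + σ * (θ + θ ^ 2) ≤ -(ε * θ / 2) := by
        nlinarith [mul_nonneg hε (sq_nonneg θ)]
      have h8 : (1 + η) * (a * (-θ + θ ^ 2) + σ * (θ + θ ^ 2)) + η * L ≤ 0 := by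
        have := mul_le_mul_of_nonneg_left h7 (show 0 ≤ 1 + η by linarith)
        have := mul_nonneg hη (mul_nonneg hε hθ.le)
        linarith
      have h9 := mul_le_mul_of_nonneg_right h8 hψ0
      linarith
    · have h5 : ψ ≤ b₀ * Real.exp (-(θ * (hi - lo))) := by
        rw [hψe]
        refine mul_le_mul_of_nonneg_left (Real.exp_le_exp.2 (neg_le_neg ?_)) hb₀0.le
        exact mul_le_mul_of_nonneg_left (by linarith) hθ.le
      have h6 : a * (-θ + θ ^ 2) + σ * (θ + θ ^ 2) ≤ 2 * L := by
        have g1 : a * (-θ + θ ^ 2) ≤ 0 := mul_nonpos_of_nonneg_of_nonpos ha (by linarith)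
        have g2 : σ * (θ + θ ^ 2) ≤ L * 2 := mul_le_mul hσL (by linarith) (by positivity) hL
        linarith
      have h7 : (1 + η) * (a * (-θ + θ ^ 2) + σ * (θ + θ ^ 2)) + η * L ≤ 5 * L := by
        have g1 := mul_le_mul_of_nonneg_left h6 (show 0 ≤ 1 + η by linarith)
        have g2 := mul_le_mul_of_nonneg_right hη1 hL
        linarith
      have h8 := mul_le_mul_of_nonneg_right h7 hψ0
      have h9 := mul_le_mul_of_nonneg_left h5 (show 0 ≤ 5 * L by linarith)
      linarith

end Potential

section NetDrift

variable {J : ℕ} {lo hi : ℝ} {y : Set (Fin J) → Fin J → ℝ} {D : (Fin J → ℤ) → Prop}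

theorem netProcess_depleted_next (s : NetState J) (a : Fin J ⊕ Fin J) (j : Fin J) :
    ((netProcess lo hi y D).next s a).Depleted lo hi j ↔
      ((((netProcess lo hi y D).next s a).queue j : ℝ) < lo ∨ s.Depleted lo hi j) ∧
        (((netProcess lo hi y D).next s a).queue j : ℝ) < hi := by
  have h : ((netProcess lo hi y D).next s a).dep j = true ↔ s.Depleted lo hi j := by
    simp [netProcess]
  rw [← h]
  rfl

theorem netProcess_hit_next (s : NetState J) (a : Fin J ⊕ Fin J) :
    ((netProcess lo hi y D).next s a).Hit D ↔
      s.Hit D ∨ D fun j => ((netProcess lo hi y D).next s a).queue j := by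
  have h : ((netProcess lo hi y D).next s a).hit = true ↔ s.Hit D := by
    simp [netProcess]
  rw [← h]
  rfl

theorem netProcess_queue_inl (s : NetState J) (k j : Fin J) :
    (((netProcess lo hi y D).next s (Sum.inl k)).queue j : ℝ)
      = s.queue j + if j = k then 1 else 0 := by
  by_cases h : j = k
  · subst h; simp [netProcess]
  · simp [netProcess, h]

theorem netProcess_queue_inr (s : NetState J) (k j : Fin J) (hk : 0 < s.queue k) :
    (((netProcess lo hi y D).next s (Sum.inr k)).queue j : ℝ)
      = s.queue j - if j = k then 1 else 0 := by
  by_cases h : j = k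
  · subst h
    simp only [netProcess, Sum.elim_inr, Function.update_self, if_true]
    rw [Nat.cast_sub hk, Nat.cast_one]
  · simp [netProcess, h]

theorem NetState.le_of_not_depleted (hlh : lo < hi) {s : NetState J} {j : Fin J}
    (h : ¬ s.Depleted lo hi j) : lo ≤ s.queue j := by
  by_contra! h'
  exact h ⟨Or.inl h', h'.trans hlh⟩

theorem netProcess_queue_pos (hlo : 0 < lo) (hlh : lo < hi) {l : Fin J ⊕ Fin J → ℝ}
    {s : NetState J} {j : Fin J} (h : (netProcess lo hi y D).rate l s (Sum.inr j) ≠ 0) :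
    0 < s.queue j := by
  have h1 : ¬ s.Depleted lo hi j := fun h' => h (by
    simp [JumpProcess.rate, netProcess, NetState.flow, h'])
  have := hlo.trans_le (NetState.le_of_not_depleted hlh h1)
  exact_mod_cast this

/-- The workload of a state, with weights `k`. -/
def NetState.work (k : Fin J → ℝ) (s : NetState J) : ℝ := ∑ j, k j * s.queue j

variable (lo hi) in
/-- The sum of the potentials of all queues. -/
def NetState.potential (A θ : ℝ) (s : NetState J) : ℝ :=
  ∑ j, depletionPotential lo hi A θ (s.Depleted lo hi j) (s.queue j)

open Classical in
variable (lo hi) in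
/-- A bound for the drift that is lost to depleted queues. -/
def NetState.loss (b : ℝ) (s : NetState J) : ℝ := ∑ j, if s.Depleted lo hi j then b else 0

theorem netProcess_work_inl (k : Fin J → ℝ) (s : NetState J) (j : Fin J) :
    ((netProcess lo hi y D).next s (Sum.inl j)).work k - s.work k = k j := by
  simp only [NetState.work, netProcess_queue_inl]
  rw [← Finset.sum_sub_distrib, Finset.sum_eq_single j (fun b _ hb => by simp [hb])
    (fun h => absurd (Finset.mem_univ j) h)]
  simp
  ring

theorem netProcess_work_inr (k : Fin J → ℝ) (s : NetState J) (j : Fin J) (hj : 0 < s.queue j) :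
    ((netProcess lo hi y D).next s (Sum.inr j)).work k - s.work k = -k j := by
  simp only [NetState.work, netProcess_queue_inr s j _ hj]
  rw [← Finset.sum_sub_distrib, Finset.sum_eq_single j (fun b _ hb => by simp [hb])
    (fun h => absurd (Finset.mem_univ j) h)]
  simp
  ring

theorem netProcess_potential_next (A θ : ℝ) (s : NetState J) (a : Fin J ⊕ Fin J)
    (j : Fin J) (ha : a = Sum.inl j ∨ a = Sum.inr j) :
    ((netProcess lo hi y D).next s a).potential lo hi A θ - s.potential lo hi A θ
      = depletionPotential lo hi A θ (((netProcess lo hi y D).next s a).Depleted lo hi j)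
          (((netProcess lo hi y D).next s a).queue j)
        - depletionPotential lo hi A θ (s.Depleted lo hi j) (s.queue j) := by
  unfold NetState.potential
  rw [← Finset.sum_sub_distrib, Finset.sum_eq_single j _ (fun h => absurd (Finset.mem_univ j) h)]
  intro b _ hb
  have h1 : ((netProcess lo hi y D).next s a).queue b = s.queue b := by
    rcases ha with rfl | rfl <;> simp [netProcess, hb]
  have h2 : ((netProcess lo hi y D).next s a).Depleted lo hi b = s.Depleted lo hi b := by
    rw [eq_iff_iff, netProcess_depleted_next, h1]
    constructor
    · rintro ⟨h | h, h'⟩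
      exacts [⟨Or.inl h, h'⟩, h]
    · exact fun h => ⟨Or.inr h, h.2⟩
  rw [h1, h2, sub_self]

theorem netProcess_sum_rate (l : Fin J ⊕ Fin J → ℝ) (s : NetState J)
    (f : Fin J ⊕ Fin J → ℝ) :
    ∑ a, (netProcess lo hi y D).rate l s a * f a
      = ∑ j, (l (Sum.inl j) * f (Sum.inl j) + l (Sum.inr j) * s.flow lo hi y j * f (Sum.inr j)) := by
  rw [Fintype.sum_sum_type, ← Finset.sum_add_distrib]
  exact Finset.sum_congr rfl fun j _ => by simp [JumpProcess.rate, netProcess]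

theorem netProcess_potential_drift_le (hlo : 0 < lo) (hlh : lo < hi)
    {l : Fin J ⊕ Fin J → ℝ} (hl : ∀ a, 0 < l a) (hy : ∀ s j, 0 ≤ y s j)
    {A θ L η ε b : ℝ} (hA : 0 < A) (hθ : 0 < θ)
    (hθ1 : θ ≤ 1) (hsmall : Real.exp (-(θ * (hi - lo))) ≤ 1 / 2)
    (hL : ∀ s, (netProcess lo hi y D).totalRate l s ≤ L)
    (hyε : ∀ s j, j ∉ s → l (Sum.inr j) * y s j ≤ l (Sum.inl j) - ε)
    (hη : 0 ≤ η) (hη1 : η ≤ 1) (hηa : ∀ j, 4 * η * L * (hi + 2) ≤ l (Sum.inl j))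
    (hθa : ∀ j, 4 * l (Sum.inl j) * θ ≤ ε) (hηθ : 2 * η * L ≤ ε * θ)
    (hb : ∀ j, 2 * b ≤ A * l (Sum.inl j)) (s : NetState J) :
    ∑ a, (netProcess lo hi y D).rate l s a *
        ((1 + η) * ((netProcess lo hi y D).next s a).potential lo hi A θ - s.potential lo hi A θ)
      ≤ -s.loss lo hi b
        + J * (5 * L * (2 * A * (hi + 2)) * Real.exp (-(θ * (hi - lo)))) := by
  classical
  set X := netProcess lo hi y D with hX
  have hflow : ∀ j, 0 ≤ s.flow lo hi y j := fun j => by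
    unfold NetState.flow; split_ifs
    exacts [le_rfl, hy _ _]
  have hr0 : ∀ a, 0 ≤ X.rate l s a := by
    rintro (j | j)
    · exact mul_nonneg (hl _).le zero_le_one
    · exact mul_nonneg (hl _).le (hflow j)
  set ψ : Fin J → ℝ := fun j => depletionPotential lo hi A θ (s.Depleted lo hi j) (s.queue j)
    with hψ
  have hψ0 : ∀ j, 0 ≤ ψ j := fun j => (depletionPotential_mem hlo hlh hA hθ hsmall
    (Nat.cast_nonneg _) (fun h => h.2) (NetState.le_of_not_depleted hlh)).1
  have h1 : ∑ a, X.rate l s a *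
        ((1 + η) * (X.next s a).potential lo hi A θ - s.potential lo hi A θ)
      = (1 + η) * ∑ a, X.rate l s a *
        ((X.next s a).potential lo hi A θ - s.potential lo hi A θ)
        + η * X.totalRate l s * ∑ j, ψ j := by
    rw [show ∑ j, ψ j = s.potential lo hi A θ from rfl, JumpProcess.totalRate, Finset.mul_sum,
      Finset.mul_sum, Finset.sum_mul, ← Finset.sum_add_distrib]
    exact Finset.sum_congr rfl fun a _ => by ring
  have h2 : η * X.totalRate l s * ∑ j, ψ j ≤ ∑ j, η * L * ψ j := by
    rw [← Finset.mul_sum]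
    exact mul_le_mul_of_nonneg_right (mul_le_mul_of_nonneg_left (hL s) hη)
      (Finset.sum_nonneg fun j _ => hψ0 j)
  rw [h1]
  refine (add_le_add_right h2 _).trans ?_
  rw [netProcess_sum_rate, Finset.mul_sum, ← Finset.sum_add_distrib]
  have h3 : -s.loss lo hi b + J * (5 * L * (2 * A * (hi + 2)) * Real.exp (-(θ * (hi - lo))))
      = ∑ j : Fin J, (-(if s.Depleted lo hi j then b else 0)
        + 5 * L * (2 * A * (hi + 2)) * Real.exp (-(θ * (hi - lo)))) := by
    rw [Finset.sum_add_distrib, Finset.sum_neg_distrib]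
    simp [NetState.loss]
  rw [h3]
  refine Finset.sum_le_sum fun j _ => ?_
  rw [netProcess_potential_next A θ s (Sum.inl j) j (Or.inl rfl),
    netProcess_potential_next A θ s (Sum.inr j) j (Or.inr rfl)]
  set σ := l (Sum.inr j) * s.flow lo hi y j with hσ
  have hq : (((netProcess lo hi y D).next s (Sum.inl j)).queue j : ℝ) = s.queue j + 1 := by
    rw [netProcess_queue_inl, if_pos rfl]
  have hσ0 : 0 ≤ σ := mul_nonneg (hl _).le (hflow j)
  have hσL : σ ≤ L :=
    (Finset.single_le_sum (fun a _ => hr0 a) (Finset.mem_univ (Sum.inr j))).trans (hL s)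
  have hσe : s.Depleted lo hi j → σ = 0 := fun h => by
    rw [hσ, NetState.flow, if_pos h, mul_zero]
  have hσh : ¬ s.Depleted lo hi j → (s.queue j : ℝ) < hi → σ ≤ l (Sum.inl j) - ε := fun h h' => by
    rw [hσ, NetState.flow, if_neg h]
    exact hyε _ _ (not_le.2 h')
  -- Indicator after a departure with real subtraction. It may differ from that of `next` only where
  -- the service rate vanishes.
  set e₂ : Prop := ((s.queue j : ℝ) - 1 < lo ∨ s.Depleted lo hi j) ∧ (s.queue j : ℝ) - 1 < hi
    with he₂
  have hdn : σ * (depletionPotential lo hi A θ (((netProcess lo hi y D).next s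
        (Sum.inr j)).Depleted lo hi j) (((netProcess lo hi y D).next s (Sum.inr j)).queue j)
        - depletionPotential lo hi A θ (s.Depleted lo hi j) (s.queue j))
      = σ * (depletionPotential lo hi A θ e₂ (s.queue j - 1)
        - depletionPotential lo hi A θ (s.Depleted lo hi j) (s.queue j)) := by
    by_cases h0 : X.rate l s (Sum.inr j) = 0
    · have h0' : σ = 0 := h0
      rw [h0', zero_mul, zero_mul]
    · have h4 : (((netProcess lo hi y D).next s (Sum.inr j)).queue j : ℝ) = s.queue j - 1 := by
        rw [netProcess_queue_inr s j j (netProcess_queue_pos hlo hlh h0), if_pos rfl]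
      have h5 := netProcess_depleted_next (lo := lo) (hi := hi) (y := y) (D := D) s (Sum.inr j) j
      rw [h4] at h5 ⊢
      rw [eq_iff_iff.2 h5]
  rw [hdn, hq]
  have hup := netProcess_depleted_next (lo := lo) (hi := hi) (y := y) (D := D) s (Sum.inl j) j
  rw [hq] at hup
  exact depletionPotential_drift_le hlo hlh hA hθ hθ1 hsmall (Nat.cast_nonneg _) (fun h => h.2)
    (NetState.le_of_not_depleted hlh) hup Iff.rfl (hl _).le hσ0 hσL hσe hσh hη hη1 (hηa j)
    (hθa j) hηθ (hb j)

theorem netProcess_hasDrift (hlo : 0 < lo) (hlh : lo < hi)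
    {l : Fin J ⊕ Fin J → ℝ} (hl : ∀ a, 0 < l a) (hy : ∀ s j, 0 ≤ y s j)
    {A θ L η ε b : ℝ} (hA : 0 < A) (hθ : 0 < θ)
    (hθ1 : θ ≤ 1) (hsmall : Real.exp (-(θ * (hi - lo))) ≤ 1 / 2)
    (hL : ∀ s, (netProcess lo hi y D).totalRate l s ≤ L)
    (hyε : ∀ s j, j ∉ s → l (Sum.inr j) * y s j ≤ l (Sum.inl j) - ε)
    (hη : 0 ≤ η) (hη1 : η ≤ 1) (hηa : ∀ j, 4 * η * L * (hi + 2) ≤ l (Sum.inl j))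
    (hθa : ∀ j, 4 * l (Sum.inl j) * θ ≤ ε) (hηθ : 2 * η * L ≤ ε * θ)
    (hb0 : 0 ≤ b) (hb : ∀ j, 2 * b ≤ A * l (Sum.inl j)) (hpot : J * (2 * A * (hi + 2)) ≤ 1)
    {k : Fin J → ℝ} {h c κ κ₂ e₁ : ℝ} (hk : ∀ j, 0 ≤ k j) (hkh : ∀ j, k j ≤ h)
    (hkb : ∀ s j, k j * (l (Sum.inr j) * y s j) ≤ b)
    (hdrift : ∀ s : NetState J, c < s.work k →
      ∑ j, k j * (l (Sum.inl j) - l (Sum.inr j) * y {j | hi ≤ (s.queue j : ℝ)} j)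
        ∈ Set.Icc (-κ₂) (-κ))
    (he₁ : J * (5 * L * (2 * A * (hi + 2)) * Real.exp (-(θ * (hi - lo)))) ≤ e₁) :
    (netProcess lo hi y D).HasDrift l (NetState.work k) (NetState.potential lo hi A θ)
      (NetState.loss lo hi b) c h η κ κ₂ e₁ (L * h ^ 2) := by
  classical
  set X := netProcess lo hi y D with hX
  have hflow : ∀ (s : NetState J) j, 0 ≤ s.flow lo hi y j := fun s j => by
    unfold NetState.flow; split_ifs
    exacts [le_rfl, hy _ _]
  have hr0 : ∀ s a, 0 ≤ X.rate l s a := by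
    rintro s (j | j)
    · exact mul_nonneg (hl _).le zero_le_one
    · exact mul_nonneg (hl _).le (hflow s j)
  have hψ : ∀ (s : NetState J) j,
      0 ≤ depletionPotential lo hi A θ (s.Depleted lo hi j) (s.queue j) ∧
        depletionPotential lo hi A θ (s.Depleted lo hi j) (s.queue j) ≤ 2 * A * (hi + 2) :=
    fun s j => depletionPotential_mem hlo hlh hA hθ hsmall
      (Nat.cast_nonneg _) (fun h => h.2) (NetState.le_of_not_depleted hlh)
  have hjump : ∀ s a, X.rate l s a ≠ 0 → |(X.next s a).work k - s.work k| ≤ h := by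
    rintro s (j | j) ha
    · rw [netProcess_work_inl, abs_of_nonneg (hk j)]
      exact hkh j
    · rw [netProcess_work_inr k s j (netProcess_queue_pos hlo hlh ha), abs_neg,
        abs_of_nonneg (hk j)]
      exact hkh j
  -- The drift is the nominal one plus the work that depleted queues forgo; the latter is what
  -- `loss` bounds.
  have hsum : ∀ s, ∑ a, X.rate l s a * ((X.next s a).work k - s.work k)
      = ∑ j, k j * (l (Sum.inl j) - l (Sum.inr j) * y {j | hi ≤ (s.queue j : ℝ)} j)
        + ∑ j, if s.Depleted lo hi j then
          k j * (l (Sum.inr j) * y {j | hi ≤ (s.queue j : ℝ)} j) else 0 := by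
    intro s
    rw [netProcess_sum_rate, ← Finset.sum_add_distrib]
    refine Finset.sum_congr rfl fun j _ => ?_
    rw [netProcess_work_inl]
    have h1 : l (Sum.inr j) * s.flow lo hi y j * ((X.next s (Sum.inr j)).work k - s.work k)
        = l (Sum.inr j) * s.flow lo hi y j * (-k j) := by
      by_cases h0 : X.rate l s (Sum.inr j) = 0
      · have h0' : l (Sum.inr j) * s.flow lo hi y j = 0 := h0
        rw [h0', zero_mul, zero_mul]
      · rw [netProcess_work_inr k s j (netProcess_queue_pos hlo hlh h0)]
    rw [h1, NetState.flow]
    split_ifs <;> ring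
  refine ⟨hr0, fun s => Finset.sum_nonneg fun j _ => mul_nonneg (hk j) (Nat.cast_nonneg _),
    fun s => Finset.sum_nonneg fun j _ => (hψ s j).1,
    fun s => ?_, fun s => Finset.sum_nonneg fun j _ => ?_, hjump, fun s hs => ?_, fun s hs => ?_,
    fun s => ?_, fun s => ?_⟩
  · refine (Finset.sum_le_sum fun j _ => (hψ s j).2).trans ?_
    simpa using hpot
  · split_ifs
    exacts [hb0, le_rfl]
  · rw [hsum]
    refine add_le_add (hdrift s hs).2 (Finset.sum_le_sum fun j _ => ?_)
    split_ifs
    exacts [hkb _ j, le_rfl]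
  · rw [hsum]
    refine (hdrift s hs).1.trans (le_add_of_nonneg_right (Finset.sum_nonneg fun j _ => ?_))
    split_ifs
    exacts [mul_nonneg (hk j) (mul_nonneg (hl _).le (hy _ _)), le_rfl]
  · have h1 : ∀ a, X.rate l s a * ((X.next s a).work k - s.work k) ^ 2
        ≤ X.rate l s a * h ^ 2 := by
      intro a
      by_cases ha : X.rate l s a = 0
      · rw [ha, zero_mul, zero_mul]
      · refine mul_le_mul_of_nonneg_left ?_ (hr0 s a)
        rw [← sq_abs]
        exact pow_le_pow_left₀ (abs_nonneg _) (hjump s a ha) 2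
    refine (Finset.sum_le_sum fun a _ => h1 a).trans ?_
    rw [← Finset.sum_mul]
    exact mul_le_mul_of_nonneg_right (hL s) (sq_nonneg h)
  · exact (netProcess_potential_drift_le hlo hlh hl hy hA hθ hθ1 hsmall hL hyε hη hη1 hηa hθa hηθ
      hb s).trans (add_le_add_right he₁ _)

end NetDrift

/-! ### Asymptotics in the scaling parameter -/

namespace Network

variable {I J m : ℕ} {N : Network I J}

theorem sum_K_mul_le (i : Fin I) {f : Fin J → ℝ} {c : ℝ} (hc : 0 ≤ c)
    (hf : ∀ j, i ∈ N.res j → f j ≤ c) : ∑ j, N.K i j * f j ≤ J * c := by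
  have : ∀ j ∈ Finset.univ, N.K i j * f j ≤ c := fun j _ => by
    simp only [K, Matrix.of_apply]
    split_ifs with h
    · rw [one_mul]; exact hf j h
    · rw [zero_mul]; exact hc
  simpa using Finset.sum_le_sum this

theorem K_mem (i : Fin I) (j : Fin J) : 0 ≤ N.K i j ∧ N.K i j ≤ 1 := by
  simp only [K, Matrix.of_apply]
  split_ifs <;> norm_num

theorem GR_apply (r : ℝ) (i : Fin I) (j : Fin J) : N.GR r i j = N.K i j / N.muR r j := by
  rw [GR, Matrix.mul_diagonal, mul_one_div]

theorem netProcess_totalRate_mem [Nonempty (Fin J)] {lo hi r a₀ M Y : ℝ}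
    {y : Set (Fin J) → Fin J → ℝ} {D : (Fin J → ℤ) → Prop}
    (hy : ∀ s j, 0 ≤ y s j ∧ y s j ≤ Y) (hY : 0 ≤ Y) (hmu : ∀ j, 0 ≤ N.muR r j)
    (ha₀ : 0 ≤ a₀) (hlam : ∀ j, a₀ ≤ N.lamR r j ∧ N.lamR r j ≤ M) (hmuM : ∀ j, N.muR r j ≤ M)
    (s : NetState J) :
    a₀ ≤ (netProcess lo hi y D).totalRate (N.clockRate r) s ∧
      (netProcess lo hi y D).totalRate (N.clockRate r) s ≤ J * (M + M * Y) := by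
  have h1 : (netProcess lo hi y D).totalRate (N.clockRate r) s
      = ∑ j, (N.lamR r j + N.muR r j * s.flow lo hi y j) := by
    have := netProcess_sum_rate (lo := lo) (hi := hi) (y := y) (D := D) (N.clockRate r) s
      (fun _ => 1)
    simpa [JumpProcess.totalRate, clockRate] using this
  have hf := NetState.flow_mem (lo := lo) (hi := hi) hy hY s
  rw [h1]
  constructor
  · obtain ⟨j⟩ := ‹Nonempty (Fin J)›
    have h2 : ∀ j ∈ Finset.univ, 0 ≤ N.lamR r j + N.muR r j * s.flow lo hi y j := fun j _ =>
      add_nonneg (ha₀.trans (hlam j).1) (mul_nonneg (hmu j) (hf j).1)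
    have h3 := Finset.single_le_sum h2 (Finset.mem_univ j)
    linarith [(hlam j).1, mul_nonneg (hmu j) (hf j).1]
  · have : ∀ j ∈ Finset.univ, N.lamR r j + N.muR r j * s.flow lo hi y j ≤ M + M * Y :=
      fun j _ => add_le_add (hlam j).2
        (mul_le_mul (hmuM j) (hf j).2 (hf j).1 ((hmu j).trans (hmuM j)))
    simpa [mul_add] using Finset.sum_le_sum this

theorem sum_GR_mul_drift_mem [Nonempty (Fin J)] (hN : N.Basic) (hloc : N.LocalTraffic)
    (hheavy : N.HeavyTraffic) {ρ : Fin m → Fin J} {r α c₂ κ κ₂ : ℝ} (hr : 1 ≤ r)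
    (hα : α ≤ 1) (hc₂ : 0 < c₂) (hmu : ∀ j, (⨅ j, N.mu j) / 2 ≤ N.muR r j) (i : Fin I)
    (hgap : r * ∑ j, N.K i j * (N.load j - N.loadR r j) ∈ Set.Icc κ κ₂)
    (s : NetState J) (hs : N.c₃ c₂ < s.work fun j => N.GR r i j / r) :
    ∑ j, N.GR r i j / r * (N.lamR r j
      - N.muR r j * N.rate ρ {j | c₂ * r ^ α ≤ (s.queue j : ℝ)} j)
      ∈ Set.Icc (-(κ₂ / r ^ 2)) (-(κ / r ^ 2)) := by
  have hr0 : 0 < r := zero_lt_one.trans_le hr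
  have hmu0 : 0 < ⨅ j, N.mu j := by
    obtain ⟨j₀, hj₀⟩ := Finite.exists_min N.mu
    exact (hheavy.mu_pos j₀).trans_le (le_ciInf hj₀)
  -- Without a stocked queue at `i`, its queues are below `c₂ * r`, and with `muR` at least half of
  -- the smallest `mu` the workload is at most `c₃`.
  have hstock : ∃ l ∈ {j | c₂ * r ^ α ≤ (s.queue j : ℝ)}, i ∈ N.res l := by
    by_contra! h
    refine absurd hs (not_lt.2 ?_)
    have h1 : s.work (fun j => N.GR r i j / r)
        = ∑ j, N.K i j * ((s.queue j : ℝ) / (N.muR r j * r)) :=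
      Finset.sum_congr rfl fun j _ => by
        change N.GR r i j / r * _ = _
        rw [GR_apply]; ring
    rw [h1]
    refine (sum_K_mul_le i (c := c₂ / ((⨅ j, N.mu j) / 2)) (by positivity) fun j hj => ?_).trans
      (le_of_eq (by unfold c₃; field_simp))
    have h2 : (s.queue j : ℝ) < c₂ * r ^ α := not_le.1 fun h' => h j h' hj
    have h3 : r ^ α ≤ r := by
      simpa using Real.rpow_le_rpow_of_exponent_le hr hα
    have hmuj := hmu j
    have h4 : 0 < N.muR r j := hN.muR_pos r hr0 j
    rw [div_le_div_iff₀ (by positivity) (by positivity)]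
    have h5 : (s.queue j : ℝ) ≤ c₂ * r := h2.le.trans (mul_le_mul_of_nonneg_left h3 hc₂.le)
    calc (s.queue j : ℝ) * ((⨅ j, N.mu j) / 2) ≤ c₂ * r * N.muR r j :=
          mul_le_mul h5 hmuj (by positivity) (by positivity)
      _ = _ := by ring
  have h1 := sum_K_mul_rate hN hloc hheavy (ρ := ρ) _ i hstock
  have hC : N.C i = ∑ j, N.K i j * N.load j := by rw [hheavy.critical]; rfl
  have h2 : ∑ j, N.GR r i j / r * (N.lamR r j
      - N.muR r j * N.rate ρ {j | c₂ * r ^ α ≤ (s.queue j : ℝ)} j)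
      = -(r * ∑ j, N.K i j * (N.load j - N.loadR r j)) / r ^ 2 := by
    have h3 : ∀ j, N.GR r i j / r * (N.lamR r j
        - N.muR r j * N.rate ρ {j | c₂ * r ^ α ≤ (s.queue j : ℝ)} j)
        = (N.K i j * N.loadR r j
          - N.K i j * N.rate ρ {j | c₂ * r ^ α ≤ (s.queue j : ℝ)} j) / r := by
      intro j
      have := (hN.muR_pos r hr0 j).ne'
      rw [GR_apply, loadR]
      field_simp
    simp_rw [h3]
    rw [← Finset.sum_div, Finset.sum_sub_distrib, h1, hC]
    simp_rw [mul_sub]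
    rw [Finset.sum_sub_distrib]
    field_simp
    ring
  rw [h2, neg_div]
  have hr2 : 0 < r ^ 2 := by positivity
  exact ⟨neg_le_neg (div_le_div_of_nonneg_right hgap.2 hr2.le),
    neg_le_neg (div_le_div_of_nonneg_right hgap.1 hr2.le)⟩

theorem tendsto_gap {b : Fin J → ℝ}
    (hb : ∀ j, Tendsto (fun r => r * (N.load j - N.loadR r j)) atTop (𝓝 (b j))) (i : Fin I) :
    Tendsto (fun r => r * ∑ j, N.K i j * (N.load j - N.loadR r j)) atTop
      (𝓝 ((N.K *ᵥ b) i)) := by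
  have h : Tendsto (fun r => ∑ j, N.K i j * (r * (N.load j - N.loadR r j))) atTop
      (𝓝 (∑ j, N.K i j * b j)) := tendsto_finsetSum _ fun j _ => (hb j).const_mul _
  refine h.congr fun r => ?_
  rw [Finset.mul_sum]
  exact Finset.sum_congr rfl fun j _ => by ring

end Network

theorem tendsto_rpow_add_div {α c : ℝ} (hα : α < 1) :
    Tendsto (fun r : ℝ => (c * r ^ α + 2) / r) atTop (𝓝 0) := by
  have h1 : Tendsto (fun r : ℝ => c * r ^ (-(1 - α)) + 2 * r⁻¹) atTop (𝓝 (c * 0 + 2 * 0)) :=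
    ((tendsto_rpow_neg_atTop (by linarith)).const_mul c).add (tendsto_inv_atTop_zero.const_mul 2)
  rw [mul_zero, mul_zero, add_zero] at h1
  refine h1.congr' ?_
  filter_upwards [eventually_gt_atTop 0] with r hr
  rw [neg_sub, Real.rpow_sub_one hr.ne']
  ring

theorem tendsto_sq_mul_exp_neg_rpow {α c : ℝ} (hα : 0 < α) (hc : 0 < c) :
    Tendsto (fun r : ℝ => r ^ 2 * Real.exp (-(c * r ^ α))) atTop (𝓝 0) := by
  have h1 := (tendsto_rpow_mul_exp_neg_mul_atTop_nhds_zero (2 / α) c hc).comp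
    (tendsto_rpow_atTop hα)
  refine h1.congr' ?_
  filter_upwards [eventually_gt_atTop 0] with r hr
  simp only [Function.comp_apply]
  rw [← Real.rpow_mul hr.le, mul_div_cancel₀ _ hα.ne', neg_mul]
  norm_cast

/-! ### Choice of the constants for the drift condition. -/

namespace Network

variable {I J m : ℕ} {N : Network I J}

/-- The orders of magnitude are: jumps and losses `1/r`, drift and second moments `1/r²`, potential
`r^(α-1)`, and a potential error that is exponentially small in `r^α`. Since `0 < α < 1`, all
requirements hold for large `r`. -/
theorem exists_hasDrift [Nonempty (Fin J)] [Nonempty (Fin I)] (hN : N.Basic)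
    (hloc : N.LocalTraffic) (hheavy : N.HeavyTraffic) {ρ : Fin m → Fin J}
    (hρ : BijOn ρ univ N.Sm) {α c₁ c₂ : ℝ} (hα : 0 < α) (hα' : α < 1) (hc₁ : 0 < c₁)
    (hc₂ : c₁ < c₂) :
    ∃ Y γ κ κ₂ L a₀ : ℝ, 0 < γ ∧ γ ≤ 1 ∧ 0 < κ ∧ 0 < κ₂ ∧ 0 < L ∧ 0 < a₀ ∧ 0 ≤ Y ∧
      (∀ s j, 0 ≤ N.rate ρ s j ∧ N.rate ρ s j ≤ Y) ∧
      ∀ᶠ r in atTop, ∀ (i : Fin I) (D : (Fin J → ℤ) → Prop),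
        (∀ s, a₀ ≤ (netProcess (c₁ * r ^ α) (c₂ * r ^ α) (N.rate ρ) D).totalRate
          (N.clockRate r) s) ∧
        (∀ s, (netProcess (c₁ * r ^ α) (c₂ * r ^ α) (N.rate ρ) D).totalRate
          (N.clockRate r) s ≤ L) ∧
        ∃ (Ψ B : NetState J → ℝ) (h η e₁ e₂ : ℝ), γ * h ≤ 1 ∧ 2 * (γ * h) ≤ η ∧
          γ ^ 2 * e₂ + e₁ ≤ κ / r ^ 2 * γ / 2 ∧
          (netProcess (c₁ * r ^ α) (c₂ * r ^ α) (N.rate ρ) D).HasDrift (N.clockRate r)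
            (NetState.work fun j => N.GR r i j / r) Ψ B (N.c₃ c₂) h η (κ / r ^ 2) (κ₂ / r ^ 2)
            e₁ e₂ := by
  obtain ⟨ε₀, Y, hε₀, hY, hy, hyε⟩ := exists_rate_bounds hN hheavy hρ
  obtain ⟨b, hb, hKb⟩ := hheavy.drift
  have hmu0 : 0 < ⨅ j, N.mu j := by
    obtain ⟨j₀, hj₀⟩ := Finite.exists_min N.mu
    exact (hheavy.mu_pos j₀).trans_le (le_ciInf hj₀)
  have hmule : ∀ j, ⨅ j, N.mu j ≤ N.mu j := ciInf_le (Finite.bddBelow_range _)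
  obtain ⟨κ, hκ, hκb⟩ : ∃ κ, 0 < κ ∧ ∀ i, κ < (N.K *ᵥ b) i := by
    obtain ⟨i₀, hi₀⟩ := Finite.exists_min (N.K *ᵥ b)
    exact ⟨(N.K *ᵥ b) i₀ / 2, half_pos (hKb i₀), fun i =>
      (half_lt_self (hKb i₀)).trans_le (hi₀ i)⟩
  obtain ⟨κ₂, hκ₂, hκb₂⟩ : ∃ κ₂, 0 < κ₂ ∧ ∀ i, (N.K *ᵥ b) i < κ₂ := by
    obtain ⟨i₀, hi₀⟩ := Finite.exists_max (N.K *ᵥ b)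
    exact ⟨(N.K *ᵥ b) i₀ + 1, by linarith [hKb i₀], fun i => (hi₀ i).trans_lt (lt_add_one _)⟩
  obtain ⟨a₀, ha₀, hla₀⟩ : ∃ a₀, 0 < a₀ ∧ ∀ j, a₀ < N.lam j := by
    obtain ⟨j₀, hj₀⟩ := Finite.exists_min N.lam
    exact ⟨N.lam j₀ / 2, half_pos (hheavy.lam_pos j₀), fun j =>
      (half_lt_self (hheavy.lam_pos j₀)).trans_le (hj₀ j)⟩
  obtain ⟨M, hM, hlM, hmM⟩ : ∃ M, 0 < M ∧ (∀ j, N.lam j < M) ∧ ∀ j, N.mu j < M := by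
    obtain ⟨j₀, hj₀⟩ := Finite.exists_max fun j => max (N.lam j) (N.mu j)
    refine ⟨max (N.lam j₀) (N.mu j₀) + 1, ?_, fun j => ?_, fun j => ?_⟩
    · linarith [le_max_left (N.lam j₀) (N.mu j₀), hheavy.lam_pos j₀]
    · linarith [le_max_left (N.lam j) (N.mu j), hj₀ j]
    · linarith [le_max_right (N.lam j) (N.mu j), hj₀ j]
  set μ₀ := (⨅ j, N.mu j) / 2 with hμ₀
  have hμ₀0 : 0 < μ₀ := half_pos hmu0
  set L := J * (M + M * Y) with hL
  have hJ : (0 : ℝ) < J := by exact_mod_cast Fin.pos_iff_nonempty.2 ‹_›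
  have hL0 : 0 < L := by positivity
  set ε := μ₀ * ε₀ with hε
  have hε0 : 0 < ε := by positivity
  set θ := min 1 (ε / (4 * M)) with hθ
  have hθ0 : 0 < θ := lt_min one_pos (by positivity)
  have hθM : 4 * M * θ ≤ ε := by
    have : θ ≤ ε / (4 * M) := min_le_right _ _
    rwa [le_div_iff₀ (by positivity), mul_comm] at this
  set k := 1 / μ₀ with hk
  have hk0 : 0 < k := by positivity
  -- The second order term takes a quarter of the drift; `e₁` gets another quarter.
  set γ := min 1 (κ / (4 * (L * k ^ 2))) with hγ
  have hγ0 : 0 < γ := lt_min one_pos (by positivity)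
  have hγL : γ * (L * k ^ 2) ≤ κ / 4 := by
    have : γ ≤ κ / (4 * (L * k ^ 2)) := min_le_right _ _
    rw [le_div_iff₀ (by positivity)] at this
    linarith
  -- With slope `A = a / r` the arrivals at a depleted queue, at rate at least `a₀`, pay twice the
  -- loss `Y / r`.
  set a := 2 * Y / a₀ with ha
  have ha0 : 0 < a := by positivity
  have h1 : ∀ᶠ r in atTop, ∀ j, a₀ ≤ N.lamR r j ∧ N.lamR r j ≤ M :=
    eventually_all.2 fun j => ((hheavy.lam_tendsto j).eventually_const_le (hla₀ j)).and
      ((hheavy.lam_tendsto j).eventually_le_const (hlM j))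
  have h2 : ∀ᶠ r in atTop, ∀ j, μ₀ ≤ N.muR r j ∧ N.muR r j ≤ M :=
    eventually_all.2 fun j => ((hheavy.mu_tendsto j).eventually_const_le
      ((half_lt_self hmu0).trans_le (hmule j))).and
      ((hheavy.mu_tendsto j).eventually_le_const (hmM j))
  have h3 : ∀ᶠ r in atTop, ∀ j, N.muR r j * (N.load j - ε₀) - N.lamR r j ≤ -ε :=
    eventually_all.2 fun j => (((hheavy.mu_tendsto j).mul_const _).sub
      (hheavy.lam_tendsto j)).eventually_le_const (by
        have e : N.mu j * N.load j = N.lam j := mul_div_cancel₀ _ (hheavy.mu_pos j).ne'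
        have := mul_lt_mul_of_pos_right ((half_lt_self hmu0).trans_le (hmule j)) hε₀
        rw [mul_sub, e, hε, hμ₀]
        linarith)
  have h4 : ∀ᶠ r in atTop, ∀ i, r * ∑ j, N.K i j * (N.load j - N.loadR r j) ∈ Set.Icc κ κ₂ :=
    eventually_all.2 fun i => ((tendsto_gap hb i).eventually_const_le (hκb i)).and
      ((tendsto_gap hb i).eventually_le_const (hκb₂ i))
  have hp := tendsto_rpow_add_div (c := c₂) hα'
  have he := tendsto_sq_mul_exp_neg_rpow (c := θ * (c₂ - c₁)) hα
    (mul_pos hθ0 (sub_pos.2 hc₂))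
  have h5 := he.eventually_le_const (show (0 : ℝ) < 1 / 2 by norm_num)
  have h6 := (hp.const_mul (8 * γ * k * L)).eventually_le_const
    (show 8 * γ * k * L * 0 < a₀ by rwa [mul_zero])
  have h7 := (hp.const_mul (J * (2 * a))).eventually_le_const
    (show J * (2 * a) * 0 < (1 : ℝ) by rw [mul_zero]; exact one_pos)
  have h8 := ((hp.mul he).const_mul (J * (10 * L * a))).eventually_le_const
    (show J * (10 * L * a) * (0 * 0) < κ * γ / 4 by rw [mul_zero, mul_zero]; positivity)
  refine ⟨Y, γ, κ, κ₂, L, a₀, hγ0, min_le_left _ _, hκ, hκ₂, hL0, ha₀, hY.le, hy, ?_⟩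
  filter_upwards [h1, h2, h3, h4, h5, h6, h7, h8, eventually_ge_atTop 1,
    eventually_ge_atTop (2 * γ * k), eventually_ge_atTop (4 * γ * k * L / (ε * θ))] with
    r h1 h2 h3 h4 h5 h6 h7 h8 hr h9 h10 i D
  have hr0 : 0 < r := zero_lt_one.trans_le hr
  have hmuR0 : ∀ j, 0 < N.muR r j := hN.muR_pos r hr0
  have hrα : 0 < r ^ α := Real.rpow_pos_of_pos hr0 α
  have htot := fun s => netProcess_totalRate_mem (lo := c₁ * r ^ α) (hi := c₂ * r ^ α) (D := D)
    hy hY.le (fun j => (hmuR0 j).le) ha₀.le h1 (fun j => (h2 j).2) s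
  set lo := c₁ * r ^ α with hlo
  set hi := c₂ * r ^ α with hhi
  have hlo0 : 0 < lo := by positivity
  have hlh : lo < hi := mul_lt_mul_of_pos_right hc₂ hrα
  have hexp : Real.exp (-(θ * (hi - lo))) = Real.exp (-(θ * (c₂ - c₁) * r ^ α)) := by
    rw [hlo, hhi]; ring_nf
  refine ⟨fun s => (htot s).1, fun s => (htot s).2, NetState.potential lo hi (a / r) θ,
    NetState.loss lo hi (Y / r), k / r, 2 * (γ * (k / r)), κ * γ / 4 / r ^ 2, L * (k / r) ^ 2,
    ?_, le_rfl, ?_, ?_⟩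
  · rw [← mul_div_assoc, div_le_one hr0]
    linarith [mul_pos hγ0 hk0]
  · have e : γ ^ 2 * (L * (k / r) ^ 2) + κ * γ / 4 / r ^ 2
        = γ * (γ * (L * k ^ 2) + κ / 4) / r ^ 2 := by field_simp
    have e' : κ / r ^ 2 * γ / 2 = γ * (κ / 4 + κ / 4) / r ^ 2 := by field_simp; norm_num
    rw [e, e']
    gcongr
  · have hl : ∀ a, 0 < N.clockRate r a := by
      rintro (j | j)
      exacts [hN.lamR_pos r hr0 j, hmuR0 j]
    have hGR : ∀ j, N.GR r i j / r = N.K i j / (N.muR r j * r) := fun j => by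
      rw [GR_apply, div_div]
    refine netProcess_hasDrift hlo0 hlh hl (fun s j => (hy s j).1) (A := a / r) (θ := θ)
      (ε := ε) (by positivity) hθ0 (min_le_left _ _) ?_ (fun s => (htot s).2) ?_ (by positivity)
      ?_ ?_ ?_ ?_ (by positivity) ?_ ?_ ?_ ?_ ?_ ?_ ?_
    · rw [hexp]
      refine le_trans (le_mul_of_one_le_left (Real.exp_pos _).le ?_) h5
      exact one_le_pow₀ hr
    · intro s j hj
      have := mul_le_mul_of_nonneg_left (hyε s j hj) (hmuR0 j).le
      change N.muR r j * N.rate ρ s j ≤ N.lamR r j - ε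
      linarith [h3 j]
    · rw [← mul_div_assoc, ← mul_div_assoc, div_le_one hr0]
      linarith
    · intro j
      refine le_trans (le_of_eq ?_) (h6.trans (h1 j).1)
      rw [hhi]; ring
    · intro j
      refine le_trans ?_ hθM
      exact mul_le_mul_of_nonneg_right (mul_le_mul_of_nonneg_left (h1 j).2 (by norm_num)) hθ0.le
    · rw [div_le_iff₀ (by positivity)] at h10
      have e : 2 * (2 * (γ * (k / r))) * L = 4 * γ * k * L / r := by ring
      rw [e, div_le_iff₀ hr0]
      linarith
    · intro j
      have e : 2 * (Y / r) = a / r * a₀ := by rw [ha]; field_simp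
      rw [e]
      exact mul_le_mul_of_nonneg_left (h1 j).1 (by positivity)
    · refine le_trans (le_of_eq ?_) h7
      rw [hhi]; ring
    · intro j
      exact div_nonneg (by rw [GR_apply]; exact div_nonneg (K_mem i j).1 (hmuR0 j).le) hr0.le
    · intro j
      rw [GR_apply]
      exact div_le_div_of_nonneg_right (div_le_div₀ zero_le_one (K_mem i j).2 hμ₀0 (h2 j).1)
        hr0.le
    · intro s j
      have e : N.GR r i j / r * (N.clockRate r (Sum.inr j) * N.rate ρ s j)
          = N.K i j * N.rate ρ s j / r := by
        change N.GR r i j / r * (N.muR r j * N.rate ρ s j) = _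
        have := (hmuR0 j).ne'
        rw [GR_apply]; field_simp
      rw [e]
      refine div_le_div_of_nonneg_right ?_ hr0.le
      exact (mul_le_of_le_one_left (hy s j).1 (K_mem i j).2).trans (hy s j).2
    · intro s hs
      exact sum_GR_mul_drift_mem hN hloc hheavy hr hα'.le (hc₁.trans hc₂) (fun j => (h2 j).1) i
        (h4 i) s hs
    · rw [hexp, le_div_iff₀ (by positivity)]
      refine le_trans (le_of_eq ?_) h8
      rw [hhi]; field_simp; rw [hL]; ring

end Network

/-! ### The theorem. -/

theorem mainTheorem4 {I J m : ℕ} (N : Network I J) (hN : N.Basic) (hloc : N.LocalTraffic)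
    (hheavy : N.HeavyTraffic) (ρ : Fin m → Fin J) (hρ : N.IsViableRanking ρ)
    (α c₁ c₂ : ℝ) (hα : 0 < α) (hα' : α < 1 / 2) (hc₁ : 0 < c₁) (hc₂ : c₁ < c₂) :
    ∃ β γ R H : ℝ, 0 < β ∧ 0 < γ ∧ 0 < R ∧ 0 < H ∧
      ∀ r : ℝ, R ≤ r → ∀ (q : Fin J → ℕ) (z : Fin J → Bool)
        (Ω : Type*) [MeasurableSpace Ω] (P : Measure Ω) [IsProbabilityMeasure P]
        (η Δ : Fin J → ℕ → Ω → ℝ) (Q : Ω → ℝ → Fin J → ℤ) (B : Ω → ℝ → Fin J → ℝ),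
        N.IsRealization ρ α c₁ c₂ r q z P η Δ Q B →
        ∀ i : Fin I, N.V c₂ r β P Q i < ⊤ ∧
          ∀ t : ℝ, 0 ≤ t →
            ∫⁻ ω, ENNReal.ofReal (Real.exp (γ * N.workload r (Q ω) t i)) ∂P
              ≤ ENNReal.ofReal H *
                (1 + ENNReal.ofReal (Real.exp (-β * t)) * N.V c₂ r β P Q i) := by
  rcases isEmpty_or_nonempty (Fin I) with hI | hI
  · exact ⟨1, 1, 1, 1, one_pos, one_pos, one_pos, one_pos,
      fun r _ q z Ω _ P _ η Δ Q B _ i => hI.elim i⟩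
  have hJ : Nonempty (Fin J) := by
    obtain ⟨i⟩ := hI
    have hi : i ∈ ⋃ j ∈ N.S1, (N.res j : Set (Fin I)) := by rw [hloc]; trivial
    simp only [mem_iUnion] at hi
    exact ⟨hi.choose⟩
  obtain ⟨Y, γ, κ, κ₂, L, a₀, hγ, hγ1, hκ, hκ₂, hL, ha₀, hY, hy, hev⟩ :=
    Network.exists_hasDrift hN hloc hheavy hρ.bij hα (by linarith) hc₁ hc₂
  have hc₃ : 0 < N.c₃ c₂ := by
    obtain ⟨j₀, hj₀⟩ := Finite.exists_min N.mu
    have h1 : 0 < ⨅ j, N.mu j := (hheavy.mu_pos j₀).trans_le (le_ciInf hj₀)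
    have h2 : (0 : ℝ) < J := by exact_mod_cast Fin.pos_iff_nonempty.2 hJ
    have h3 : 0 < c₂ := hc₁.trans hc₂
    unfold Network.c₃
    positivity
  -- Half of the decay rate `κ * γ / 4`, which leaves room for the contraction argument; `c₀ = 8`
  -- follows from `β * c₀ = κ * γ`.
  set β := κ * γ / 8 with hβ
  have hβ0 : 0 < β := by positivity
  set γ₀ := min γ (β / κ₂) with hγ₀
  have hγ₀0 : 0 < γ₀ := lt_min hγ (by positivity)
  have hγ₀κ : γ₀ * κ₂ ≤ β := by
    have : γ₀ ≤ β / κ₂ := min_le_right _ _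
    rwa [le_div_iff₀ hκ₂] at this
  set H := 2 * Real.exp (γ * N.c₃ c₂) * (8 + 2 * Real.exp (γ * N.c₃ c₂))
    + Real.exp (γ₀ * (2 * N.c₃ c₂)) with hH
  have hH0 : 0 < H := by positivity
  have hpow : Tendsto (fun r : ℝ => r ^ 2) atTop atTop := tendsto_pow_atTop two_ne_zero
  -- The conditions on `r ^ 2` put the decay rate `κ * γ / 4 / r ^ 2` below the upper bound `L` and
  -- the exponent `β / r ^ 2` below the lower bound `a₀` of the total rates.
  obtain ⟨R, hR⟩ := eventually_atTop.1 ((hev.and (eventually_ge_atTop 1)).and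
    ((hpow.eventually_ge_atTop (κ * γ / 4 / L)).and (hpow.eventually_gt_atTop (β / a₀))))
  refine ⟨β, γ₀, max R 1, H, hβ0, hγ₀0, by positivity, hH0,
    fun r hr q z Ω _ P _ η Δ Q B hreal i => ?_⟩
  obtain ⟨⟨hev, hr1⟩, hrL, hra⟩ := hR r ((le_max_left _ _).trans hr)
  have hr0 : 0 < r := zero_lt_one.trans_le hr1
  have hr2 : 0 < r ^ 2 := by positivity
  have hrα : 0 < r ^ α := Real.rpow_pos_of_pos hr0 α
  have hlo : 0 < c₁ * r ^ α := by positivity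
  have hlh : c₁ * r ^ α < c₂ * r ^ α := mul_lt_mul_of_pos_right hc₂ hrα
  have hl : ∀ a, 0 < N.clockRate r a := by
    rintro (j | j)
    exacts [hN.lamR_pos r hr0 j, hN.muR_pos r hr0 j]
  set D : (Fin J → ℤ) → Prop := fun q => |(N.GR r *ᵥ fun j => (q j : ℝ)) i / r|
    ≤ 2 * N.c₃ c₂ with hDdef
  have hwork : ∀ s : NetState J, (N.GR r *ᵥ fun j => (((s.queue j : ℤ)) : ℝ)) i / r
      = s.work fun j => N.GR r i j / r := by
    intro s
    simp only [Matrix.mulVec, dotProduct, NetState.work, Finset.sum_div, Int.cast_natCast]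
    exact Finset.sum_congr rfl fun j _ => by ring
  obtain ⟨hla, hlL, Ψ, E, h, η', e₁, e₂, hγh, hη, he, hdrift⟩ := hev i D
  have hprob : ∀ a, IsProbabilityMeasure (expMeasure (N.clockRate r a)) := fun a =>
    isProbabilityMeasure_expMeasure (hl a)
  have hDs : ∀ s : NetState J, D (fun j => s.queue j)
      ↔ (s.work fun j => N.GR r i j / r) ≤ 2 * N.c₃ c₂ := fun s => by
    rw [hDdef]
    simp only
    rw [hwork, abs_of_nonneg (hdrift.w_nonneg s)]
  obtain ⟨V, hV0, hV, hbound⟩ := hdrift.exists_lintegral_le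
    (fun a => expMeasure (N.clockRate r a)) (fun a => rfl) hl (netProcess_speed_nonneg hy hY)
    hγ hγ1 hγh hη he (by positivity) hc₃ (D := fun s => D fun j => s.queue j)
    (Hit := NetState.Hit D) hDs (fun s hs => Or.inr hs)
    (fun s a => netProcess_hit_next s a) (β := β / r ^ 2) (γ₀ := γ₀) (L := L) (c₀ := 8)
    (by positivity)
    (by
      rw [show κ / r ^ 2 * γ / 4 = κ * γ / 4 / r ^ 2 by ring, div_lt_div_iff_of_pos_right hr2, hβ]
      linarith [mul_pos hκ hγ])
    (by
      rw [show κ / r ^ 2 * γ / 4 = κ * γ / 4 / r ^ 2 by ring, div_le_iff₀ hr2]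
      exact (div_le_iff₀' hL).1 hrL)
    hlL
    (fun s => lt_of_lt_of_le (by
      rw [div_lt_iff₀ hr2]
      exact (div_lt_iff₀' ha₀).1 hra) (hla s))
    hγ₀0.le (min_le_left _ _)
    (by
      rw [← mul_div_assoc]
      exact div_le_div_of_nonneg_right hγ₀κ hr2.le)
    (by rw [hβ]; ring)
  have hVeq : N.V c₂ r β P Q i = ENNReal.ofReal (V ⟨q, z, false⟩) :=
    hreal.V_eq hr0 hlo hlh hy hY D (fun a => expMeasure (N.clockRate r a)) (fun a => rfl) hl i
      (fun Q t => Iff.rfl) hβ0 (hV _)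
  refine ⟨by rw [hVeq]; exact ENNReal.ofReal_lt_top, fun t ht => ?_⟩
  have hQ := hreal.lintegral_queue_le hlo hlh hy hY D
    (fun a => expMeasure (N.clockRate r a)) (fun a => rfl) hl
    (fun q => ENNReal.ofReal (Real.exp (γ₀ * ((N.GR r *ᵥ fun j => (q j : ℝ)) i / r))))
    (t := r ^ 2 * t) (by positivity) (C := ENNReal.ofReal (H * (1 + Real.exp (-β * t)
      * V ⟨q, z, false⟩))) (fun n => by
        have := hbound n ⟨q, z, false⟩ (r ^ 2 * t) (by positivity)
          (fun hs => by simpa [NetState.Hit] using hs)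
        rw [show -(β / r ^ 2 * (r ^ 2 * t)) = -β * t by field_simp] at this
        simp_rw [hwork]
        exact this)
  refine hQ.trans (le_of_eq ?_)
  rw [hVeq, ENNReal.ofReal_mul hH0.le, ENNReal.ofReal_add zero_le_one
    (mul_nonneg (Real.exp_pos _).le (hV0 _)), ENNReal.ofReal_one,
    ENNReal.ofReal_mul (Real.exp_pos _).le]

end
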